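/- **Setting.** All logarithms are to base $2$. Fix noise variances $V_A,V_B,V_E>0$. In the Gaussian Maurer model with block length $n$, a satellite emits $U^n\in\mathbb R^n$ with a law satisfying $\frac1n\sum_i (u^{(i)})^2\le 1$ almost surely, and Alice, Bob and Eve receive $X^n=U^n+N_A^n$, $Y^n=U^n+N_B^n$, $Z^n=U^n+N_E^n$, where the noises are i.i.d. centred Gaussian with variances $V_A,V_B,V_E$, and $U^n,N_A^n,N_B^n,N_E^n$ are independent. A *protocol* chooses the law of $U^n$, lets Alice and Bob (who may use private randomness, independent of each other and of the rest) exchange finitely many messages from finite alphabets over a public channel, each message depending on what its sender holds and on the earlier messages, and computes a key $S$ (Alice) from $X^n$ and the entire communication $C$, and a key $S'$ (Bob) from $Y^n$ and $C$, both in a finite set $\mathcal S$. A rate $R$ is *achievable* if for every $\epsilon>0$ and all sufficiently large $n$ there is a protocol with $\Pr[S\ne S']\le\epsilon$, $H(S\mid CZ^n)\ge\log|\mathcal S|-\epsilon$ and $\frac1n\log|\mathcal S|\ge R-\epsilon$. The secret key rate $R_S(V_A,V_B,V_E)$ is the supremum of all achievable rates. **Selected bits.** Let $U$ be uniform on $\{1,-1\}$,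 and let $(X,Y,Z)$ be the corresponding received signals at one time. Let $0<a_1\le\dots\le a_K$. The reliability level $W_A\in\{0,\dots,K\}$ of Alice is $0$ if $|X|\le a_1$, $j$ if $a_j<|X|\le a_{j+1}$ ($1\le j<K$), and $K$ if $|X|>a_K$; $W_B$ is defined in the same way from $Y$. Let $\tilde X_\Delta=1$ if $X\ge0$ and $0$ otherwise; $\tilde Y_\Delta$ is defined in the same way from $Y$. For $w=(w_A,w_B)$ put $$D_X(w)=H(\tilde X_\Delta\mid Z,W_A=w_A,W_B=w_B)-H(\tilde X_\Delta\mid Y,W_A=w_A,W_B=w_B),$$ $$D_Y(w)=H(\tilde Y_\Delta\mid Z,W_A=w_A,W_B=w_B)-H(\tilde Y_\Delta\mid X,W_A=w_A,W_B=w_B).$$ Let $L\subseteq\{0,\dots,K\}^2$ be any set of admissible level pairs (for instance $\{1,\dots,K\}^2$ or $\{0,\dots,K\}^2$), and let $$A=\{w\in L: D_X(w)\ge\max\{0,D_Y(w)\}\},\qquad B=\{w\in L: D_Y(w)>\max\{0,D_X(w)\}\}.$$ Let $X_\Delta=\tilde X_\Delta$ if $(W_A,W_B)\in A$ and $X_\Delta=0$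 otherwise; let $Y_\Delta=\tilde Y_\Delta$ if $(W_A,W_B)\in B$ and $Y_\Delta=0$ otherwise. Put $$R^*=H(X_\Delta Y_\Delta\mid ZW_AW_B)-H(X_\Delta\mid YW_AW_B)-H(Y_\Delta\mid XW_AW_B).$$ **Proposed protocol.** $U^n$ is i.i.d. uniform on $\{1,-1\}$. Alice and Bob publish their level sequences $W_A^n$ and $W_B^n$ and determine $X_\Delta^n$ and $Y_\Delta^n$ by the above rules, time by time. Alice publishes $M_A=\varphi_A(X_\Delta^n)\in\mathcal M_A$ and Bob publishes $M_B=\varphi_B(Y_\Delta^n)\in\mathcal M_B$. Alice decodes $(M_B,X^n,W_A^n,W_B^n)$ into $\hat Y_\Delta^n$, and Bob decodes $(M_A,Y^n,W_A^n,W_B^n)$ into $\hat X_\Delta^n$. Alice draws $f$ uniformly from a two-universal family $\mathcal F$ of functions $\{0,1\}^n\times\{0,1\}^n\to\mathcal S$ (for a uniform $f\in\mathcal F$, any two distinct inputs have the same value with probability at most $1/|\mathcal S|$) and publishes it. The keys are $S=f(X_\Delta^n,\hat Y_\Delta^n)$ and $S'=f(\hat X_\Delta^n,Y_\Delta^n)$.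 **Theorem.** 1. For every $\epsilon>0$ and all sufficiently large $n$ there are finite non-empty sets $\mathcal M_A,\mathcal M_B,\mathcal S$ with $\frac1n\log|\mathcal M_A|>H(X_\Delta\mid YW_AW_B)$, $\frac1n\log|\mathcal M_B|>H(Y_\Delta\mid XW_AW_B)$ and $\frac1n\log|\mathcal S|\ge R^*-\epsilon$, together with encoders and decoders, such that for every two-universal family $\mathcal F$ the proposed protocol satisfies $\Pr[S\ne S']\le\epsilon$ and $H(S\mid CZ^n)\ge\log|\mathcal S|-\epsilon$, where $C=(W_A^n,W_B^n,M_A,M_B,f)$. 2. Consequently $R_S(V_A,V_B,V_E)\ge R^*$. 3. Moreover $$R^*=\sum_{(w_A,w_B)\in L}P_{W_AW_B}(w_A,w_B)\,\max\{0,\;D_X(w_A,w_B),\;D_Y(w_A,w_B)\}.$$ -/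

import Mathlib

open MeasureTheory ProbabilityTheory Filter Topology
open scoped NNReal ENNReal BigOperators

namespace GaussianMaurer

/-! ### Conditional entropy given an arbitrary (possibly continuous) observation -/

/-- `H(D | T)` in bits, for a random variable `D` with finitely many values and an arbitrary
random variable `T` on the probability space `(Ω, μ)`: the expectation of
`- ∑ d, P(D = d | T) log₂ P(D = d | T)`. -/
noncomputable def condEntropy {Ω 𝒟 𝒯 : Type} [MeasurableSpace Ω] [Fintype 𝒟] [MeasurableSpace 𝒯]
    (μ : Measure Ω) (D : Ω → 𝒟) (T : Ω → 𝒯) : ℝ :=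
  ∫ ω, ∑ d : 𝒟, Real.negMulLog
    ((μ⟦D ⁻¹' {d} | MeasurableSpace.comap T inferInstance⟧) ω) / Real.log 2 ∂μ

/-! ### The channel from the satellite to Alice, Bob and Eve -/

/-- The joint law of `(X, Y, Z) = (U + N_A, U + N_B, U + N_E)` when the signal `U` has law `P`, the
noises have laws `NA`, `NB`, `NE`, and `U, N_A, N_B, N_E` are independent. -/
noncomputable def receivedLaw {G : Type} [Add G] [MeasurableSpace G] (P NA NB NE : Measure G) :
    Measure (G × G × G) :=
  (P.prod (NA.prod (NB.prod NE))).map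
    (fun q => (q.1 + q.2.1, q.1 + q.2.2.1, q.1 + q.2.2.2))

/-- `n` i.i.d. centred Gaussian noises of variance `V`. -/
noncomputable def noise (n : ℕ) (V : ℝ≥0) : Measure (Fin n → ℝ) :=
  Measure.pi (fun _ => gaussianReal 0 V)

/-- The uniform distribution on `{1, -1} ⊆ ℝ`. -/
noncomputable def signLaw : Measure ℝ :=
  (2⁻¹ : ℝ≥0∞) • (Measure.dirac (1 : ℝ) + Measure.dirac (-1 : ℝ))

instance : IsProbabilityMeasure signLaw := by
  constructor
  simp only [signLaw, Measure.smul_apply, Measure.add_apply, measure_univ, smul_eq_mul]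
  rw [one_add_one_eq_two]
  exact ENNReal.inv_mul_cancel (by norm_num) (by norm_num)

/-! ### General secret key agreement protocols with public discussion -/

/-- An interactive public discussion between Alice, who holds a value in `α`, and Bob, who holds a
value in `β`.  It consists of finitely many messages; each one lies in a finite alphabet and is
computed by its sender from what that sender holds and from the messages sent before.  The index is
the type of the whole communication. -/
inductive Discussion (α β : Type) [MeasurableSpace α] [MeasurableSpace β] : Type → Type 1
  | silent : Discussion α β Unit
  | alice {C : Type} (d : Discussion α β C) {M : Type} [Finite M] (msg : C → α → M)
      (meas : ∀ c m, MeasurableSet {x | msg c x = m}) : Discussion α β (C × M)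
  | bob {C : Type} (d : Discussion α β C) {M : Type} [Finite M] (msg : C → β → M)
      (meas : ∀ c m, MeasurableSet {y | msg c y = m}) : Discussion α β (C × M)

/-- The entire communication that results from what Alice and Bob hold. -/
def Discussion.transcript {α β : Type} [MeasurableSpace α] [MeasurableSpace β] :
    {C : Type} → Discussion α β C → α → β → C
  | _, .silent, _, _ => ()
  | _, @Discussion.alice _ _ _ _ _ d _ _ msg _, x, y => (d.transcript x y, msg (d.transcript x y) x)
  | _, @Discussion.bob _ _ _ _ _ d _ _ msg _, x, y => (d.transcript x y, msg (d.transcript x y) y)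

/-- A secret key agreement protocol with block length `n`: a signal distribution for the satellite
(under the power constraint), private randomness for Alice and Bob, a public discussion, and the
maps by which Alice and Bob compute their keys from their received signals and the entire public
communication. -/
structure KeyProtocol (n : ℕ) : Type 1 where
  /-- the law of `U^n` -/
  signal : Measure (Fin n → ℝ)
  signal_prob : IsProbabilityMeasure signal
  power : ∀ᵐ u ∂signal, (∑ i, u i ^ 2) / (n : ℝ) ≤ 1
  /-- Alice's private randomness -/
  RA : Type
  [spaceA : MeasurableSpace RA]
  randA : Measure RA
  randA_prob : IsProbabilityMeasure randA
  /-- Bob's private randomness -/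
  RB : Type
  [spaceB : MeasurableSpace RB]
  randB : Measure RB
  randB_prob : IsProbabilityMeasure randB
  /-- the type of the entire public communication -/
  C : Type
  discussion : Discussion ((Fin n → ℝ) × RA) ((Fin n → ℝ) × RB) C
  /-- the key alphabet -/
  S : Type
  [fintypeS : Fintype S]
  keyA : (Fin n → ℝ) → C → S
  keyA_meas : ∀ c s, MeasurableSet {x | keyA x c = s}
  keyB : (Fin n → ℝ) → C → S
  keyB_meas : ∀ c s, MeasurableSet {y | keyB y c = s}

attribute [instance] KeyProtocol.spaceA KeyProtocol.spaceB KeyProtocol.fintypeS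

namespace KeyProtocol

variable {n : ℕ} (P : KeyProtocol n)

/-- The outcomes `((X^n, Y^n, Z^n), (private randomness of Alice, private randomness of Bob))`. -/
abbrev Sample : Type :=
  ((Fin n → ℝ) × (Fin n → ℝ) × (Fin n → ℝ)) × (P.RA × P.RB)

/-- The probability measure on the outcomes, for the noise variances `VA`, `VB`, `VE`. -/
noncomputable def law (VA VB VE : ℝ≥0) : Measure P.Sample :=
  (receivedLaw P.signal (noise n VA) (noise n VB) (noise n VE)).prod (P.randA.prod P.randB)

/-- The entire public communication `C`. -/
def comm (ω : P.Sample) : P.C :=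
  P.discussion.transcript (ω.1.1, ω.2.1) (ω.1.2.1, ω.2.2)

/-- Alice's key `S`. -/
def aliceKey (ω : P.Sample) : P.S := P.keyA ω.1.1 (P.comm ω)

/-- Bob's key `S'`. -/
def bobKey (ω : P.Sample) : P.S := P.keyB ω.1.2.1 (P.comm ω)

/-- `Pr[S ≠ S'] ≤ ε`. -/
def Agrees (VA VB VE : ℝ≥0) (ε : ℝ) : Prop :=
  (P.law VA VB VE).real {ω | P.aliceKey ω ≠ P.bobKey ω} ≤ ε

/-- `H(S | C Z^n) ≥ log₂ |S| - ε`; the communication takes finitely many values, so its type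
carries the discrete σ-algebra. -/
def Secure (VA VB VE : ℝ≥0) (ε : ℝ) : Prop :=
  letI : MeasurableSpace P.C := ⊤
  Real.logb 2 (Fintype.card P.S) - ε ≤
    condEntropy (P.law VA VB VE) P.aliceKey (fun ω => (P.comm ω, ω.1.2.2))

/-- `(1 / n) log₂ |S|`. -/
noncomputable def rate : ℝ := Real.logb 2 (Fintype.card P.S) / n

end KeyProtocol

/-- The rate `R` is achievable for the noise variances `VA`, `VB`, `VE`. -/
def Achievable (VA VB VE : ℝ≥0) (R : ℝ) : Prop :=
  ∀ ε : ℝ, 0 < ε → ∀ᶠ n : ℕ in atTop, ∃ P : KeyProtocol n,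
    P.Agrees VA VB VE ε ∧ P.Secure VA VB VE ε ∧ R - ε ≤ P.rate

/-- The secret key rate `R_S(VA, VB, VE)`: the supremum, in the extended reals, of all achievable
rates. -/
noncomputable def secretKeyRate (VA VB VE : ℝ≥0) : EReal :=
  sSup {r : EReal | ∃ R : ℝ, Achievable VA VB VE R ∧ r = (R : EReal)}

/-! ### Reliability levels, hard decisions and selection -/

/-- The reliability level of a received value: `0` if `|x| ≤ a₁`, `j` if `a_j < |x| ≤ a_{j+1}`, and
`K` if `|x| > a_K`; for nondecreasing `a` this is the number of thresholds below `|x|`. -/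
noncomputable def level {K : ℕ} (a : Fin K → ℝ) (x : ℝ) : Fin (K + 1) :=
  ⟨(Finset.univ.filter (fun j => a j < |x|)).card,
    Nat.lt_succ_of_le ((Finset.card_le_univ _).trans_eq (Fintype.card_fin K))⟩

/-- The hard decision: `1` if `x ≥ 0`, and `0` if `x < 0`. -/
noncomputable def hard (x : ℝ) : Fin 2 := if 0 ≤ x then 1 else 0

/-- The pairs `(w_A, w_B)` of levels. -/
abbrev Levels (K : ℕ) : Type := Fin (K + 1) × Fin (K + 1)

/-- The law of `(X, Y, Z)` at a single time, for the uniform `±1` signal. -/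
noncomputable def letterLaw (VA VB VE : ℝ≥0) : Measure (ℝ × ℝ × ℝ) :=
  receivedLaw signLaw (gaussianReal 0 VA) (gaussianReal 0 VB) (gaussianReal 0 VE)

section Selection

variable (VA VB VE : ℝ≥0) {K : ℕ} (a : Fin K → ℝ)

/-- The levels `(W_A, W_B)` at a single time. -/
noncomputable def levels (q : ℝ × ℝ × ℝ) : Levels K := (level a q.1, level a q.2.1)

/-- `P_{W_A W_B}(w_A, w_B)`. -/
noncomputable def levelProb (w : Levels K) : ℝ := (letterLaw VA VB VE).real (levels a ⁻¹' {w})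

/-- The law of `(X, Y, Z)` at a single time, given `(W_A, W_B) = (w_A, w_B)`. -/
noncomputable def levelLaw (w : Levels K) : Measure (ℝ × ℝ × ℝ) :=
  cond (letterLaw VA VB VE) (levels a ⁻¹' {w})

/-- Eve's ambiguity minus Bob's ambiguity about Alice's hard decision:
`H(X̃ | Z, W_A = w_A, W_B = w_B) - H(X̃ | Y, W_A = w_A, W_B = w_B)`. -/
noncomputable def gainX (w : Levels K) : ℝ :=
  condEntropy (levelLaw VA VB VE a w) (fun q => hard q.1) (fun q => q.2.2) -
    condEntropy (levelLaw VA VB VE a w) (fun q => hard q.1) (fun q => q.2.1)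

/-- Eve's ambiguity minus Alice's ambiguity about Bob's hard decision:
`H(Ỹ | Z, W_A = w_A, W_B = w_B) - H(Ỹ | X, W_A = w_A, W_B = w_B)`. -/
noncomputable def gainY (w : Levels K) : ℝ :=
  condEntropy (levelLaw VA VB VE a w) (fun q => hard q.2.1) (fun q => q.2.2) -
    condEntropy (levelLaw VA VB VE a w) (fun q => hard q.2.1) (fun q => q.1)

variable (L : Finset (Levels K))

/-- The level pairs in `L` at which Alice's hard decision is kept. -/
def setA : Set (Levels K) :=
  {w | w ∈ L ∧ max 0 (gainY VA VB VE a w) ≤ gainX VA VB VE a w}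

/-- The level pairs in `L` at which Bob's hard decision is kept. -/
def setB : Set (Levels K) :=
  {w | w ∈ L ∧ max 0 (gainX VA VB VE a w) < gainY VA VB VE a w}

open Classical in
/-- Alice's selected bit `X_Δ`, from `(W_A, W_B) = w` and `X = x`. -/
noncomputable def selX (w : Levels K) (x : ℝ) : Fin 2 :=
  if w ∈ setA VA VB VE a L then hard x else 0

open Classical in
/-- Bob's selected bit `Y_Δ`, from `(W_A, W_B) = w` and `Y = y`. -/
noncomputable def selY (w : Levels K) (y : ℝ) : Fin 2 :=
  if w ∈ setB VA VB VE a L then hard y else 0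

/-- `H(X_Δ | Y W_A W_B)`. -/
noncomputable def ambiguityX : ℝ :=
  condEntropy (letterLaw VA VB VE) (fun q => selX VA VB VE a L (levels a q) q.1)
    (fun q => (q.2.1, levels a q))

/-- `H(Y_Δ | X W_A W_B)`. -/
noncomputable def ambiguityY : ℝ :=
  condEntropy (letterLaw VA VB VE) (fun q => selY VA VB VE a L (levels a q) q.2.1)
    (fun q => (q.1, levels a q))

/-- `H(X_Δ Y_Δ | Z W_A W_B)`. -/
noncomputable def ambiguityEve : ℝ :=
  condEntropy (letterLaw VA VB VE)
    (fun q => (selX VA VB VE a L (levels a q) q.1, selY VA VB VE a L (levels a q) q.2.1))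
    (fun q => (q.2.2, levels a q))

/-- `H(X_Δ Y_Δ | Z W_A W_B) - H(X_Δ | Y W_A W_B) - H(Y_Δ | X W_A W_B)`. -/
noncomputable def keyRateBound : ℝ :=
  ambiguityEve VA VB VE a L - ambiguityX VA VB VE a L - ambiguityY VA VB VE a L

end Selection

/-! ### The proposed protocol -/

/-- `{0, 1}^n`. -/
abbrev Bits (n : ℕ) : Type := Fin n → Fin 2

/-- The possible hash functions from `{0, 1}^n × {0, 1}^n` to a key alphabet with `s` elements. -/
abbrev Hash (n s : ℕ) : Type := Bits n × Bits n → Fin s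

/-- `𝓕` is two-universal: for a uniformly chosen `f ∈ 𝓕`, two distinct inputs collide with
probability at most `1 / s`. -/
def IsTwoUniversal {n s : ℕ} (𝓕 : Finset (Hash n s)) : Prop :=
  ∀ r r' : Bits n × Bits n, r ≠ r' →
    ((𝓕.filter (fun f => f r = f r')).card : ℝ) / (𝓕.card : ℝ) ≤ 1 / (s : ℝ)

/-- Encoders of `X_Δ^n` and `Y_Δ^n` into message sets with `mA` and `mB` elements, and decoders that
use the message, the level sequences and the own received signal. -/
structure Code (n K mA mB : ℕ) where
  /-- Alice's encoder, `X_Δ^n ↦ M_A` -/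
  encA : Bits n → Fin mA
  /-- Bob's encoder, `Y_Δ^n ↦ M_B` -/
  encB : Bits n → Fin mB
  /-- Alice's decoder, with value `Ŷ_Δ^n` -/
  decA : Fin mB → (Fin n → Fin (K + 1)) → (Fin n → Fin (K + 1)) → (Fin n → ℝ) → Bits n
  decA_meas : ∀ m wA wB r, MeasurableSet {x | decA m wA wB x = r}
  /-- Bob's decoder, with value `X̂_Δ^n` -/
  decB : Fin mA → (Fin n → Fin (K + 1)) → (Fin n → Fin (K + 1)) → (Fin n → ℝ) → Bits n
  decB_meas : ∀ m wA wB r, MeasurableSet {y | decB m wA wB y = r}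

theorem signLaw_pi_power (n : ℕ) :
    ∀ᵐ u ∂(Measure.pi (fun _ : Fin n => signLaw)), (∑ i, u i ^ 2) / (n : ℝ) ≤ 1 := by
  have h1 : ∀ᵐ x ∂signLaw, x ^ 2 = 1 := by
    unfold signLaw
    refine Measure.ae_smul_measure ?_ _
    rw [ae_add_measure_iff]
    constructor <;> rw [ae_dirac_eq] <;> simp
  have h2 : ∀ᵐ u ∂(Measure.pi (fun _ : Fin n => signLaw)), ∀ i, u i ^ 2 = 1 := by
    rw [ae_all_iff]
    intro i
    exact (measurePreserving_eval (fun _ : Fin n => signLaw) i).quasiMeasurePreserving.ae h1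
  filter_upwards [h2] with u hu
  simp only [hu, Finset.sum_const, Finset.card_univ, Fintype.card_fin, nsmul_eq_mul, mul_one]
  exact div_self_le_one _

theorem measurable_level {K : ℕ} (a : Fin K → ℝ) : Measurable (level a) := by
  have h : Measurable (fun x : ℝ => (level a x : ℕ)) := by
    simp only [level, Finset.card_filter]
    refine Finset.measurable_sum _ fun j _ => ?_
    exact Measurable.ite (measurableSet_lt measurable_const continuous_abs.measurable)
      measurable_const measurable_const
  refine measurable_to_countable' fun k => ?_
  have : level a ⁻¹' {k} = (fun x : ℝ => (level a x : ℕ)) ⁻¹' {(k : ℕ)} := by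
    ext x; simp [Fin.ext_iff]
  rw [this]
  exact h (measurableSet_singleton _)

theorem measurable_hard : Measurable hard :=
  Measurable.ite measurableSet_Ici measurable_const measurable_const

theorem measurable_selX (VA VB VE : ℝ≥0) {K : ℕ} (a : Fin K → ℝ) (L : Finset (Levels K))
    (w : Levels K) : Measurable (selX VA VB VE a L w) := by
  unfold selX
  split_ifs
  · exact measurable_hard
  · exact measurable_const

theorem measurable_selY (VA VB VE : ℝ≥0) {K : ℕ} (a : Fin K → ℝ) (L : Finset (Levels K))
    (w : Levels K) : Measurable (selY VA VB VE a L w) := by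
  unfold selY
  split_ifs
  · exact measurable_hard
  · exact measurable_const

section Proposed

variable (VA VB VE : ℝ≥0) {K : ℕ} (a : Fin K → ℝ) (L : Finset (Levels K)) {n : ℕ}

/-- The level sequence of a received sequence. -/
noncomputable def levelSeq (x : Fin n → ℝ) : Fin n → Fin (K + 1) := fun i => level a (x i)

/-- `X_Δ^n`, from the level sequences and `X^n`. -/
noncomputable def selXSeq (wA wB : Fin n → Fin (K + 1)) (x : Fin n → ℝ) : Bits n :=
  fun i => selX VA VB VE a L (wA i, wB i) (x i)

/-- `Y_Δ^n`, from the level sequences and `Y^n`. -/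
noncomputable def selYSeq (wA wB : Fin n → Fin (K + 1)) (y : Fin n → ℝ) : Bits n :=
  fun i => selY VA VB VE a L (wA i, wB i) (y i)

theorem measurable_levelSeq : Measurable (levelSeq a (n := n)) :=
  measurable_pi_lambda _ fun i => (measurable_level a).comp (measurable_pi_apply i)

theorem measurable_selXSeq (wA wB : Fin n → Fin (K + 1)) :
    Measurable (selXSeq VA VB VE a L wA wB) :=
  measurable_pi_lambda _ fun i => (measurable_selX VA VB VE a L _).comp (measurable_pi_apply i)

theorem measurable_selYSeq (wA wB : Fin n → Fin (K + 1)) :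
    Measurable (selYSeq VA VB VE a L wA wB) :=
  measurable_pi_lambda _ fun i => (measurable_selY VA VB VE a L _).comp (measurable_pi_apply i)

variable {mA mB s : ℕ}

/-- The public communication of the proposed protocol: Alice sends `W_A^n`, Bob sends `W_B^n`, Alice
sends `M_A`, Bob sends `M_B`, and Alice sends the hash function that she has drawn. -/
noncomputable def proposedDiscussion (code : Code n K mA mB) :
    Discussion ((Fin n → ℝ) × Hash n s) ((Fin n → ℝ) × Unit)
      (((((Unit × (Fin n → Fin (K + 1))) × (Fin n → Fin (K + 1))) × Fin mA) × Fin mB) ×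
        Hash n s) :=
  let d₁ := Discussion.alice Discussion.silent
    (fun (_ : Unit) (x : (Fin n → ℝ) × Hash n s) => levelSeq a x.1)
    (fun _ m => ((measurable_levelSeq a).comp measurable_fst) (measurableSet_singleton m))
  let d₂ := Discussion.bob d₁
    (fun _ (y : (Fin n → ℝ) × Unit) => levelSeq a y.1)
    (fun _ m => ((measurable_levelSeq a).comp measurable_fst) (measurableSet_singleton m))
  let d₃ := Discussion.alice d₂
    (fun c x => code.encA (selXSeq VA VB VE a L c.1.2 c.2 x.1))
    (fun c m => (((measurable_of_finite code.encA).comp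
      (measurable_selXSeq VA VB VE a L c.1.2 c.2)).comp measurable_fst)
        (measurableSet_singleton m))
  let d₄ := Discussion.bob d₃
    (fun c y => code.encB (selYSeq VA VB VE a L c.1.1.2 c.1.2 y.1))
    (fun c m => (((measurable_of_finite code.encB).comp
      (measurable_selYSeq VA VB VE a L c.1.1.2 c.1.2)).comp measurable_fst)
        (measurableSet_singleton m))
  Discussion.alice d₄ (fun _ x => x.2)
    (fun _ m => measurable_snd (measurableSet_singleton m))

/-- The proposed protocol: i.i.d. uniform `±1` signals; Alice draws `f` uniformly from `𝓕`; after the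
public communication Alice's key is `f (X_Δ^n, Ŷ_Δ^n)` and Bob's key is `f (X̂_Δ^n, Y_Δ^n)`. -/
noncomputable def proposedProtocol (code : Code n K mA mB) (𝓕 : Finset (Hash n s))
    (h𝓕 : 𝓕.Nonempty) : KeyProtocol n where
  signal := Measure.pi (fun _ => signLaw)
  signal_prob := inferInstance
  power := signLaw_pi_power n
  RA := Hash n s
  randA := (PMF.uniformOfFinset 𝓕 h𝓕).toMeasure
  randA_prob := inferInstance
  RB := Unit
  randB := Measure.dirac ()
  randB_prob := inferInstance
  C := ((((Unit × (Fin n → Fin (K + 1))) × (Fin n → Fin (K + 1))) × Fin mA) × Fin mB) × Hash n s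
  discussion := proposedDiscussion VA VB VE a L code
  S := Fin s
  keyA := fun x c => match c with
    | (((((_, wA), wB), _), mB), f) => f (selXSeq VA VB VE a L wA wB x, code.decA mB wA wB x)
  keyA_meas := by
    rintro ⟨⟨⟨⟨⟨_, wA⟩, wB⟩, m⟩, m'⟩, f⟩ k
    have h1 : Measurable (code.decA m' wA wB) :=
      measurable_to_countable' fun r => code.decA_meas m' wA wB r
    exact ((measurable_of_finite f).comp
      ((measurable_selXSeq VA VB VE a L wA wB).prodMk h1)) (measurableSet_singleton k)
  keyB := fun y c => match c with
    | (((((_, wA), wB), mA), _), f) => f (code.decB mA wA wB y, selYSeq VA VB VE a L wA wB y)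
  keyB_meas := by
    rintro ⟨⟨⟨⟨⟨_, wA⟩, wB⟩, m⟩, m'⟩, f⟩ k
    have h1 : Measurable (code.decB m wA wB) :=
      measurable_to_countable' fun r => code.decB_meas m wA wB r
    exact ((measurable_of_finite f).comp
      (h1.prodMk (measurable_selYSeq VA VB VE a L wA wB))) (measurableSet_singleton k)

end Proposed

end GaussianMaurer

/-!
The proof rests on exponential bounds for Rényi sums, which replace typical sequences, and on an
entropy form of the leftover hash lemma, which needs no smoothing.

*Conditional distributions.* A random variable `D` with finitely many values has a regular
conditional distribution `q d t` given any observation `T` (`exists_isCondLaw`), and `H(D | T)` is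
the mean of the entropies of the vectors `q · (T ω)` (`IsCondLaw.condEntropy_mul_log_two`). For i.i.d.
pairs the conditional distribution of a block is the product (`IsCondLaw.pi`). Since
`p ^ (1 + t) ≤ p + t p log p + 16 t ^ 2` for `p ∈ [0, 1]` and `|t| ≤ 1 / 2`, whatever the law of
`T`, the Rényi sums of a block satisfy
`E ∑ q ^ (1 + t) ≤ exp (n (-t H + O(t ^ 2)))` (`IsCondLaw.integral_sum_prod_rpow_le`). Negative `t`
serves source coding and positive `t` serves privacy amplification.

*Source coding.* Random binning with a threshold decoder transmits `X_Δ^n` to Bob and `Y_Δ^n` to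
Alice with exponentially small error at rates above the conditional entropies
(`IsCondLaw.exists_code`, `IsCondLaw.exists_block_code`).

*Privacy amplification.* Let `r` have law `q` and let `m = φ r` be public. For a uniform member `f`
of a two-universal family with `s` values, the defect `log s - H(f(r) | m, f)` is the mean of
`log (s P(f(r), m) / P(m))`. Jensen's inequality over `f`, for fixed `r`, bounds it by the mean of
`log (1 + s q(r) / P(m))` (`log_card_sub_le_average_entropy`). Messages of very small mass are rare
because there are few messages, and for the others `log (1 + x) ≤ x ^ θ / θ` leads to a Rényi sum
(`sum_log_excess_le`, `log_card_sub_le_condEntropy_hash`). Alice's key is hashed from her decision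
about Bob's bits instead of the bits themselves; the decisions are wrong with exponentially small
probability, so this changes the conditional entropy by `o(1)` even though the key has linear length
(`condEntropy_le_add_of_ne`).

*Rates.* With `|M_A| |M_B| |S| ≈ 2 ^ (n (H(X_Δ | Y W) + H(Y_Δ | X W) + R^* - ε))`, which is
`2 ^ (n (H(X_Δ Y_Δ | Z W) - ε))`, the defect tends to zero. The family of all functions is
two-universal, so `R^*` is achievable. The formula for `R^*` comes from averaging all three
entropies over the level pairs (`condEntropy_prod_finite`): at each pair at most one of the two bits
is kept, namely the one with the larger gain, and none is kept if both gains are negative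
(`levelProb_mul_selected_gain`).
-/

namespace GaussianMaurer

/-! ### Regular conditional distributions of finite-valued random variables -/

/-- `q d t` is a version of `P(D = d | T = t)` that is a probability vector for *every* `t`. The
defining property is stated as an identity of measures on the range of `T`, so that it passes to
products without approximating measurable sets by boxes. -/
structure IsCondLaw {Ω 𝒟 𝒯 : Type} [MeasurableSpace Ω] [Fintype 𝒟] [MeasurableSpace 𝒯]
    (μ : Measure Ω) (D : Ω → 𝒟) (T : Ω → 𝒯) (q : 𝒟 → 𝒯 → ℝ) : Prop where
  measurable_obs : Measurable T
  measurableSet_fiber : ∀ d, MeasurableSet (D ⁻¹' {d})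
  measurable : ∀ d, Measurable (q d)
  nonneg : ∀ d t, 0 ≤ q d t
  sum_eq_one : ∀ t, ∑ d, q d t = 1
  map_restrict : ∀ d, (μ.restrict (D ⁻¹' {d})).map T =
    (μ.map T).withDensity fun t => ENNReal.ofReal (q d t)

section Integrals

variable {Ω 𝒟 : Type} [MeasurableSpace Ω] [Fintype 𝒟] {μ : Measure Ω} {D : Ω → 𝒟}

theorem measurable_finite_comp {g : 𝒟 → Ω → ℝ} (hD : ∀ d, MeasurableSet (D ⁻¹' {d}))
    (hg : ∀ d, Measurable (g d)) : Measurable fun ω => g (D ω) ω := by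
  classical
  have h : (fun ω => g (D ω) ω) = fun ω => ∑ d, (D ⁻¹' {d}).indicator (g d) ω := by
    funext ω
    rw [Finset.sum_eq_single (D ω)]
    · simp
    · intro d _ hd
      simp [Set.indicator, Ne.symm hd]
    · simp
  rw [h]
  exact Finset.measurable_sum _ fun d _ => (hg d).indicator (hD d)

theorem integrable_of_measurable_of_bounded [IsFiniteMeasure μ] {f : Ω → ℝ} (hf : Measurable f)
    {C : ℝ} (hC : ∀ ω, |f ω| ≤ C) : Integrable f μ :=
  Integrable.of_bound hf.aestronglyMeasurable C (ae_of_all _ hC)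

theorem integral_finite_comp {g : 𝒟 → Ω → ℝ} (hD : ∀ d, MeasurableSet (D ⁻¹' {d}))
    (hg : ∀ d, Integrable (g d) μ) :
    ∫ ω, g (D ω) ω ∂μ = ∑ d, ∫ ω in D ⁻¹' {d}, g d ω ∂μ := by
  classical
  have h : (fun ω => g (D ω) ω) = fun ω => ∑ d, (D ⁻¹' {d}).indicator (g d) ω := by
    funext ω
    rw [Finset.sum_eq_single (D ω)]
    · simp
    · intro d _ hd
      simp [Set.indicator, Ne.symm hd]
    · simp
  rw [h, integral_finsetSum _ fun d _ => (hg d).indicator (hD d)]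
  exact Finset.sum_congr rfl fun d _ => integral_indicator (hD d)

end Integrals

namespace IsCondLaw

variable {Ω 𝒟 𝒯 : Type} [MeasurableSpace Ω] [Fintype 𝒟] [MeasurableSpace 𝒯]
  {μ : Measure Ω} {D : Ω → 𝒟} {T : Ω → 𝒯} {q : 𝒟 → 𝒯 → ℝ}

theorem le_one (h : IsCondLaw μ D T q) (d : 𝒟) (t : 𝒯) : q d t ≤ 1 := by
  rw [← h.sum_eq_one t]
  exact Finset.single_le_sum (fun d _ => h.nonneg d t) (Finset.mem_univ d)

theorem setIntegral_eq [IsFiniteMeasure μ] (h : IsCondLaw μ D T q) (d : 𝒟) {g : 𝒯 → ℝ}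
    (hg : Measurable g) :
    ∫ ω in D ⁻¹' {d}, g (T ω) ∂μ = ∫ ω, q d (T ω) * g (T ω) ∂μ := by
  rw [← integral_map (φ := T) (f := g) h.measurable_obs.aemeasurable hg.aestronglyMeasurable,
    h.map_restrict d, integral_withDensity_eq_integral_toReal_smul
      (h.measurable d).ennreal_ofReal (by simp),
    ← integral_map (φ := T) (f := fun t => q d t * g t) h.measurable_obs.aemeasurable
      ((h.measurable d).mul hg).aestronglyMeasurable]
  simp only [ENNReal.toReal_ofReal (h.nonneg d _), smul_eq_mul]

/-- The defining property of a conditional distribution, for bounded test functions. -/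
theorem integral_eq [IsFiniteMeasure μ] (h : IsCondLaw μ D T q) {g : 𝒟 → 𝒯 → ℝ}
    (hg : ∀ d, Measurable (g d)) {C : ℝ} (hC : ∀ d t, |g d t| ≤ C) :
    ∫ ω, g (D ω) (T ω) ∂μ = ∫ ω, ∑ d, q d (T ω) * g d (T ω) ∂μ := by
  have hgT : ∀ d, Measurable fun ω => g d (T ω) := fun d => (hg d).comp h.measurable_obs
  have hqT : ∀ d, Measurable fun ω => q d (T ω) :=
    fun d => (h.measurable d).comp h.measurable_obs
  rw [integral_finite_comp (g := fun d ω => g d (T ω)) h.measurableSet_fiber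
    fun d => integrable_of_measurable_of_bounded (hgT d) fun ω => hC d _, integral_finsetSum]
  · exact Finset.sum_congr rfl fun d _ => h.setIntegral_eq d (hg d)
  · intro d _
    refine integrable_of_measurable_of_bounded (C := C) ((hqT d).mul (hgT d)) fun ω => ?_
    rw [abs_mul, abs_of_nonneg (h.nonneg d _)]
    calc q d (T ω) * |g d (T ω)| ≤ 1 * |g d (T ω)| :=
          mul_le_mul_of_nonneg_right (h.le_one d _) (abs_nonneg _)
      _ ≤ C := by rw [one_mul]; exact hC d _

theorem condExp_ae_eq [IsFiniteMeasure μ] (h : IsCondLaw μ D T q) (d : 𝒟) :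
    μ⟦D ⁻¹' {d} | MeasurableSpace.comap T inferInstance⟧ =ᵐ[μ] fun ω => q d (T ω) := by
  have hT := h.measurable_obs
  have hqT : Measurable fun ω => q d (T ω) := (h.measurable d).comp hT
  symm
  refine ae_eq_condExp_of_forall_setIntegral_eq hT.comap_le
    ((integrable_const (1 : ℝ)).indicator (h.measurableSet_fiber d)) ?_ ?_ ?_
  · intro s _ _
    refine (integrable_of_measurable_of_bounded (C := 1) hqT fun ω => ?_).integrableOn
    rw [abs_of_nonneg (h.nonneg d _)]
    exact h.le_one d _
  · rintro s ⟨B, hB, rfl⟩ -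
    have h1 := h.setIntegral_eq d (g := B.indicator 1) (measurable_one.indicator hB)
    have e1 : (fun ω => q d (T ω) * B.indicator 1 (T ω))
        = (T ⁻¹' B).indicator fun ω => q d (T ω) := by
      funext ω
      by_cases hω : T ω ∈ B <;> simp [Set.indicator, hω]
    have e2 : (fun ω => B.indicator (1 : 𝒯 → ℝ) (T ω)) = (T ⁻¹' B).indicator 1 := rfl
    rw [e1, e2, integral_indicator (hT hB), integral_indicator (hT hB)] at h1
    rw [← h1, setIntegral_indicator (h.measurableSet_fiber d), Measure.restrict_restrict (hT hB)]
    rfl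
  · exact ((h.measurable d).comp (comap_measurable T)).aestronglyMeasurable

/-- Conditional entropy through a regular conditional distribution, in nats. -/
theorem condEntropy_mul_log_two [IsFiniteMeasure μ] (h : IsCondLaw μ D T q) :
    condEntropy μ D T * Real.log 2 = ∫ ω, ∑ d, Real.negMulLog (q d (T ω)) ∂μ := by
  have hl : Real.log 2 ≠ 0 := (Real.log_pos one_lt_two).ne'
  rw [condEntropy, ← integral_mul_const]
  refine integral_congr_ae ?_
  have hall : ∀ᵐ ω ∂μ, ∀ d,
      (μ⟦D ⁻¹' {d} | MeasurableSpace.comap T inferInstance⟧) ω = q d (T ω) :=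
    ae_all_iff.2 h.condExp_ae_eq
  filter_upwards [hall] with ω hω
  simp only [hω, Finset.sum_mul]
  exact Finset.sum_congr rfl fun d _ => div_mul_cancel₀ _ hl

theorem congr (h : IsCondLaw μ D T q) {T' : Ω → 𝒯} {D' : Ω → 𝒟} (hT : T = T') (hD : D = D') :
    IsCondLaw μ D' T' q := by
  subst hT hD
  exact h

/-- A conditional distribution of a random variable under an image measure. -/
theorem of_map {Ω' : Type} [MeasurableSpace Ω'] {ν : Measure Ω'} {e : Ω' → Ω}
    (he : MeasurePreserving e ν μ) (hD : ∀ d, MeasurableSet (D ⁻¹' {d})) (hT : Measurable T)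
    (h : IsCondLaw ν (D ∘ e) (T ∘ e) q) : IsCondLaw μ D T q where
  measurable_obs := hT
  measurableSet_fiber := hD
  measurable := h.measurable
  nonneg := h.nonneg
  sum_eq_one := h.sum_eq_one
  map_restrict d := by
    rw [← he.map_eq, Measure.restrict_map he.measurable (hD d), Measure.map_map hT he.measurable,
      Measure.map_map hT he.measurable]
    exact h.map_restrict d

/-- Observing in addition an independent random variable does not change the conditional
distribution. -/
theorem prod {Ω' 𝒯' : Type} [MeasurableSpace Ω'] [MeasurableSpace 𝒯'] {ν : Measure Ω'}
    [IsProbabilityMeasure μ] [IsProbabilityMeasure ν] {F : Ω' → 𝒯'} (hF : Measurable F)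
    (h : IsCondLaw μ D T q) :
    IsCondLaw (μ.prod ν) (fun ω => D ω.1) (fun ω => (T ω.1, F ω.2)) (fun d t => q d t.1) where
  measurable_obs := (h.measurable_obs.comp measurable_fst).prodMk (hF.comp measurable_snd)
  measurableSet_fiber d := measurable_fst (h.measurableSet_fiber d)
  measurable d := (h.measurable d).comp measurable_fst
  nonneg d t := h.nonneg d _
  sum_eq_one t := h.sum_eq_one _
  map_restrict d := by
    have : IsProbabilityMeasure (ν.map F) := Measure.isProbabilityMeasure_map hF.aemeasurable
    have : IsProbabilityMeasure (μ.map T) :=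
      Measure.isProbabilityMeasure_map h.measurable_obs.aemeasurable
    have e1 : (fun ω : Ω × Ω' => D ω.1) ⁻¹' {d} = (D ⁻¹' {d}) ×ˢ Set.univ := by
      ext; simp
    have e2 : (fun ω : Ω × Ω' => (T ω.1, F ω.2)) = Prod.map T F := rfl
    rw [e1, e2, ← Measure.prod_restrict, Measure.restrict_univ,
      ← Measure.map_prod_map _ _ h.measurable_obs hF, h.map_restrict d,
      ← Measure.map_prod_map _ _ h.measurable_obs hF,
      prod_withDensity_left (h.measurable d).ennreal_ofReal]

theorem _root_.MeasureTheory.Measure.pi_withDensity_ofReal {n : ℕ} {𝒯 : Type} [MeasurableSpace 𝒯]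
    (ν : Measure 𝒯) [IsProbabilityMeasure ν] {p : Fin n → 𝒯 → ℝ} (hp : ∀ i, Measurable (p i))
    (h0 : ∀ i t, 0 ≤ p i t) (h1 : ∀ i t, p i t ≤ 1) :
    Measure.pi (fun i => ν.withDensity fun t => ENNReal.ofReal (p i t)) =
      (Measure.pi fun _ : Fin n => ν).withDensity
        fun t => ENNReal.ofReal (∏ i, p i (t i)) := by
  have hint : ∀ i, Integrable (p i) ν := fun i =>
    integrable_of_measurable_of_bounded (C := 1) (hp i) fun t => by
      rw [abs_of_nonneg (h0 i t)]; exact h1 i t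
  have (i : Fin n) : IsFiniteMeasure (ν.withDensity fun t => ENNReal.ofReal (p i t)) :=
    isFiniteMeasure_withDensity_ofReal (hint i).2
  refine Measure.pi_eq fun s hs => ?_
  rw [withDensity_apply _ (MeasurableSet.univ_pi hs), Measure.restrict_pi_pi,
    ← ofReal_integral_eq_lintegral_ofReal]
  · rw [integral_fintype_prod_eq_prod (fun i t => p i t),
      ENNReal.ofReal_prod_of_nonneg fun i _ => integral_nonneg (h0 i)]
    refine Finset.prod_congr rfl fun i _ => ?_
    rw [withDensity_apply _ (hs i), ← ofReal_integral_eq_lintegral_ofReal (hint i).integrableOn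
      (ae_of_all _ (h0 i))]
  · refine integrable_of_measurable_of_bounded (C := 1)
      (Finset.measurable_prod _ fun i _ => (hp i).comp (measurable_pi_apply i)) fun t => ?_
    rw [abs_of_nonneg (Finset.prod_nonneg fun i _ => h0 i _)]
    exact Finset.prod_le_one (fun i _ => h0 i _) fun i _ => h1 i _
  · exact ae_of_all _ fun t => Finset.prod_nonneg fun i _ => h0 i _

/-- For i.i.d. pairs the conditional distribution of the block is the product. -/
theorem pi (n : ℕ) [IsProbabilityMeasure μ] (h : IsCondLaw μ D T q) :
    IsCondLaw (Measure.pi fun _ : Fin n => μ) (fun ω i => D (ω i)) (fun ω i => T (ω i))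
      (fun d t => ∏ i, q (d i) (t i)) where
  measurable_obs := measurable_pi_lambda _ fun i => h.measurable_obs.comp (measurable_pi_apply i)
  measurableSet_fiber d := by
    have : (fun (ω : Fin n → Ω) i => D (ω i)) ⁻¹' {d} = Set.univ.pi fun i => D ⁻¹' {d i} := by
      ext ω; simp [funext_iff]
    rw [this]
    exact MeasurableSet.univ_pi fun i => h.measurableSet_fiber _
  measurable d := Finset.measurable_prod _ fun i _ =>
    (h.measurable _).comp (measurable_pi_apply i)
  nonneg d t := Finset.prod_nonneg fun i _ => h.nonneg _ _
  sum_eq_one t := by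
    classical
    have := Finset.prod_univ_sum (fun _ : Fin n => (Finset.univ : Finset 𝒟))
      (fun i d => q d (t i))
    rw [Fintype.piFinset_univ] at this
    rw [← this]
    simp [h.sum_eq_one]
  map_restrict d := by
    have e1 : (fun (ω : Fin n → Ω) i => D (ω i)) ⁻¹' {d} = Set.univ.pi fun i => D ⁻¹' {d i} := by
      ext ω; simp [funext_iff]
    have hp : IsProbabilityMeasure (μ.map T) :=
      Measure.isProbabilityMeasure_map h.measurable_obs.aemeasurable
    rw [e1, Measure.restrict_pi_pi,
      Measure.pi_map_pi (f := fun _ => T) fun i => h.measurable_obs.aemeasurable,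
      Measure.pi_map_pi (f := fun _ => T) fun i => h.measurable_obs.aemeasurable]
    simp only [h.map_restrict]
    exact Measure.pi_withDensity_ofReal _ (fun i => h.measurable _) (fun i => h.nonneg _)
      fun i => h.le_one _

end IsCondLaw

theorem exists_isCondLaw {Ω 𝒟 𝒯 : Type} [MeasurableSpace Ω] [Fintype 𝒟] [Nonempty 𝒟]
    [MeasurableSpace 𝒯] (μ : Measure Ω) [IsFiniteMeasure μ] {D : Ω → 𝒟} {T : Ω → 𝒯}
    (hD : ∀ d, MeasurableSet (D ⁻¹' {d})) (hT : Measurable T) :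
    ∃ q : 𝒟 → 𝒯 → ℝ, IsCondLaw μ D T q := by
  let _ : MeasurableSpace 𝒟 := ⊤
  have : DiscreteMeasurableSpace 𝒟 := ⟨fun _ => trivial⟩
  have hDm : Measurable D := measurable_to_countable' hD
  refine ⟨fun d t => (condDistrib D T μ t).real {d}, hT, hD, fun d => ?_, fun d t => ?_,
    fun t => ?_, fun d => ?_⟩
  · exact (Kernel.measurable_coe _ (measurableSet_singleton d)).ennreal_toReal
  · exact measureReal_nonneg
  · rw [sum_measureReal_singleton]
    simp
  · ext B hB
    have h := congrArg (fun m : Measure (𝒯 × 𝒟) => m (B ×ˢ {d}))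
      (compProd_map_condDistrib (X := T) (μ := μ) hDm.aemeasurable)
    simp only [Measure.compProd_apply_prod hB (measurableSet_singleton d)] at h
    rw [Measure.map_apply (hT.prodMk hDm) (hB.prod (measurableSet_singleton d))] at h
    rw [Measure.map_apply hT hB, Measure.restrict_apply (hT hB), withDensity_apply _ hB]
    simp only [measureReal_def, ENNReal.ofReal_toReal (measure_ne_top _ _)]
    rw [h]
    congr 1

/-! ### Properties of conditional entropy -/

section Entropy

variable {Ω 𝒟 𝒯 : Type} [MeasurableSpace Ω] [Fintype 𝒟] [MeasurableSpace 𝒯] {μ : Measure Ω}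

theorem condProb_mem_Icc {Ω : Type} {m m₀ : MeasurableSpace Ω} {μ : Measure[m₀] Ω}
    [IsFiniteMeasure μ] (hm : m ≤ m₀) {s : Set Ω} (hs : MeasurableSet[m₀] s) :
    ∀ᵐ ω ∂μ, (μ⟦s | m⟧) ω ∈ Set.Icc (0 : ℝ) 1 := by
  have hi : Integrable (s.indicator fun _ => (1 : ℝ)) μ := (integrable_const 1).indicator hs
  have h0 : 0 ≤ᵐ[μ] μ⟦s | m⟧ :=
    condExp_nonneg (ae_of_all _ fun ω => Set.indicator_nonneg (fun _ _ => zero_le_one) ω)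
  have h1 : μ⟦s | m⟧ ≤ᵐ[μ] μ[fun _ => (1 : ℝ) | m] :=
    condExp_mono hi (integrable_const 1)
      (ae_of_all _ fun ω => Set.indicator_le_self' (fun _ _ => zero_le_one) ω)
  rw [condExp_const hm] at h1
  filter_upwards [h0, h1] with ω h0 h1 using ⟨h0, h1⟩

theorem condEntropy_nonneg [IsFiniteMeasure μ] {D : Ω → 𝒟} {T : Ω → 𝒯} (hT : Measurable T)
    (hD : ∀ d, MeasurableSet (D ⁻¹' {d})) : 0 ≤ condEntropy μ D T := by
  refine integral_nonneg_of_ae ?_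
  have hall := ae_all_iff.2 fun d => condProb_mem_Icc (μ := μ) hT.comap_le (hD d)
  filter_upwards [hall] with ω hω
  exact Finset.sum_nonneg fun d _ => div_nonneg
    (Real.negMulLog_nonneg (hω d).1 (hω d).2) (Real.log_pos one_lt_two).le

/-- Conditional entropy depends on the observation only through the σ-algebra it generates. -/
theorem condEntropy_congr_comap {𝒯' : Type} [MeasurableSpace 𝒯'] {D : Ω → 𝒟} {T : Ω → 𝒯}
    {T' : Ω → 𝒯'} {g : 𝒯 → 𝒯'} {g' : 𝒯' → 𝒯} (hg : Measurable g) (hg' : Measurable g')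
    (h : ∀ ω, g (T ω) = T' ω) (h' : ∀ ω, g' (T' ω) = T ω) :
    condEntropy μ D T = condEntropy μ D T' := by
  have e : MeasurableSpace.comap T inferInstance = MeasurableSpace.comap T' inferInstance := by
    refine le_antisymm ?_ ?_
    · have : T = g' ∘ T' := funext fun ω => (h' ω).symm
      rw [this]
      exact (hg'.comp (comap_measurable T')).comap_le
    · have : T' = g ∘ T := funext fun ω => (h ω).symm
      rw [this]
      exact (hg.comp (comap_measurable T)).comap_le
  rw [condEntropy, condEntropy, e]

theorem condEntropy_congr_ae {D D' : Ω → 𝒟} {T : Ω → 𝒯} (h : D =ᵐ[μ] D') :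
    condEntropy μ D T = condEntropy μ D' T := by
  refine integral_congr_ae ?_
  have hd : ∀ d, μ⟦D ⁻¹' {d} | MeasurableSpace.comap T inferInstance⟧ =ᵐ[μ]
      μ⟦D' ⁻¹' {d} | MeasurableSpace.comap T inferInstance⟧ := fun d => by
    refine condExp_congr_ae ?_
    filter_upwards [h] with ω hω
    have hiff : ω ∈ D ⁻¹' {d} ↔ ω ∈ D' ⁻¹' {d} := by simp [hω]
    by_cases hd : ω ∈ D ⁻¹' {d}
    · rw [Set.indicator_of_mem hd, Set.indicator_of_mem (hiff.1 hd)]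
    · rw [Set.indicator_of_notMem hd, Set.indicator_of_notMem (mt hiff.2 hd)]
  filter_upwards [ae_all_iff.2 hd] with ω hω
  simp only [hω]

theorem condEntropy_comp_injective {𝒟' : Type} [Fintype 𝒟'] {i : 𝒟 → 𝒟'}
    (hi : Function.Injective i) (D : Ω → 𝒟) (T : Ω → 𝒯) :
    condEntropy μ (fun ω => i (D ω)) T = condEntropy μ D T := by
  classical
  refine integral_congr_ae (ae_of_all _ fun ω => ?_)
  have h1 : ∀ d, (fun ω => i (D ω)) ⁻¹' {i d} = D ⁻¹' {d} := fun d => by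
    ext ω; simp [hi.eq_iff]
  have h2 : ∀ d ∉ Set.range i, (fun ω => i (D ω)) ⁻¹' {d} = ∅ := fun d hd => by
    ext ω
    simp only [Set.mem_preimage, Set.mem_singleton_iff, Set.mem_empty_iff_false, iff_false]
    exact fun h => hd ⟨_, h⟩
  dsimp only
  rw [← Finset.sum_subset (Finset.subset_univ (Finset.univ.image i)),
    Finset.sum_image fun _ _ _ _ h => hi h]
  · simp only [h1]
  · intro d _ hd
    rw [h2 d (by simpa using hd)]
    simp [Set.indicator_empty]

theorem condEntropy_const [IsProbabilityMeasure μ] (d₀ : 𝒟) {T : Ω → 𝒯} (hT : Measurable T) :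
    condEntropy μ (fun _ => d₀) T = 0 := by
  classical
  have h : IsCondLaw μ (fun _ : Ω => d₀) T (fun d _ => if d = d₀ then 1 else 0) :=
    { measurable_obs := hT
      measurableSet_fiber := fun d => MeasurableSet.const _
      measurable := fun d => measurable_const
      nonneg := fun d t => by split_ifs <;> norm_num
      sum_eq_one := fun t => by simp
      map_restrict := fun d => by
        by_cases hd : d = d₀
        · simp [hd, withDensity_const]
        · have : (fun _ : Ω => d₀) ⁻¹' {d} = ∅ := by ext; simp [Ne.symm hd]
          rw [this]
          simp [hd, withDensity_const] }
  have h2 := h.condEntropy_mul_log_two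
  have h3 : ∀ d, Real.negMulLog (if d = d₀ then 1 else 0) = 0 := fun d => by
    split_ifs <;> simp
  simp only [h3, Finset.sum_const_zero, integral_zero] at h2
  exact (mul_eq_zero.1 h2).resolve_right (Real.log_pos one_lt_two).ne'

/-- A conditional distribution given `(T, W)` with finite-valued `W` restricts to a conditional
distribution given `T` on each event `W = w`. -/
theorem IsCondLaw.cond_fiber {𝒲 : Type} [MeasurableSpace 𝒲] [MeasurableSingletonClass 𝒲]
    [IsFiniteMeasure μ] {D : Ω → 𝒟} {T : Ω → 𝒯} {W : Ω → 𝒲} {q : 𝒟 → 𝒯 × 𝒲 → ℝ}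
    (h : IsCondLaw μ D (fun ω => (T ω, W ω)) q) (w : 𝒲) :
    IsCondLaw (cond μ (W ⁻¹' {w})) D T (fun d t => q d (t, w)) where
  measurable_obs := measurable_fst.comp h.measurable_obs
  measurableSet_fiber := h.measurableSet_fiber
  measurable d := (h.measurable d).comp (measurable_id.prodMk measurable_const)
  nonneg d t := h.nonneg d _
  sum_eq_one t := h.sum_eq_one _
  map_restrict d := by
    have hT : Measurable T := measurable_fst.comp h.measurable_obs
    have hW : Measurable W := measurable_snd.comp h.measurable_obs
    have hqm : Measurable fun t => ENNReal.ofReal (q d (t, w)) :=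
      ((h.measurable d).comp (measurable_id.prodMk measurable_const)).ennreal_ofReal
    have hset : MeasurableSet (W ⁻¹' {w}) := hW (measurableSet_singleton w)
    rw [ProbabilityTheory.cond, Measure.restrict_smul, Measure.map_smul, Measure.map_smul,
      withDensity_smul_measure]
    congr 1
    ext B hB
    have hBw : MeasurableSet (B ×ˢ ({w} : Set 𝒲)) := hB.prod (measurableSet_singleton w)
    have h1 := congrArg (fun m : Measure (𝒯 × 𝒲) => m (B ×ˢ {w})) (h.map_restrict d)
    rw [Measure.map_apply h.measurable_obs hBw, Measure.restrict_apply (h.measurable_obs hBw),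
      withDensity_apply _ hBw, setLIntegral_map hBw (h.measurable d).ennreal_ofReal
        h.measurable_obs] at h1
    rw [Measure.map_apply hT hB, Measure.restrict_apply (hT hB),
      Measure.restrict_apply ((hT hB).inter (h.measurableSet_fiber d)), withDensity_apply _ hB,
      setLIntegral_map hB hqm hT, Measure.restrict_restrict (hT hB)]
    have e : (fun ω => (T ω, W ω)) ⁻¹' (B ×ˢ {w}) = T ⁻¹' B ∩ W ⁻¹' {w} := by
      ext; simp
    rw [e] at h1
    rw [Set.inter_right_comm, h1]
    refine setLIntegral_congr_fun ((hT hB).inter hset) fun ω hω => ?_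
    have : W ω = w := hω.2
    simp [this]

/-- Conditional entropy given `(T, W)` with finite-valued `W` is the average over the values of `W`
of the conditional entropies given `T`. -/
theorem condEntropy_prod_finite {𝒲 : Type} [Fintype 𝒲] [MeasurableSpace 𝒲]
    [MeasurableSingletonClass 𝒲] [IsProbabilityMeasure μ] {D : Ω → 𝒟} {T : Ω → 𝒯} {W : Ω → 𝒲}
    (hD : ∀ d, MeasurableSet (D ⁻¹' {d})) (hT : Measurable T) (hW : Measurable W) :
    condEntropy μ D (fun ω => (T ω, W ω)) =
      ∑ w, μ.real (W ⁻¹' {w}) * condEntropy (cond μ (W ⁻¹' {w})) D T := by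
  have : Nonempty Ω := by
    by_contra hne
    rw [not_nonempty_iff] at hne
    have := IsProbabilityMeasure.ne_zero μ
    exact this (Measure.eq_zero_of_isEmpty μ)
  have : Nonempty 𝒟 := this.map D
  obtain ⟨q, h⟩ := exists_isCondLaw μ hD (hT.prodMk hW)
  have hl : Real.log 2 ≠ 0 := (Real.log_pos one_lt_two).ne'
  refine mul_right_cancel₀ hl ?_
  have hqm : ∀ d, Measurable fun ω => Real.negMulLog (q d (T ω, W ω)) := fun d =>
    Real.continuous_negMulLog.measurable.comp ((h.measurable d).comp (hT.prodMk hW))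
  rw [h.condEntropy_mul_log_two, Finset.sum_mul]
  have hW' : ∀ w, MeasurableSet (W ⁻¹' {w}) := fun w => hW (measurableSet_singleton w)
  have hint : ∀ w, Integrable (fun ω => ∑ d, Real.negMulLog (q d (T ω, w))) μ := fun w => by
    refine integrable_finsetSum _ fun d _ =>
      integrable_of_measurable_of_bounded (C := 1) (Real.continuous_negMulLog.measurable.comp
        ((h.measurable d).comp (hT.prodMk measurable_const))) fun ω => ?_
    have h0 := h.nonneg d (T ω, w)
    rw [abs_of_nonneg (Real.negMulLog_nonneg h0 (h.le_one _ _))]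
    have := Real.negMulLog_le_one_sub_self h0
    linarith
  rw [integral_finite_comp (D := W) (g := fun w ω => ∑ d, Real.negMulLog (q d (T ω, w)))
    hW' hint]
  refine Finset.sum_congr rfl fun w _ => ?_
  rw [mul_assoc, (h.cond_fiber w).condEntropy_mul_log_two]
  by_cases hw : μ (W ⁻¹' {w}) = 0
  · rw [Measure.restrict_eq_zero.2 hw]
    simp [measureReal_def, hw]
  · rw [ProbabilityTheory.cond, integral_smul_measure, ENNReal.toReal_inv, smul_eq_mul,
      ← measureReal_def, mul_inv_cancel_left₀]
    rw [measureReal_def]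
    exact ENNReal.toReal_ne_zero.2 ⟨hw, measure_ne_top _ _⟩

end Entropy

/-! ### Continuity of conditional entropy under rare modifications -/

theorem negMulLog_add_le {c u : ℝ} (hc : 0 ≤ c) (hu : 0 ≤ u) :
    Real.negMulLog (c + u) ≤ Real.negMulLog c + Real.negMulLog u := by
  have key : ∀ x y : ℝ, 0 ≤ x → 0 ≤ y → x * Real.log x ≤ x * Real.log (x + y) := by
    intro x y hx hy
    rcases hx.eq_or_lt with rfl | hx
    · simp
    · exact mul_le_mul_of_nonneg_left (Real.log_le_log hx (by linarith)) hx.le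
  have h1 := key c u hc hu
  have h2 := key u c hu hc
  rw [add_comm u c] at h2
  simp only [Real.negMulLog]
  linarith

/-- The tangent to `negMulLog` at `exp (-1 - t)` lies above it. -/
theorem negMulLog_le_tangent (t : ℝ) {u : ℝ} (hu : 0 ≤ u) :
    Real.negMulLog u ≤ t * u + Real.exp (-1 - t) := by
  rcases hu.eq_or_lt with rfl | hu
  · simp [Real.exp_nonneg]
  · have h := Real.log_le_sub_one_of_pos (div_pos (Real.exp_pos (-1 - t)) hu)
    rw [Real.log_div (Real.exp_pos _).ne' hu.ne', Real.log_exp] at h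
    have h2 := mul_le_mul_of_nonneg_left h hu.le
    have h3 : u * (Real.exp (-1 - t) / u - 1) = Real.exp (-1 - t) - u := by
      field_simp
    rw [h3] at h2
    simp only [Real.negMulLog]
    linarith

theorem negMulLog_sub_le {c u : ℝ} (hc : 0 ≤ c) (hu : 0 ≤ u) (h1 : c + u ≤ 1) :
    Real.negMulLog c - u ≤ Real.negMulLog (c + u) := by
  rcases hc.eq_or_lt with rfl | hc
  · have := Real.negMulLog_nonneg (x := 0 + u) (by linarith) h1
    simp only [Real.negMulLog_zero]
    linarith
  · have h2 := Real.log_le_sub_one_of_pos (div_pos (show 0 < c + u by linarith) hc)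
    rw [Real.log_div (by linarith) hc.ne'] at h2
    have h3 := mul_le_mul_of_nonneg_left h2 hc.le
    have h4 : c * ((c + u) / c - 1) = u := by field_simp; ring
    rw [h4] at h3
    have h5 : u * Real.log (c + u) ≤ 0 :=
      mul_nonpos_of_nonneg_of_nonpos hu (Real.log_nonpos (by linarith) h1)
    simp only [Real.negMulLog]
    linarith

/-- If `D` and `D'` differ with small probability, then the entropy of `D` given a sub-σ-algebra is
not much smaller than that of `D'`. The free parameter `t` is the slope of the tangent that bounds
`negMulLog` at the small conditional probabilities of the exceptional event; it replaces the
averaging step of Fano's inequality. -/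
theorem integral_negMulLog_condProb_le {Ω 𝒟 : Type} [Fintype 𝒟] {m m₀ : MeasurableSpace Ω}
    {μ : Measure[m₀] Ω} [IsProbabilityMeasure μ] (hmle : m ≤ m₀) {D D' : Ω → 𝒟}
    (hD : ∀ d, MeasurableSet[m₀] (D ⁻¹' {d})) (hD' : ∀ d, MeasurableSet[m₀] (D' ⁻¹' {d}))
    (t : ℝ) :
    ∫ ω, ∑ d, Real.negMulLog ((μ⟦D' ⁻¹' {d} | m⟧) ω) ∂μ ≤
      ∫ ω, ∑ d, Real.negMulLog ((μ⟦D ⁻¹' {d} | m⟧) ω) ∂μ +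
      (μ.real {ω | D ω ≠ D' ω} * (1 + t) + Fintype.card 𝒟 * Real.exp (-1 - t)) := by
  classical
  let c : 𝒟 → Ω → ℝ := fun d => μ⟦D ⁻¹' {d} ∩ D' ⁻¹' {d} | m⟧
  let u : 𝒟 → Ω → ℝ := fun d => μ⟦D ⁻¹' {d} \ D' ⁻¹' {d} | m⟧
  let u' : 𝒟 → Ω → ℝ := fun d => μ⟦D' ⁻¹' {d} \ D ⁻¹' {d} | m⟧
  have split : ∀ A B : Set Ω, MeasurableSet[m₀] A → MeasurableSet[m₀] B →
      μ⟦A | m⟧ =ᵐ[μ] μ⟦A ∩ B | m⟧ + μ⟦A \ B | m⟧ := by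
    intro A B hA hB
    have e : (A.indicator fun _ => (1 : ℝ)) =
        (A ∩ B).indicator (fun _ => (1 : ℝ)) + (A \ B).indicator (fun _ => (1 : ℝ)) := by
      funext ω
      by_cases h1 : ω ∈ A <;> by_cases h2 : ω ∈ B <;> simp [h1, h2]
    rw [e]
    exact condExp_add ((integrable_const 1).indicator (hA.inter hB))
      ((integrable_const 1).indicator (hA.diff hB)) m
  have hall : ∀ᵐ ω ∂μ, ∀ d, (μ⟦D ⁻¹' {d} | m⟧) ω = c d ω + u d ω ∧
      (μ⟦D' ⁻¹' {d} | m⟧) ω = c d ω + u' d ω ∧ 0 ≤ c d ω ∧ 0 ≤ u d ω ∧ 0 ≤ u' d ω ∧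
      (μ⟦D ⁻¹' {d} | m⟧) ω ∈ Set.Icc (0 : ℝ) 1 ∧ (μ⟦D' ⁻¹' {d} | m⟧) ω ∈ Set.Icc (0 : ℝ) 1 := by
    refine ae_all_iff.2 fun d => ?_
    filter_upwards [split _ _ (hD d) (hD' d), split _ _ (hD' d) (hD d),
      condProb_mem_Icc hmle ((hD d).inter (hD' d)), condProb_mem_Icc hmle ((hD d).diff (hD' d)),
      condProb_mem_Icc hmle ((hD' d).diff (hD d)), condProb_mem_Icc hmle (hD d),
      condProb_mem_Icc hmle (hD' d)] with ω h1 h2 h3 h4 h5 h6 h7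
    refine ⟨h1, ?_, h3.1, h4.1, h5.1, h6, h7⟩
    rw [h2, Set.inter_comm]
    rfl
  have hcm : ∀ s : Set Ω, AEStronglyMeasurable (μ⟦s | m⟧) μ := fun s =>
    (stronglyMeasurable_condExp.mono hmle).aestronglyMeasurable
  have hint : ∀ E : Ω → 𝒟, (∀ᵐ ω ∂μ, ∀ d, (μ⟦E ⁻¹' {d} | m⟧) ω ∈ Set.Icc (0 : ℝ) 1) →
      Integrable (fun ω => ∑ d, Real.negMulLog ((μ⟦E ⁻¹' {d} | m⟧) ω)) μ := by
    intro E hE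
    refine integrable_finsetSum _ fun d _ => Integrable.of_bound
      (Real.continuous_negMulLog.comp_aestronglyMeasurable (hcm _)) 1 ?_
    filter_upwards [hE] with ω hω
    rw [Real.norm_eq_abs, abs_of_nonneg (Real.negMulLog_nonneg (hω d).1 (hω d).2)]
    have := Real.negMulLog_le_one_sub_self (hω d).1
    linarith [(hω d).1]
  have hu : ∀ d, Integrable (u d) μ := fun d => integrable_condExp
  have hu' : ∀ d, Integrable (u' d) μ := fun d => integrable_condExp
  have htail : ∀ d, Integrable (fun ω => t * u' d ω + Real.exp (-1 - t)) μ := fun d =>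
    ((hu' d).const_mul t).add (integrable_const _)
  have hrem : ∀ d, Integrable (fun ω => u d ω + (t * u' d ω + Real.exp (-1 - t))) μ := fun d =>
    (hu d).add (htail d)
  have hmain : ∫ ω, ∑ d, Real.negMulLog ((μ⟦D' ⁻¹' {d} | m⟧) ω) ∂μ ≤
      ∫ ω, (∑ d, Real.negMulLog ((μ⟦D ⁻¹' {d} | m⟧) ω) +
        ∑ d, (u d ω + (t * u' d ω + Real.exp (-1 - t)))) ∂μ := by
    refine integral_mono_ae (hint D' (hall.mono fun ω h d => (h d).2.2.2.2.2.2))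
      ((hint D (hall.mono fun ω h d => (h d).2.2.2.2.2.1)).add (integrable_finsetSum _ fun d _ => hrem d)) ?_
    filter_upwards [hall] with ω hω
    rw [← Finset.sum_add_distrib]
    refine Finset.sum_le_sum fun d _ => ?_
    obtain ⟨h1, h2, h3, h4, h5, h6, -⟩ := hω d
    rw [h1] at h6 ⊢
    rw [h2]
    have e1 := negMulLog_add_le h3 h5
    have e2 := negMulLog_le_tangent t h5
    have e3 := negMulLog_sub_le h3 h4 h6.2
    linarith
  have hsum : ∀ E E' : Ω → 𝒟, (∀ d, MeasurableSet[m₀] (E ⁻¹' {d})) →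
      (∀ d, MeasurableSet[m₀] (E' ⁻¹' {d})) →
      ∑ d, ∫ ω, (μ⟦E ⁻¹' {d} \ E' ⁻¹' {d} | m⟧) ω ∂μ = μ.real {ω | E ω ≠ E' ω} := by
    intro E E' hE hE'
    have e : {ω | E ω ≠ E' ω} = ⋃ d ∈ Finset.univ, (E ⁻¹' {d} \ E' ⁻¹' {d}) := by
      ext ω
      simp [eq_comm]
    rw [e, measureReal_biUnion_finset]
    · refine Finset.sum_congr rfl fun d _ => ?_
      rw [integral_condExp hmle, integral_indicator ((hE d).diff (hE' d))]
      simp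
    · intro d _ d' _ hdd
      refine Set.disjoint_left.2 fun ω h1 h2 => hdd ?_
      rw [← h1.1, ← h2.1]
    · exact fun d _ => (hE d).diff (hE' d)
  refine hmain.trans_eq ?_
  rw [integral_add (hint D (hall.mono fun ω h d => (h d).2.2.2.2.2.1))
    (integrable_finsetSum _ fun d _ => hrem d), integral_finsetSum _ fun d _ => hrem d]
  congr 1
  have h1 : ∀ d, ∫ ω, (u d ω + (t * u' d ω + Real.exp (-1 - t))) ∂μ =
      ∫ ω, u d ω ∂μ + (t * ∫ ω, u' d ω ∂μ + Real.exp (-1 - t)) := fun d => by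
    rw [integral_add (hu d) (htail d),
      integral_add ((hu' d).const_mul t) (integrable_const _), integral_const_mul]
    simp
  simp only [h1, Finset.sum_add_distrib, ← Finset.mul_sum, Finset.sum_const, Finset.card_univ,
    nsmul_eq_mul]
  have h2 : ∑ d, ∫ ω, u d ω ∂μ = _ := hsum D D' hD hD'
  have h3 : ∑ d, ∫ ω, u' d ω ∂μ = _ := hsum D' D hD' hD
  have h4 : {ω | D' ω ≠ D ω} = {ω | D ω ≠ D' ω} := by ext; simp [eq_comm]
  rw [h2, h3, h4]
  ring

theorem condEntropy_le_add_of_ne {Ω 𝒟 𝒯 : Type} [MeasurableSpace Ω] [Fintype 𝒟]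
    [MeasurableSpace 𝒯] {μ : Measure Ω} [IsProbabilityMeasure μ] {D D' : Ω → 𝒟} {T : Ω → 𝒯}
    (hD : ∀ d, MeasurableSet (D ⁻¹' {d})) (hD' : ∀ d, MeasurableSet (D' ⁻¹' {d}))
    (hT : Measurable T) (t : ℝ) :
    condEntropy μ D' T * Real.log 2 ≤ condEntropy μ D T * Real.log 2 +
      (μ.real {ω | D ω ≠ D' ω} * (1 + t) + Fintype.card 𝒟 * Real.exp (-1 - t)) := by
  have hl : Real.log 2 ≠ 0 := (Real.log_pos one_lt_two).ne'
  have hent : ∀ E : Ω → 𝒟, condEntropy μ E T * Real.log 2 = ∫ ω, ∑ d,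
      Real.negMulLog ((μ⟦E ⁻¹' {d} | MeasurableSpace.comap T inferInstance⟧) ω) ∂μ := fun E => by
    rw [condEntropy, ← integral_mul_const]
    refine integral_congr_ae (ae_of_all _ fun ω => ?_)
    simp only [Finset.sum_mul]
    exact Finset.sum_congr rfl fun d _ => div_mul_cancel₀ _ hl
  rw [hent, hent]
  exact integral_negMulLog_condProb_le hT.comap_le hD hD' t

/-! ### Leftover hashing for a fixed probability vector -/

section Hashing

variable {ℛ 𝓗 ℳ 𝒮 : Type} [Fintype ℛ] [DecidableEq ℳ] [DecidableEq 𝒮]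

/-- The mass that the vector `q` gives to the message `m`. -/
def messageMass (φ : ℛ → ℳ) (q : ℛ → ℝ) (m : ℳ) : ℝ := ∑ r, if φ r = m then q r else 0

/-- The mass that the vector `q` gives to the message `m` together with the key `k`. -/
def keyMass (φ : ℛ → ℳ) (κ : ℛ → 𝒮) (q : ℛ → ℝ) (k : 𝒮) (m : ℳ) : ℝ :=
  ∑ r, if φ r = m ∧ κ r = k then q r else 0

/-- The conditional probability of the key `k` given the message `m`; for a message of probability
zero it is taken to be uniform. -/
noncomputable def keyGivenMessage [Fintype 𝒮] (φ : ℛ → ℳ) (κ : ℛ → 𝒮) (q : ℛ → ℝ) (k : 𝒮) (m : ℳ) : ℝ :=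
  if messageMass φ q m = 0 then (Fintype.card 𝒮 : ℝ)⁻¹
  else keyMass φ κ q k m / messageMass φ q m

variable {φ : ℛ → ℳ} {κ : ℛ → 𝒮} {q : ℛ → ℝ}

theorem keyMass_nonneg (hq : ∀ r, 0 ≤ q r) (k : 𝒮) (m : ℳ) : 0 ≤ keyMass φ κ q k m :=
  Finset.sum_nonneg fun r _ => by split_ifs; exacts [hq r, le_rfl]

theorem messageMass_nonneg (hq : ∀ r, 0 ≤ q r) (m : ℳ) : 0 ≤ messageMass φ q m :=
  Finset.sum_nonneg fun r _ => by split_ifs; exacts [hq r, le_rfl]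

theorem le_messageMass (hq : ∀ r, 0 ≤ q r) (r : ℛ) : q r ≤ messageMass φ q (φ r) := by
  refine le_trans ?_ (Finset.single_le_sum (f := fun r' => if φ r' = φ r then q r' else 0)
    (fun r' _ => ?_) (Finset.mem_univ r))
  · simp
  · split_ifs; exacts [hq r', le_rfl]

theorem le_keyMass (hq : ∀ r, 0 ≤ q r) (r : ℛ) : q r ≤ keyMass φ κ q (κ r) (φ r) := by
  refine le_trans ?_ (Finset.single_le_sum
    (f := fun r' => if φ r' = φ r ∧ κ r' = κ r then q r' else 0)
    (fun r' _ => ?_) (Finset.mem_univ r))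
  · simp
  · split_ifs; exacts [hq r', le_rfl]

theorem sum_keyMass [Fintype 𝒮] (m : ℳ) : ∑ k, keyMass φ κ q k m = messageMass φ q m := by
  simp only [keyMass, messageMass]
  rw [Finset.sum_comm]
  refine Finset.sum_congr rfl fun r _ => ?_
  by_cases h : φ r = m <;> simp [h]

theorem sum_messageMass_mul [Fintype ℳ] (g : ℳ → ℝ) :
    ∑ m, messageMass φ q m * g m = ∑ r, q r * g (φ r) := by
  simp only [messageMass, Finset.sum_mul]
  rw [Finset.sum_comm]
  exact Finset.sum_congr rfl fun r _ => by simp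

theorem sum_keyMass_mul [Fintype ℳ] [Fintype 𝒮] (g : 𝒮 → ℳ → ℝ) :
    ∑ m, ∑ k, keyMass φ κ q k m * g k m = ∑ r, q r * g (κ r) (φ r) := by
  simp only [keyMass, Finset.sum_mul]
  have h : ∀ m, ∑ k, ∑ r, (if φ r = m ∧ κ r = k then q r else 0) * g k m =
      ∑ r, ∑ k, (if φ r = m ∧ κ r = k then q r else 0) * g k m := fun m => Finset.sum_comm
  simp only [h]
  rw [Finset.sum_comm]
  refine Finset.sum_congr rfl fun r _ => ?_
  rw [Finset.sum_eq_single (φ r), Finset.sum_eq_single (κ r)]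
  · simp
  · intro k _ hk; simp [Ne.symm hk]
  · simp
  · intro m _ hm; simp [Ne.symm hm]
  · simp

theorem keyMass_le_messageMass [Fintype 𝒮] (hq : ∀ r, 0 ≤ q r) (k : 𝒮) (m : ℳ) :
    keyMass φ κ q k m ≤ messageMass φ q m := by
  rw [← sum_keyMass (κ := κ)]
  exact Finset.single_le_sum (fun k _ => keyMass_nonneg hq k m) (Finset.mem_univ k)

theorem messageMass_mul_keyGivenMessage [Fintype 𝒮] (hq : ∀ r, 0 ≤ q r) (k : 𝒮) (m : ℳ) :
    messageMass φ q m * keyGivenMessage φ κ q k m = keyMass φ κ q k m := by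
  unfold keyGivenMessage
  split_ifs with h
  · rw [h, zero_mul]
    exact (le_antisymm ((keyMass_le_messageMass hq k m).trans_eq h) (keyMass_nonneg hq k m)).symm
  · field_simp

theorem keyGivenMessage_nonneg [Fintype 𝒮] (hq : ∀ r, 0 ≤ q r) (k : 𝒮) (m : ℳ) :
    0 ≤ keyGivenMessage φ κ q k m := by
  unfold keyGivenMessage
  split_ifs
  · positivity
  · exact div_nonneg (keyMass_nonneg hq k m) (messageMass_nonneg hq m)

theorem sum_keyGivenMessage [Fintype 𝒮] [Nonempty 𝒮] (m : ℳ) : ∑ k, keyGivenMessage φ κ q k m = 1 := by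
  unfold keyGivenMessage
  split_ifs with h
  · simp
  · rw [← Finset.sum_div, sum_keyMass, div_self h]

/-- The average over the messages of the entropy of the key, rewritten as an average over `ℛ`. -/
theorem sum_negMulLog_keyGivenMessage [Fintype ℳ] [Fintype 𝒮] (hq : ∀ r, 0 ≤ q r) :
    ∑ r, q r * ∑ k, Real.negMulLog (keyGivenMessage φ κ q k (φ r)) =
      ∑ r, q r * -Real.log (keyGivenMessage φ κ q (κ r) (φ r)) := by
  rw [← sum_messageMass_mul (φ := φ) fun m => ∑ k, Real.negMulLog (keyGivenMessage φ κ q k m),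
    ← sum_keyMass_mul (φ := φ) (κ := κ) fun k m => -Real.log (keyGivenMessage φ κ q k m)]
  refine Finset.sum_congr rfl fun m _ => ?_
  rw [Finset.mul_sum]
  refine Finset.sum_congr rfl fun k _ => ?_
  rw [← messageMass_mul_keyGivenMessage hq k m, Real.negMulLog]
  ring

/-- On average over a two-universal family, the mass sharing both the message and the hash value of
`r` is at most the mass of `r` plus a fraction `1 / |𝒮|` of the mass sharing its message. -/
theorem average_keyMass_le [Fintype 𝒮] (hq : ∀ r, 0 ≤ q r) (ev : 𝓗 → ℛ → 𝒮) {𝓕 : Finset 𝓗}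
    (h𝓕 : 𝓕.Nonempty)
    (huniv : ∀ r r', r ≠ r' → ((𝓕.filter fun f => ev f r = ev f r').card : ℝ) / 𝓕.card ≤
      1 / Fintype.card 𝒮) (r : ℛ) :
    ∑ f ∈ 𝓕, (𝓕.card : ℝ)⁻¹ * keyMass φ (ev f) q (ev f r) (φ r) ≤
      q r + messageMass φ q (φ r) / Fintype.card 𝒮 := by
  classical
  have hc : (𝓕.card : ℝ) ≠ 0 := by
    simpa using h𝓕.ne_empty
  have h1 : ∑ f ∈ 𝓕, (𝓕.card : ℝ)⁻¹ * keyMass φ (ev f) q (ev f r) (φ r) =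
      ∑ r', (if φ r' = φ r then q r' else 0) *
        (((𝓕.filter fun f => ev f r' = ev f r).card : ℝ) / 𝓕.card) := by
    simp only [keyMass, Finset.mul_sum]
    rw [Finset.sum_comm]
    refine Finset.sum_congr rfl fun r' _ => ?_
    rw [Finset.card_filter]
    push_cast
    rw [Finset.sum_div, Finset.mul_sum]
    refine Finset.sum_congr rfl fun f _ => ?_
    by_cases h1 : φ r' = φ r <;> by_cases h2 : ev f r' = ev f r <;> simp [h1, h2]
    ring
  rw [h1]
  have h2 : q r + messageMass φ q (φ r) / Fintype.card 𝒮 =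
      ∑ r', ((if r' = r then q r else 0) +
        (if φ r' = φ r then q r' else 0) * (1 / Fintype.card 𝒮)) := by
    rw [Finset.sum_add_distrib, ← Finset.sum_mul, messageMass]
    simp [div_eq_mul_inv]
  rw [h2]
  refine Finset.sum_le_sum fun r' _ => ?_
  have h3 : 0 ≤ if φ r' = φ r then q r' else 0 := by split_ifs; exacts [hq r', le_rfl]
  by_cases h : r' = r
  · subst h
    simp [hc]
    exact mul_nonneg (hq _) (by positivity)
  · simp only [h, if_false, zero_add]
    exact mul_le_mul_of_nonneg_left (huniv r' r h) h3

/-- **Leftover hashing.** The logarithm of the mass ratio is averaged over the hash function by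
Jensen's inequality, separately for each value of the hashed variable; no smoothing is needed. -/
theorem log_card_sub_le_average_entropy [Fintype ℳ] [Fintype 𝒮] [Nonempty 𝒮] (hq : ∀ r, 0 ≤ q r) (hq1 : ∑ r, q r = 1)
    (ev : 𝓗 → ℛ → 𝒮) {𝓕 : Finset 𝓗} (h𝓕 : 𝓕.Nonempty)
    (huniv : ∀ r r', r ≠ r' → ((𝓕.filter fun f => ev f r = ev f r').card : ℝ) / 𝓕.card ≤
      1 / Fintype.card 𝒮) :
    Real.log (Fintype.card 𝒮) -
        ∑ r, q r * Real.log (1 + Fintype.card 𝒮 * q r / messageMass φ q (φ r)) ≤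
      ∑ f ∈ 𝓕, (𝓕.card : ℝ)⁻¹ *
        ∑ r, q r * ∑ k, Real.negMulLog (keyGivenMessage φ (ev f) q k (φ r)) := by
  have hc : (𝓕.card : ℝ) ≠ 0 := by
    simpa using h𝓕.ne_empty
  have hs : (0 : ℝ) < Fintype.card 𝒮 := by exact_mod_cast Fintype.card_pos
  have hw : ∑ _f ∈ 𝓕, (𝓕.card : ℝ)⁻¹ = 1 := by simp [hc]
  simp only [sum_negMulLog_keyGivenMessage hq]
  simp only [Finset.mul_sum]
  rw [Finset.sum_comm]
  have e : Real.log (Fintype.card 𝒮) = ∑ r, q r * Real.log (Fintype.card 𝒮) := by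
    rw [← Finset.sum_mul, hq1, one_mul]
  rw [e, ← Finset.sum_sub_distrib]
  refine Finset.sum_le_sum fun r _ => ?_
  rcases (hq r).eq_or_lt with h0 | h0
  · simp [← h0]
  have hb : 0 < messageMass φ q (φ r) := h0.trans_le (le_messageMass hq r)
  have ha : ∀ f, 0 < keyMass φ (ev f) q (ev f r) (φ r) := fun f =>
    h0.trans_le (le_keyMass hq r)
  have hQ : ∀ f, keyGivenMessage φ (ev f) q (ev f r) (φ r) =
      keyMass φ (ev f) q (ev f r) (φ r) / messageMass φ q (φ r) := fun f => if_neg hb.ne'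
  have hJ := strictConcaveOn_log_Ioi.concaveOn.le_map_sum (t := 𝓕)
    (w := fun _ => (𝓕.card : ℝ)⁻¹)
    (p := fun f => Fintype.card 𝒮 * keyGivenMessage φ (ev f) q (ev f r) (φ r))
    (fun f _ => by positivity) hw
    (fun f _ => by
      rw [hQ]
      exact mul_pos hs (div_pos (ha f) hb))
  simp only [smul_eq_mul] at hJ
  have hle : ∑ f ∈ 𝓕, (𝓕.card : ℝ)⁻¹ *
      (Fintype.card 𝒮 * keyGivenMessage φ (ev f) q (ev f r) (φ r)) ≤
      1 + Fintype.card 𝒮 * q r / messageMass φ q (φ r) := by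
    have h1 := average_keyMass_le (φ := φ) hq ev h𝓕 huniv r
    have h2 : ∑ f ∈ 𝓕, (𝓕.card : ℝ)⁻¹ *
        (Fintype.card 𝒮 * keyGivenMessage φ (ev f) q (ev f r) (φ r)) =
        (Fintype.card 𝒮 / messageMass φ q (φ r)) *
          ∑ f ∈ 𝓕, (𝓕.card : ℝ)⁻¹ * keyMass φ (ev f) q (ev f r) (φ r) := by
      rw [Finset.mul_sum]
      refine Finset.sum_congr rfl fun f _ => ?_
      rw [hQ]
      ring
    rw [h2]
    refine (mul_le_mul_of_nonneg_left h1 (div_pos hs hb).le).trans_eq ?_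
    field_simp
    ring
  have hpos : 0 < ∑ f ∈ 𝓕, (𝓕.card : ℝ)⁻¹ *
      (Fintype.card 𝒮 * keyGivenMessage φ (ev f) q (ev f r) (φ r)) := by
    refine Finset.sum_pos (fun f _ => ?_) h𝓕
    rw [hQ]
    have := ha f
    have : (0 : ℝ) < 𝓕.card := by positivity
    positivity
  have h3 := hJ.trans (Real.log_le_log hpos hle)
  have h4 : ∑ f ∈ 𝓕, (𝓕.card : ℝ)⁻¹ *
      Real.log (Fintype.card 𝒮 * keyGivenMessage φ (ev f) q (ev f r) (φ r)) =
      Real.log (Fintype.card 𝒮) + ∑ f ∈ 𝓕, (𝓕.card : ℝ)⁻¹ *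
        Real.log (keyGivenMessage φ (ev f) q (ev f r) (φ r)) := by
    have : ∀ f ∈ 𝓕, (𝓕.card : ℝ)⁻¹ *
        Real.log (Fintype.card 𝒮 * keyGivenMessage φ (ev f) q (ev f r) (φ r)) =
        (𝓕.card : ℝ)⁻¹ * Real.log (Fintype.card 𝒮) + (𝓕.card : ℝ)⁻¹ *
        Real.log (keyGivenMessage φ (ev f) q (ev f r) (φ r)) := fun f _ => by
      rw [Real.log_mul hs.ne', mul_add]
      rw [hQ]
      exact (div_pos (ha f) hb).ne'
    rw [Finset.sum_congr rfl this, Finset.sum_add_distrib, ← Finset.sum_mul, hw, one_mul]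
  rw [h4] at h3
  have h5 : ∑ f ∈ 𝓕, (𝓕.card : ℝ)⁻¹ *
      (q r * -Real.log (keyGivenMessage φ (ev f) q (ev f r) (φ r))) =
      -(q r * ∑ f ∈ 𝓕, (𝓕.card : ℝ)⁻¹ *
        Real.log (keyGivenMessage φ (ev f) q (ev f r) (φ r))) := by
    rw [Finset.mul_sum, ← Finset.sum_neg_distrib]
    exact Finset.sum_congr rfl fun f _ => by ring
  rw [h5]
  have h6 := mul_le_mul_of_nonneg_left h3 h0.le
  linarith

theorem log_one_add_le_rpow_div {x θ : ℝ} (hx : 0 ≤ x) (h0 : 0 < θ) (h1 : θ ≤ 1) :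
    Real.log (1 + x) ≤ x ^ θ / θ := by
  have h2 : (1 + x) ^ θ ≤ 1 + x ^ θ := by
    lift x to ℝ≥0 using hx
    have := NNReal.rpow_add_le_add_rpow 1 x h0.le h1
    rw [NNReal.one_rpow] at this
    exact_mod_cast this
  have h3 : θ * Real.log (1 + x) ≤ x ^ θ := by
    rw [← Real.log_rpow (by linarith)]
    have h4 := Real.rpow_nonneg hx θ
    have h5 := Real.log_le_sub_one_of_pos (x := 1 + x ^ θ) (by linarith)
    have h6 := Real.log_le_log (Real.rpow_pos_of_pos (show 0 < 1 + x by linarith) θ) h2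
    linarith
  rw [le_div_iff₀ h0]
  linarith

/-- Messages of mass less than `β` are rare since there are only `|ℳ|` messages; for the others the
excess is bounded by a Rényi sum. -/
theorem sum_log_excess_le [Fintype ℳ] (hq : ∀ r, 0 ≤ q r) {s β θ : ℝ} (hs : 0 ≤ s) (hβ : 0 < β)
    (h0 : 0 < θ) (h1 : θ ≤ 1) :
    ∑ r, q r * Real.log (1 + s * q r / messageMass φ q (φ r)) ≤
      Fintype.card ℳ * β * Real.log (1 + s) + (s / β) ^ θ / θ * ∑ r, q r ^ (1 + θ) := by
  have hlog : 0 ≤ Real.log (1 + s) := Real.log_nonneg (by linarith)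
  have hmass : ∑ r, q r * (if messageMass φ q (φ r) < β then Real.log (1 + s) else 0) ≤
      Fintype.card ℳ * β * Real.log (1 + s) := by
    rw [← sum_messageMass_mul (φ := φ)
      (fun m => if messageMass φ q m < β then Real.log (1 + s) else 0)]
    have : (Fintype.card ℳ : ℝ) * β * Real.log (1 + s) = ∑ _m : ℳ, β * Real.log (1 + s) := by
      simp [mul_assoc]
    rw [this]
    refine Finset.sum_le_sum fun m _ => ?_
    split_ifs with h
    · exact mul_le_mul_of_nonneg_right h.le hlog
    · rw [mul_zero]; positivity
  refine le_trans ?_ (add_le_add_left hmass _)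
  rw [Finset.mul_sum, ← Finset.sum_add_distrib]
  refine Finset.sum_le_sum fun r _ => ?_
  rcases (hq r).eq_or_lt with hr | hr
  · have : (0 : ℝ) ^ (1 + θ) = 0 := Real.zero_rpow (by linarith)
    simp [← hr, this]
  have hb : 0 < messageMass φ q (φ r) := hr.trans_le (le_messageMass hq r)
  have hx : 0 ≤ s * q r / messageMass φ q (φ r) := by positivity
  have hren : 0 ≤ (s / β) ^ θ / θ * q r ^ (1 + θ) := by positivity
  split_ifs with h
  · have : s * q r / messageMass φ q (φ r) ≤ s := by
      rw [div_le_iff₀ hb]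
      exact mul_le_mul_of_nonneg_left (le_messageMass hq r) hs
    have := mul_le_mul_of_nonneg_left
      (Real.log_le_log (show 0 < 1 + s * q r / messageMass φ q (φ r) by linarith)
        (add_le_add_right this 1)) hr.le
    linarith
  · rw [not_lt] at h
    have h2 : s * q r / messageMass φ q (φ r) ≤ s / β * q r := by
      rw [div_mul_eq_mul_div]
      exact div_le_div_of_nonneg_left (by positivity) hβ h
    have h3 : Real.log (1 + s * q r / messageMass φ q (φ r)) ≤ Real.log (1 + s / β * q r) :=
      Real.log_le_log (by linarith) (by linarith)
    have h4 := log_one_add_le_rpow_div (show 0 ≤ s / β * q r by positivity) h0 h1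
    rw [Real.mul_rpow (by positivity) hr.le] at h4
    have h5 := mul_le_mul_of_nonneg_left (h3.trans h4) hr.le
    rw [Real.rpow_add hr, Real.rpow_one, mul_zero, zero_add]
    refine h5.trans_eq ?_
    ring

end Hashing

/-! ### Leftover hashing given a continuous observation -/

theorem IsCondLaw.of_measureReal {Ω 𝒟 𝒯 : Type} [MeasurableSpace Ω] [Fintype 𝒟]
    [MeasurableSpace 𝒯] {μ : Measure Ω} [IsFiniteMeasure μ] {D : Ω → 𝒟} {T : Ω → 𝒯}
    {q : 𝒟 → 𝒯 → ℝ} (hT : Measurable T) (hD : ∀ d, MeasurableSet (D ⁻¹' {d}))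
    (hq : ∀ d, Measurable (q d)) (hq0 : ∀ d t, 0 ≤ q d t) (hq1 : ∀ t, ∑ d, q d t = 1)
    (h : ∀ d B, MeasurableSet B →
      μ.real (D ⁻¹' {d} ∩ T ⁻¹' B) = ∫ ω in T ⁻¹' B, q d (T ω) ∂μ) : IsCondLaw μ D T q where
  measurable_obs := hT
  measurableSet_fiber := hD
  measurable := hq
  nonneg := hq0
  sum_eq_one := hq1
  map_restrict d := by
    ext B hB
    have hle : ∀ t, q d t ≤ 1 := fun t => by
      rw [← hq1 t]
      exact Finset.single_le_sum (fun d _ => hq0 d t) (Finset.mem_univ d)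
    rw [Measure.map_apply hT hB, Measure.restrict_apply (hT hB), withDensity_apply _ hB,
      setLIntegral_map hB (hq d).ennreal_ofReal hT, Set.inter_comm,
      ← ofReal_integral_eq_lintegral_ofReal, ← h d B hB, ofReal_measureReal]
    · refine (integrable_of_measurable_of_bounded (C := 1) ((hq d).comp hT) fun ω => ?_)
      rw [abs_of_nonneg (hq0 d _)]
      exact hle _
    · exact ae_of_all _ fun ω => hq0 d _

section HashedKey

variable {Ω 𝒟 𝒯 ℳ 𝒮 : Type} [MeasurableSpace Ω] [Fintype 𝒟] [MeasurableSpace 𝒯]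
  [DecidableEq ℳ] [DecidableEq 𝒮] {μ : Measure Ω} {D : Ω → 𝒟} {T : Ω → 𝒯} {q : 𝒟 → 𝒯 → ℝ}

theorem measurable_keyMass (hq : ∀ d, Measurable (q d)) {κ : 𝒯 → 𝒟 → 𝒮}
    (hκ : ∀ d k, MeasurableSet {t | κ t d = k}) (φ : 𝒟 → ℳ) (k : 𝒮) (m : ℳ) :
    Measurable fun t => keyMass φ (κ t) (fun d => q d t) k m := by
  refine Finset.measurable_sum _ fun d _ => ?_
  by_cases h : φ d = m
  · simp only [h, true_and]
    exact Measurable.ite (hκ d k) (hq d) measurable_const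
  · simp only [h, false_and, if_false]
    exact measurable_const

theorem measurable_messageMass (hq : ∀ d, Measurable (q d)) (φ : 𝒟 → ℳ) (m : ℳ) :
    Measurable fun t => messageMass φ (fun d => q d t) m := by
  refine Finset.measurable_sum _ fun d _ => ?_
  split_ifs
  · exact hq d
  · exact measurable_const

theorem measurable_keyGivenMessage [Fintype 𝒮] (hq : ∀ d, Measurable (q d)) {κ : 𝒯 → 𝒟 → 𝒮}
    (hκ : ∀ d k, MeasurableSet {t | κ t d = k}) (φ : 𝒟 → ℳ) (k : 𝒮) (m : ℳ) :
    Measurable fun t => keyGivenMessage φ (κ t) (fun d => q d t) k m := by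
  have hb := measurable_messageMass hq φ m
  exact Measurable.ite (hb (measurableSet_singleton 0)) measurable_const
    ((measurable_keyMass hq hκ φ k m).div hb)

variable [Fintype ℳ] [MeasurableSpace ℳ] [MeasurableSingletonClass ℳ] [Fintype 𝒮]

/-- The conditional distribution of a key computed from `D` and the observation, when the message
`φ D` is observed in addition. -/
theorem IsCondLaw.key [Nonempty 𝒮] [IsFiniteMeasure μ] (h : IsCondLaw μ D T q) {κ : 𝒯 → 𝒟 → 𝒮}
    (hκ : ∀ d k, MeasurableSet {t | κ t d = k}) (φ : 𝒟 → ℳ) :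
    IsCondLaw μ (fun ω => κ (T ω) (D ω)) (fun ω => (T ω, φ (D ω)))
      (fun k t => keyGivenMessage φ (κ t.1) (fun d => q d t.1) k t.2) := by
  classical
  have hT := h.measurable_obs
  have hφ : Measurable fun ω => φ (D ω) := by
    refine measurable_to_countable' fun m => ?_
    have : (fun ω => φ (D ω)) ⁻¹' {m} = ⋃ d ∈ Finset.univ.filter (fun d => φ d = m), D ⁻¹' {d} := by
      ext ω; simp
    rw [this]
    exact Finset.measurableSet_biUnion _ fun d _ => h.measurableSet_fiber d
  have hK : ∀ k, MeasurableSet ((fun ω => κ (T ω) (D ω)) ⁻¹' {k}) := by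
    intro k
    have : (fun ω => κ (T ω) (D ω)) ⁻¹' {k} = ⋃ d, (D ⁻¹' {d} ∩ T ⁻¹' {t | κ t d = k}) := by
      ext ω; simp
    rw [this]
    exact MeasurableSet.iUnion fun d => (h.measurableSet_fiber d).inter (hT (hκ d k))
  have hQm : ∀ k, Measurable fun t : 𝒯 × ℳ =>
      keyGivenMessage φ (κ t.1) (fun d => q d t.1) k t.2 := fun k =>
    measurable_from_prod_countable_left fun m => measurable_keyGivenMessage h.measurable hκ φ k m
  have hQ0 : ∀ k (t : 𝒯 × ℳ), 0 ≤ keyGivenMessage φ (κ t.1) (fun d => q d t.1) k t.2 :=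
    fun k t => keyGivenMessage_nonneg (fun d => h.nonneg d _) k _
  have hQ1 : ∀ t : 𝒯 × ℳ, ∑ k, keyGivenMessage φ (κ t.1) (fun d => q d t.1) k t.2 = 1 :=
    fun t => sum_keyGivenMessage _
  have hQle : ∀ k (t : 𝒯 × ℳ), keyGivenMessage φ (κ t.1) (fun d => q d t.1) k t.2 ≤ 1 := by
    intro k t
    rw [← hQ1 t]
    exact Finset.single_le_sum (fun k _ => hQ0 k t) (Finset.mem_univ k)
  refine .of_measureReal (hT.prodMk hφ) hK hQm hQ0 hQ1 fun k B hB => ?_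
  have hTB : MeasurableSet ((fun ω => (T ω, φ (D ω))) ⁻¹' B) := (hT.prodMk hφ) hB
  have hBm : ∀ m, MeasurableSet {t | (t, m) ∈ B} := fun m =>
    (measurable_id.prodMk measurable_const) hB
  have e1 := h.integral_eq (g := fun d t => if (t, φ d) ∈ B ∧ κ t d = k then 1 else 0) (C := 1)
    (fun d => Measurable.ite ((hBm _).inter (hκ d k)) measurable_const measurable_const)
    (fun d t => by split_ifs <;> simp)
  have e2 := h.integral_eq (g := fun d t => if (t, φ d) ∈ B then
      keyGivenMessage φ (κ t) (fun d => q d t) k (φ d) else 0) (C := 1)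
    (fun d => Measurable.ite (hBm _) (measurable_keyGivenMessage h.measurable hκ φ k _)
      measurable_const)
    (fun d t => by
      split_ifs
      · rw [abs_of_nonneg (hQ0 k (t, φ d))]; exact hQle k (t, φ d)
      · simp)
  have e3 : μ.real ((fun ω => κ (T ω) (D ω)) ⁻¹' {k} ∩ (fun ω => (T ω, φ (D ω))) ⁻¹' B) =
      ∫ ω, (if (T ω, φ (D ω)) ∈ B ∧ κ (T ω) (D ω) = k then (1 : ℝ) else 0) ∂μ := by
    rw [← integral_indicator_one ((hK k).inter hTB)]
    refine integral_congr_ae (ae_of_all _ fun ω => ?_)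
    simp only [Set.indicator, Set.mem_inter_iff, Set.mem_preimage, Set.mem_singleton_iff,
      Pi.one_apply]
    exact if_congr and_comm rfl rfl
  rw [e3, e1, ← integral_indicator hTB]
  have e4 : ∫ ω, ((fun ω => (T ω, φ (D ω))) ⁻¹' B).indicator
      (fun ω => keyGivenMessage φ (κ (T ω)) (fun d => q d (T ω)) k (φ (D ω))) ω ∂μ =
      ∫ ω, (if (T ω, φ (D ω)) ∈ B then
        keyGivenMessage φ (κ (T ω)) (fun d => q d (T ω)) k (φ (D ω)) else 0) ∂μ :=
    integral_congr_ae (ae_of_all _ fun ω => by simp [Set.indicator])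
  rw [e4, e2]
  refine integral_congr_ae (ae_of_all _ fun ω => ?_)
  dsimp only
  set t := T ω
  have h1 := sum_messageMass_mul (φ := φ) (q := fun d => q d t)
    (fun m => if (t, m) ∈ B then keyGivenMessage φ (κ t) (fun d => q d t) k m else 0)
  have h2 := sum_keyMass_mul (φ := φ) (κ := κ t) (q := fun d => q d t)
    (fun k' m => if (t, m) ∈ B ∧ k' = k then 1 else 0)
  rw [← h1, ← h2]
  refine Finset.sum_congr rfl fun m _ => ?_
  rw [Finset.sum_eq_single k]
  · by_cases hm : (t, m) ∈ B
    · simp [hm, messageMass_mul_keyGivenMessage fun d => h.nonneg d t]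
    · simp [hm]
  · intro k' _ hk'; simp [hk']
  · simp

theorem IsCondLaw.condEntropy_key [Nonempty 𝒮] [IsFiniteMeasure μ] (h : IsCondLaw μ D T q)
    {κ : 𝒯 → 𝒟 → 𝒮} (hκ : ∀ d k, MeasurableSet {t | κ t d = k}) (φ : 𝒟 → ℳ) :
    condEntropy μ (fun ω => κ (T ω) (D ω)) (fun ω => (T ω, φ (D ω))) * Real.log 2 =
      ∫ ω, ∑ d, q d (T ω) * ∑ k,
        Real.negMulLog (keyGivenMessage φ (κ (T ω)) (fun d => q d (T ω)) k (φ d)) ∂μ := by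
  have hk := h.key hκ φ
  rw [hk.condEntropy_mul_log_two]
  refine h.integral_eq (C := Fintype.card 𝒮) (g := fun d t => ∑ k,
    Real.negMulLog (keyGivenMessage φ (κ t) (fun d => q d t) k (φ d))) (fun d => ?_) fun d t => ?_
  · exact Finset.measurable_sum _ fun k _ => Real.continuous_negMulLog.measurable.comp
      (measurable_keyGivenMessage h.measurable hκ φ k _)
  · refine (Finset.abs_sum_le_sum_abs _ _).trans ?_
    refine (Finset.sum_le_sum (g := fun _ => (1 : ℝ)) fun k _ => ?_).trans_eq (by simp)
    have h0 := hk.nonneg k (t, φ d)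
    rw [abs_of_nonneg (Real.negMulLog_nonneg h0 (hk.le_one k (t, φ d)))]
    have := Real.negMulLog_le_one_sub_self h0
    exact this.trans (sub_le_self _ h0)

end HashedKey

/-- **Privacy amplification.** The key `F(D)`, hashed by a uniform member `F` of a two-universal
family, has almost full entropy given the observation `T`, the hash function and the message
`φ D`, if the Rényi sums of `D` given `T` are small compared with the number of keys and messages. -/
theorem log_card_sub_le_condEntropy_hash {Ω Ω' 𝒟 𝒯 ℳ 𝒮 𝓗 : Type} [MeasurableSpace Ω]
    [MeasurableSpace Ω'] [Fintype 𝒟] [MeasurableSpace 𝒯] [Fintype ℳ] [MeasurableSpace ℳ]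
    [MeasurableSingletonClass ℳ] [Fintype 𝒮] [Nonempty 𝒮] [DecidableEq 𝒮] [Fintype 𝓗]
    [MeasurableSpace 𝓗] [MeasurableSingletonClass 𝓗] {μ : Measure Ω} [IsProbabilityMeasure μ]
    {ν : Measure Ω'} [IsProbabilityMeasure ν] {D : Ω → 𝒟} {T : Ω → 𝒯} {q : 𝒟 → 𝒯 → ℝ}
    (h : IsCondLaw μ D T q) {F : Ω' → 𝓗} (hF : Measurable F) {𝓕 : Finset 𝓗} (h𝓕 : 𝓕.Nonempty)
    (hνF : ν.map F = (PMF.uniformOfFinset 𝓕 h𝓕).toMeasure) (ev : 𝓗 → 𝒟 → 𝒮)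
    (huniv : ∀ r r', r ≠ r' → ((𝓕.filter fun f => ev f r = ev f r').card : ℝ) / 𝓕.card ≤
      1 / Fintype.card 𝒮) (φ : 𝒟 → ℳ) {β θ : ℝ} (hβ : 0 < β) (h0 : 0 < θ) (h1 : θ ≤ 1) :
    Real.log (Fintype.card 𝒮) - (Fintype.card ℳ * β * Real.log (1 + Fintype.card 𝒮) +
        (Fintype.card 𝒮 / β) ^ θ / θ * ∫ ω, ∑ d, q d (T ω) ^ (1 + θ) ∂μ) ≤
      condEntropy (μ.prod ν) (fun ω => ev (F ω.2) (D ω.1))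
        (fun ω => ((T ω.1, F ω.2), φ (D ω.1))) * Real.log 2 := by
  classical
  have hκ : ∀ (d : 𝒟) (k : 𝒮), MeasurableSet {t : 𝒯 × 𝓗 | ev t.2 d = k} := fun d k =>
    measurable_snd (Set.toFinite {f | ev f d = k}).measurableSet
  have hP := h.prod (ν := ν) hF
  have hent := hP.condEntropy_key (κ := fun t d => ev t.2 d) hκ φ
  have hkey := hP.key (κ := fun t d => ev t.2 d) hκ φ
  rw [hent]
  have hT := h.measurable_obs
  let Ψ : 𝒯 → 𝓗 → ℝ := fun t f => ∑ d, q d t * ∑ k,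
    Real.negMulLog (keyGivenMessage φ (ev f) (fun d => q d t) k (φ d))
  have hΨm : ∀ f, Measurable fun t => Ψ t f := fun f =>
    Finset.measurable_sum _ fun d _ => (h.measurable d).mul <|
      Finset.measurable_sum _ fun k _ => Real.continuous_negMulLog.measurable.comp
        (measurable_keyGivenMessage (κ := fun _ => ev f) h.measurable
          (fun d k => MeasurableSet.const _) φ k _)
  have hΨb : ∀ t f, |Ψ t f| ≤ Fintype.card 𝒮 := by
    intro t f
    have hin : ∀ d, 0 ≤ ∑ k, Real.negMulLog
        (keyGivenMessage φ (ev f) (fun d => q d t) k (φ d)) ∧ ∑ k, Real.negMulLog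
        (keyGivenMessage φ (ev f) (fun d => q d t) k (φ d)) ≤ Fintype.card 𝒮 := by
      intro d
      constructor
      · exact Finset.sum_nonneg fun k _ => Real.negMulLog_nonneg
          (hkey.nonneg k ((t, f), φ d)) (hkey.le_one k ((t, f), φ d))
      · refine (Finset.sum_le_sum (g := fun _ => (1 : ℝ)) fun k _ => ?_).trans_eq (by simp)
        have h0 := hkey.nonneg k ((t, f), φ d)
        exact (Real.negMulLog_le_one_sub_self h0).trans (sub_le_self _ h0)
    rw [abs_of_nonneg (Finset.sum_nonneg fun d _ => mul_nonneg (h.nonneg d t) (hin d).1)]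
    calc Ψ t f ≤ ∑ d, q d t * (Fintype.card 𝒮 : ℝ) :=
          Finset.sum_le_sum fun d _ => mul_le_mul_of_nonneg_left (hin d).2 (h.nonneg d t)
      _ = Fintype.card 𝒮 := by rw [← Finset.sum_mul, h.sum_eq_one, one_mul]
  have hΨm2 : Measurable fun p : 𝒯 × 𝓗 => Ψ p.1 p.2 :=
    measurable_from_prod_countable_left hΨm
  have hfub : ∫ ω, Ψ (T ω.1) (F ω.2) ∂(μ.prod ν) =
      ∫ ω, ∑ f ∈ 𝓕, (𝓕.card : ℝ)⁻¹ * Ψ (T ω) f ∂μ := by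
    rw [integral_prod]
    · refine integral_congr_ae (ae_of_all _ fun ω => ?_)
      dsimp only
      rw [← integral_map (φ := F) (f := fun f => Ψ (T ω) f) hF.aemeasurable
        (measurable_of_finite _).aestronglyMeasurable, hνF, PMF.integral_eq_sum]
      simp only [PMF.uniformOfFinset_apply, smul_eq_mul]
      rw [← Finset.sum_subset (Finset.subset_univ 𝓕)]
      · refine Finset.sum_congr rfl fun f hf => ?_
        simp [hf]
      · intro f _ hf
        simp [hf]
    · exact integrable_of_measurable_of_bounded (hΨm2.comp
        ((hT.comp measurable_fst).prodMk (hF.comp measurable_snd))) fun ω => hΨb _ _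
  change _ ≤ ∫ ω, Ψ (T ω.1) (F ω.2) ∂(μ.prod ν)
  rw [hfub]
  have hpow : Integrable (fun ω => ∑ d, q d (T ω) ^ (1 + θ)) μ := by
    refine integrable_finsetSum _ fun d _ => integrable_of_measurable_of_bounded (C := 1)
      (((h.measurable d).comp hT).pow_const _) fun ω => ?_
    have := h.nonneg d (T ω)
    rw [abs_of_nonneg (Real.rpow_nonneg this _)]
    exact Real.rpow_le_one this (h.le_one _ _) (by linarith)
  have hexc : Integrable (fun ω => Fintype.card ℳ * β * Real.log (1 + Fintype.card 𝒮) +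
      (Fintype.card 𝒮 / β) ^ θ / θ * ∑ d, q d (T ω) ^ (1 + θ)) μ :=
    (integrable_const _).add (hpow.const_mul _)
  have hlow : Real.log (Fintype.card 𝒮) - (Fintype.card ℳ * β * Real.log (1 + Fintype.card 𝒮) +
        (Fintype.card 𝒮 / β) ^ θ / θ * ∫ ω, ∑ d, q d (T ω) ^ (1 + θ) ∂μ) =
      ∫ ω, (Real.log (Fintype.card 𝒮) - (Fintype.card ℳ * β * Real.log (1 + Fintype.card 𝒮) +
        (Fintype.card 𝒮 / β) ^ θ / θ * ∑ d, q d (T ω) ^ (1 + θ))) ∂μ := by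
    rw [integral_sub (integrable_const _) hexc,
      integral_add (integrable_const _) (hpow.const_mul _),
      integral_const_mul _ fun ω => ∑ d, q d (T ω) ^ (1 + θ)]
    simp
  rw [hlow]
  refine integral_mono ((integrable_const _).sub hexc)
    (integrable_finsetSum _ fun f _ => (integrable_of_measurable_of_bounded
      ((hΨm f).comp hT) fun ω => hΨb _ _).const_mul _) fun ω => ?_
  have a1 := log_card_sub_le_average_entropy (φ := φ) (q := fun d => q d (T ω))
    (fun d => h.nonneg d _) (h.sum_eq_one _) ev h𝓕 huniv
  have a2 := sum_log_excess_le (φ := φ) (q := fun d => q d (T ω)) (s := Fintype.card 𝒮)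
    (fun d => h.nonneg d _) (Nat.cast_nonneg _) hβ h0 h1
  dsimp only at a1 a2 ⊢
  linarith

/-! ### Exponential bounds for Rényi sums -/

/-- Second-order expansion of `t ↦ p ^ (1 + t)` at `t = 0`, uniformly in the probability `p`. -/
theorem rpow_one_add_le {p t : ℝ} (h0 : 0 ≤ p) (h1 : p ≤ 1) (ht : |t| ≤ 1 / 2) :
    p ^ (1 + t) ≤ p - t * Real.negMulLog p + 16 * t ^ 2 := by
  obtain ⟨ht1, ht2⟩ := abs_le.1 ht
  rcases h0.eq_or_lt with rfl | hp
  · rw [Real.zero_rpow (by linarith)]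
    simp only [Real.negMulLog_zero]
    nlinarith [sq_nonneg t]
  set v := -Real.log p with hv
  have hv0 : 0 ≤ v := by have := Real.log_nonpos h0 h1; linarith
  have hpv : p = Real.exp (-v) := by rw [hv, neg_neg, Real.exp_log hp]
  have e1 : p ^ (1 + t) = p * Real.exp (-(t * v)) := by
    rw [Real.rpow_add hp, Real.rpow_one, Real.rpow_def_of_pos hp]
    congr 2
    rw [hv]; ring
  have e2 : Real.negMulLog p = p * v := by simp only [Real.negMulLog, hv]; ring
  have hexp : Real.exp (-(t * v)) ≤ 1 - t * v + (t * v) ^ 2 * Real.exp (v / 2) := by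
    have h2 : |Real.exp (-(t * v)) - (1 + -(t * v))| ≤ |(-(t * v))| ^ 2 * Real.exp |(-(t * v))| := by
      have h2 := Complex.norm_exp_sub_sum_le_norm_mul_exp ((-(t * v) : ℝ) : ℂ) 2
      simp only [Finset.sum_range_succ, Finset.sum_range_zero, pow_zero, Nat.factorial, pow_one,
        Nat.cast_one, div_one, zero_add, mul_one] at h2
      rw [← Complex.ofReal_exp, ← Complex.ofReal_one, ← Complex.ofReal_add, ← Complex.ofReal_sub,
        Complex.norm_real, Complex.norm_real, Real.norm_eq_abs, Real.norm_eq_abs] at h2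
      exact h2
    have h3 : |(-(t * v))| ≤ v / 2 := by
      rw [abs_neg, abs_mul, abs_of_nonneg hv0]
      nlinarith
    have h4 := Real.exp_le_exp.2 h3
    have h5 := (abs_le.1 h2).2
    rw [sq_abs, neg_sq] at h5
    have h6 := mul_le_mul_of_nonneg_left h4 (sq_nonneg (t * v))
    linarith
  -- `v ^ 2 * exp (-v / 2)` is bounded
  have hbd : v ^ 2 ≤ 16 * Real.exp (v / 2) := by
    have h4 := Real.add_one_le_exp (v / 4)
    have h5 : Real.exp (v / 2) = Real.exp (v / 4) ^ 2 := by
      rw [← Real.exp_nat_mul]; congr 1; push_cast; ring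
    rw [h5]
    nlinarith
  have hpe : p * (Real.exp (v / 2) * Real.exp (v / 2)) = 1 := by
    rw [hpv, ← Real.exp_add, ← Real.exp_add]
    norm_num
  have hfin : p * ((t * v) ^ 2 * Real.exp (v / 2)) ≤ 16 * t ^ 2 := by
    calc p * ((t * v) ^ 2 * Real.exp (v / 2))
        = t ^ 2 * (p * Real.exp (v / 2)) * v ^ 2 := by ring
      _ ≤ t ^ 2 * (p * Real.exp (v / 2)) * (16 * Real.exp (v / 2)) := by gcongr
      _ = 16 * t ^ 2 * (p * (Real.exp (v / 2) * Real.exp (v / 2))) := by ring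
      _ = 16 * t ^ 2 := by rw [hpe, mul_one]
  rw [e1, e2]
  have := mul_le_mul_of_nonneg_left hexp h0
  linarith

section Renyi

variable {Ω 𝒟 𝒯 : Type} [MeasurableSpace Ω] [Fintype 𝒟] [MeasurableSpace 𝒯] {μ : Measure Ω}
  [IsProbabilityMeasure μ] {D : Ω → 𝒟} {T : Ω → 𝒯} {q : 𝒟 → 𝒯 → ℝ}

theorem IsCondLaw.integrable_sum_rpow (h : IsCondLaw μ D T q) {t : ℝ} (ht : |t| ≤ 1 / 2) :
    Integrable (fun ω => ∑ d, q d (T ω) ^ (1 + t)) μ := by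
  refine integrable_finsetSum _ fun d _ => integrable_of_measurable_of_bounded (C := 1)
    (((h.measurable d).comp h.measurable_obs).pow_const _) fun ω => ?_
  have := h.nonneg d (T ω)
  rw [abs_of_nonneg (Real.rpow_nonneg this _)]
  exact Real.rpow_le_one this (h.le_one _ _) (by linarith [(abs_le.1 ht).1])

theorem IsCondLaw.integral_sum_rpow_le (h : IsCondLaw μ D T q) {t : ℝ} (ht : |t| ≤ 1 / 2) :
    ∫ ω, ∑ d, q d (T ω) ^ (1 + t) ∂μ ≤
      Real.exp (-t * (condEntropy μ D T * Real.log 2) + 16 * Fintype.card 𝒟 * t ^ 2) := by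
  have hη : Integrable (fun ω => ∑ d, Real.negMulLog (q d (T ω))) μ := by
    refine integrable_finsetSum _ fun d _ => integrable_of_measurable_of_bounded (C := 1)
      (Real.continuous_negMulLog.measurable.comp ((h.measurable d).comp h.measurable_obs))
      fun ω => ?_
    have h0 := h.nonneg d (T ω)
    rw [abs_of_nonneg (Real.negMulLog_nonneg h0 (h.le_one _ _))]
    exact (Real.negMulLog_le_one_sub_self h0).trans (sub_le_self _ h0)
  calc ∫ ω, ∑ d, q d (T ω) ^ (1 + t) ∂μ
      ≤ ∫ ω, (1 + 16 * Fintype.card 𝒟 * t ^ 2 - t * ∑ d, Real.negMulLog (q d (T ω))) ∂μ := by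
        refine integral_mono (h.integrable_sum_rpow ht)
          ((integrable_const _).sub (hη.const_mul t)) fun ω => ?_
        calc ∑ d, q d (T ω) ^ (1 + t)
            ≤ ∑ d, (q d (T ω) - t * Real.negMulLog (q d (T ω)) + 16 * t ^ 2) :=
              Finset.sum_le_sum fun d _ => rpow_one_add_le (h.nonneg _ _) (h.le_one _ _) ht
          _ = 1 + 16 * Fintype.card 𝒟 * t ^ 2 - t * ∑ d, Real.negMulLog (q d (T ω)) := by
              rw [Finset.sum_add_distrib, Finset.sum_sub_distrib, h.sum_eq_one, ← Finset.mul_sum]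
              simp
              ring
    _ = -t * (condEntropy μ D T * Real.log 2) + 16 * Fintype.card 𝒟 * t ^ 2 + 1 := by
        rw [integral_sub (integrable_const _) (hη.const_mul t), integral_const_mul,
          h.condEntropy_mul_log_two]
        simp
        ring
    _ ≤ _ := Real.add_one_le_exp _

/-- Rényi sums of i.i.d. blocks are multiplicative. -/
theorem IsCondLaw.integral_sum_prod_rpow_le (n : ℕ) (h : IsCondLaw μ D T q) {t : ℝ}
    (ht : |t| ≤ 1 / 2) :
    ∫ ω, ∑ d : Fin n → 𝒟, (∏ i, q (d i) (T (ω i))) ^ (1 + t) ∂(Measure.pi fun _ : Fin n => μ) ≤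
      Real.exp (n * (-t * (condEntropy μ D T * Real.log 2) + 16 * Fintype.card 𝒟 * t ^ 2)) := by
  classical
  have e : ∀ ω : Fin n → Ω, ∑ d : Fin n → 𝒟, (∏ i, q (d i) (T (ω i))) ^ (1 + t) =
      ∏ i, ∑ d, q d (T (ω i)) ^ (1 + t) := by
    intro ω
    have := Finset.prod_univ_sum (fun _ : Fin n => (Finset.univ : Finset 𝒟))
      (fun i d => q d (T (ω i)) ^ (1 + t))
    rw [Fintype.piFinset_univ] at this
    rw [this]
    exact Finset.sum_congr rfl fun d _ =>
      (Real.finsetProd_rpow _ _ (fun i _ => h.nonneg _ _) _).symm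
  simp only [e]
  rw [integral_fintype_prod_eq_prod (fun _ ω => ∑ d, q d (T ω) ^ (1 + t)), Finset.prod_const,
    Finset.card_univ, Fintype.card_fin, Real.exp_nat_mul]
  exact pow_le_pow_left₀ (integral_nonneg fun ω => Finset.sum_nonneg fun d _ =>
    Real.rpow_nonneg (h.nonneg _ _) _) (h.integral_sum_rpow_le ht) n

end Renyi

/-! ### Source coding with side information at the decoder -/

/-- The functions that identify two given points are a fraction `1 / m` of all functions. -/
theorem card_filter_apply_eq_mul {𝒟 : Type} [Fintype 𝒟] [DecidableEq 𝒟] {m : ℕ} {r r' : 𝒟}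
    (h : r ≠ r') :
    (Finset.univ.filter fun e : 𝒟 → Fin m => e r = e r').card * m =
      Fintype.card (𝒟 → Fin m) := by
  have e : {e : 𝒟 → Fin m // e r = e r'} × Fin m ≃ (𝒟 → Fin m) :=
    { toFun := fun p => Function.update p.1.1 r p.2
      invFun := fun e => (⟨Function.update e r (e r'), by simp [Function.update_of_ne h.symm]⟩, e r)
      left_inv := by
        rintro ⟨⟨e, he⟩, k⟩
        simp [Function.update_of_ne h.symm, ← he]
      right_inv := fun e => by simp }
  rw [← Fintype.card_congr e, Fintype.card_prod, Fintype.card_fin, Fintype.card_subtype]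

theorem measurableSet_decoding_error {Ω 𝒟 𝒯 ℳ : Type} [MeasurableSpace Ω] [Finite 𝒟]
    [MeasurableSpace 𝒯] {D : Ω → 𝒟} {T : Ω → 𝒯} (hD : ∀ d, MeasurableSet (D ⁻¹' {d}))
    (hT : Measurable T) (enc : 𝒟 → ℳ) {dec : ℳ → 𝒯 → 𝒟}
    (hdec : ∀ k d, MeasurableSet {t | dec k t = d}) :
    MeasurableSet {ω | dec (enc (D ω)) (T ω) ≠ D ω} := by
  have : {ω | dec (enc (D ω)) (T ω) ≠ D ω} =
      ⋃ d, (D ⁻¹' {d} ∩ T ⁻¹' {t | dec (enc d) t = d}ᶜ) := by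
    ext ω; simp
  rw [this]
  exact MeasurableSet.iUnion fun d => (hD d).inter (hT (hdec (enc d) d).compl)

/-- **Random binning.** There is an encoder into `m` bins and a decoder that finds the unique element
of the bin whose conditional probability is at least `γ`; the error probability is bounded by that of
an atypical source value plus the collision probability `1 / (γ m)`. -/
theorem IsCondLaw.exists_code {Ω 𝒟 𝒯 : Type} [MeasurableSpace Ω] [Fintype 𝒟] [Nonempty 𝒟]
    [MeasurableSpace 𝒯] {μ : Measure Ω} [IsProbabilityMeasure μ] {D : Ω → 𝒟} {T : Ω → 𝒯}
    {q : 𝒟 → 𝒯 → ℝ} (h : IsCondLaw μ D T q) {m : ℕ} (hm : 0 < m) {γ θ : ℝ} (hγ : 0 < γ)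
    (h0 : 0 < θ) (h1 : θ < 1) :
    ∃ (enc : 𝒟 → Fin m) (dec : Fin m → 𝒯 → 𝒟), (∀ k d, MeasurableSet {t | dec k t = d}) ∧
      μ.real {ω | dec (enc (D ω)) (T ω) ≠ D ω} ≤
        γ ^ θ * ∫ ω, ∑ d, q d (T ω) ^ (1 - θ) ∂μ + 1 / (γ * m) := by
  classical
  have : Nonempty (Fin m) := ⟨⟨0, hm⟩⟩
  have hT := h.measurable_obs
  have hm' : (0 : ℝ) < m := by exact_mod_cast hm
  let G : 𝒯 → Finset 𝒟 := fun t => Finset.univ.filter fun d => γ ≤ q d t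
  let pick : (𝒟 → Fin m) → Fin m → Finset 𝒟 → 𝒟 := fun e k s =>
    if hs : ∃ d ∈ s, e d = k ∧ ∀ d' ∈ s, e d' = k → d' = d then hs.choose
    else Classical.arbitrary 𝒟
  have hGm : ∀ s, MeasurableSet {t | G t = s} := by
    intro s
    have : {t | G t = s} = ⋂ d, {t | γ ≤ q d t ↔ d ∈ s} := by
      ext t
      simp [G, Finset.ext_iff]
    rw [this]
    refine MeasurableSet.iInter fun d => ?_
    by_cases hd : d ∈ s
    · simp only [hd, iff_true]
      exact measurableSet_le measurable_const (h.measurable d)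
    · simp only [hd, iff_false, not_le]
      exact measurableSet_lt (h.measurable d) measurable_const
  have hdec : ∀ e k d, MeasurableSet {t | pick e k (G t) = d} := by
    intro e k d
    have : {t | pick e k (G t) = d} =
        ⋃ s ∈ Finset.univ.filter fun s => pick e k s = d, {t | G t = s} := by
      ext t; simp
    rw [this]
    exact Finset.measurableSet_biUnion _ fun s _ => hGm s
  -- a decoding error needs an atypical source value or a typical competitor in the same bin
  have herr : ∀ e ω, pick e (e (D ω)) (G (T ω)) ≠ D ω →
      q (D ω) (T ω) < γ ∨ ∃ d, d ≠ D ω ∧ γ ≤ q d (T ω) ∧ e d = e (D ω) := by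
    intro e ω hne
    by_contra hcon
    push Not at hcon
    obtain ⟨hc1, hc2⟩ := hcon
    have hex : ∃ d ∈ G (T ω), e d = e (D ω) ∧
        ∀ d' ∈ G (T ω), e d' = e (D ω) → d' = d := by
      refine ⟨D ω, by simpa [G] using hc1, rfl, fun d' hd' hed => ?_⟩
      by_contra hdd
      exact hc2 d' hdd (by simpa [G] using hd') hed
    apply hne
    have hp : pick e (e (D ω)) (G (T ω)) = hex.choose := dif_pos hex
    rw [hp]
    exact (hex.choose_spec.2.2 (D ω) (by simpa [G] using hc1) rfl).symm
  let err : (𝒟 → Fin m) → Set Ω := fun e => {ω | pick e (e (D ω)) (G (T ω)) ≠ D ω}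
  have herrm : ∀ e, MeasurableSet (err e) := fun e =>
    measurableSet_decoding_error h.measurableSet_fiber hT e (hdec e)
  have hpoint : ∀ ω, ∑ e, (err e).indicator (fun _ => (1 : ℝ)) ω ≤
      Fintype.card (𝒟 → Fin m) * ((if q (D ω) (T ω) < γ then 1 else 0) + 1 / (γ * m)) := by
    intro ω
    have hsum : ∑ d, (if d ≠ D ω ∧ γ ≤ q d (T ω) then (1 : ℝ) else 0) ≤ 1 / γ := by
      calc ∑ d, (if d ≠ D ω ∧ γ ≤ q d (T ω) then (1 : ℝ) else 0) ≤ ∑ d, q d (T ω) / γ := by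
            refine Finset.sum_le_sum fun d _ => ?_
            split_ifs with hd
            · rw [le_div_iff₀ hγ, one_mul]; exact hd.2
            · exact div_nonneg (h.nonneg _ _) hγ.le
        _ = 1 / γ := by rw [← Finset.sum_div, h.sum_eq_one]
    have hcount : ∀ d, ∑ e : 𝒟 → Fin m,
        (if d ≠ D ω ∧ γ ≤ q d (T ω) ∧ e d = e (D ω) then (1 : ℝ) else 0) =
        (if d ≠ D ω ∧ γ ≤ q d (T ω) then (1 : ℝ) else 0) *
          (Fintype.card (𝒟 → Fin m) / m) := by
      intro d
      by_cases hd : d ≠ D ω ∧ γ ≤ q d (T ω)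
      · have hc := card_filter_apply_eq_mul (m := m) hd.1
        simp only [hd.1, hd.2, ne_eq, not_false_eq_true, true_and, and_self, if_true, one_mul]
        rw [eq_div_iff hm'.ne', Finset.sum_boole]
        exact_mod_cast hc
      · have : ∀ e : 𝒟 → Fin m, ¬(d ≠ D ω ∧ γ ≤ q d (T ω) ∧ e d = e (D ω)) :=
          fun e hh => hd ⟨hh.1, hh.2.1⟩
        simp only [this, hd, if_false, Finset.sum_const_zero, zero_mul]
    calc ∑ e, (err e).indicator (fun _ => (1 : ℝ)) ω
        ≤ ∑ e : 𝒟 → Fin m, ((if q (D ω) (T ω) < γ then (1 : ℝ) else 0) +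
            ∑ d, if d ≠ D ω ∧ γ ≤ q d (T ω) ∧ e d = e (D ω) then (1 : ℝ) else 0) := by
          refine Finset.sum_le_sum fun e _ => ?_
          have hs0 : 0 ≤ ∑ d, if d ≠ D ω ∧ γ ≤ q d (T ω) ∧ e d = e (D ω) then (1 : ℝ) else 0 :=
            Finset.sum_nonneg fun d _ => by split_ifs <;> norm_num
          by_cases hω : ω ∈ err e
          · rw [Set.indicator_of_mem hω]
            rcases herr e ω hω with hlt | ⟨d, hd⟩
            · rw [if_pos hlt]; linarith
            · have h1 : (1 : ℝ) ≤
                  ∑ d, if d ≠ D ω ∧ γ ≤ q d (T ω) ∧ e d = e (D ω) then (1 : ℝ) else 0 := by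
                refine le_trans ?_ (Finset.single_le_sum (f := fun d =>
                  if d ≠ D ω ∧ γ ≤ q d (T ω) ∧ e d = e (D ω) then (1 : ℝ) else 0)
                  (fun d _ => by split_ifs <;> norm_num) (Finset.mem_univ d))
                rw [if_pos hd]
              have : (0 : ℝ) ≤ if q (D ω) (T ω) < γ then (1 : ℝ) else 0 := by
                split_ifs <;> norm_num
              linarith
          · rw [Set.indicator_of_notMem hω]
            exact add_nonneg (by split_ifs <;> norm_num) hs0
      _ = Fintype.card (𝒟 → Fin m) * (if q (D ω) (T ω) < γ then (1 : ℝ) else 0) +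
          (∑ d, if d ≠ D ω ∧ γ ≤ q d (T ω) then (1 : ℝ) else 0) *
            (Fintype.card (𝒟 → Fin m) / m) := by
          rw [Finset.sum_add_distrib, Finset.sum_comm, Finset.sum_mul]
          simp only [hcount]
          simp
      _ ≤ Fintype.card (𝒟 → Fin m) * (if q (D ω) (T ω) < γ then (1 : ℝ) else 0) +
          1 / γ * (Fintype.card (𝒟 → Fin m) / m) := by gcongr
      _ = _ := by field_simp
  have hatyp : ∫ ω, (if q (D ω) (T ω) < γ then (1 : ℝ) else 0) ∂μ ≤
      γ ^ θ * ∫ ω, ∑ d, q d (T ω) ^ (1 - θ) ∂μ := by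
    rw [h.integral_eq (g := fun d t => if q d t < γ then (1 : ℝ) else 0) (C := 1)
      (fun d => Measurable.ite (measurableSet_lt (h.measurable d) measurable_const)
        measurable_const measurable_const) (fun d t => by split_ifs <;> simp),
      ← integral_const_mul]
    have hqT : ∀ d, Measurable fun ω => q d (T ω) := fun d => (h.measurable d).comp hT
    refine integral_mono (integrable_finsetSum _ fun d _ =>
      integrable_of_measurable_of_bounded (C := 1) ((hqT d).mul (Measurable.ite
        (measurableSet_lt (hqT d) measurable_const) measurable_const measurable_const))
        fun ω => ?_)
      ((integrable_finsetSum _ fun d _ => integrable_of_measurable_of_bounded (C := 1)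
        ((hqT d).pow_const _) fun ω => ?_).const_mul _) fun ω => ?_
    · rw [abs_of_nonneg (mul_nonneg (h.nonneg _ _) (by split_ifs <;> norm_num))]
      split_ifs
      · rw [mul_one]; exact h.le_one _ _
      · rw [mul_zero]; exact zero_le_one
    · rw [abs_of_nonneg (Real.rpow_nonneg (h.nonneg _ _) _)]
      exact Real.rpow_le_one (h.nonneg _ _) (h.le_one _ _) (by linarith)
    · dsimp only
      rw [Finset.mul_sum]
      refine Finset.sum_le_sum fun d _ => ?_
      have hr := Real.rpow_nonneg (h.nonneg d (T ω)) (1 - θ)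
      split_ifs with hlt
      · rcases (h.nonneg d (T ω)).eq_or_lt with hq | hq
        · rw [← hq]
          simp only [zero_mul]
          exact mul_nonneg (Real.rpow_nonneg hγ.le _) (Real.rpow_nonneg le_rfl _)
        · have e1 : q d (T ω) = q d (T ω) ^ θ * q d (T ω) ^ (1 - θ) := by
            rw [← Real.rpow_add hq]; simp
          rw [mul_one]
          calc q d (T ω) = q d (T ω) ^ θ * q d (T ω) ^ (1 - θ) := e1
            _ ≤ γ ^ θ * q d (T ω) ^ (1 - θ) :=
              mul_le_mul_of_nonneg_right (Real.rpow_le_rpow hq.le hlt.le h0.le) hr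
      · rw [mul_zero]
        exact mul_nonneg (Real.rpow_nonneg hγ.le _) hr
  have hint : Integrable (fun ω => if q (D ω) (T ω) < γ then (1 : ℝ) else 0) μ :=
    integrable_of_measurable_of_bounded (C := 1)
      (measurable_finite_comp (g := fun d ω => if q d (T ω) < γ then (1 : ℝ) else 0)
        h.measurableSet_fiber fun d => Measurable.ite
          (measurableSet_lt ((h.measurable d).comp hT) measurable_const) measurable_const
          measurable_const) fun ω => by split_ifs <;> simp
  have htotal : ∑ e, μ.real (err e) ≤ ∑ _e : 𝒟 → Fin m,
      (γ ^ θ * ∫ ω, ∑ d, q d (T ω) ^ (1 - θ) ∂μ + 1 / (γ * m)) := by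
    have e1 : ∀ e, μ.real (err e) = ∫ ω, (err e).indicator (fun _ => (1 : ℝ)) ω ∂μ := fun e => by
      rw [integral_indicator (herrm e)]; simp
    simp only [e1]
    rw [← integral_finsetSum _ fun e _ => (integrable_const _).indicator (herrm e)]
    refine (integral_mono (integrable_finsetSum _ fun e _ =>
      (integrable_const _).indicator (herrm e)) ((hint.add (integrable_const _)).const_mul _)
      hpoint).trans ?_
    rw [integral_const_mul]
    simp only [Pi.add_apply]
    rw [integral_add hint (integrable_const _)]
    simp only [integral_const, probReal_univ, one_smul, Finset.sum_const, Finset.card_univ,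
      nsmul_eq_mul]
    gcongr
  obtain ⟨e, -, he⟩ := Finset.exists_le_of_sum_le Finset.univ_nonempty htotal
  exact ⟨e, fun k t => pick e k (G t), hdec e, he⟩

/-- A small Rényi parameter at which the first-order gain `δ` beats the second-order term. -/
theorem exists_renyi_parameter (C : ℝ) {δ : ℝ} (hδ : 0 < δ) :
    ∃ θ : ℝ, 0 < θ ∧ θ ≤ 1 / 2 ∧ C * θ ≤ δ := by
  refine ⟨min (1 / 2) (δ / (|C| + 1)), by positivity, min_le_left _ _, ?_⟩
  calc C * min (1 / 2) (δ / (|C| + 1)) ≤ (|C| + 1) * (δ / (|C| + 1)) :=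
        mul_le_mul (by linarith [le_abs_self C]) (min_le_right _ _) (by positivity) (by positivity)
    _ = δ := by field_simp

/-- Above the conditional entropy, i.i.d. sources can be encoded with exponentially small error
probability. -/
theorem IsCondLaw.exists_block_code {Ω 𝒟 𝒯 : Type} [MeasurableSpace Ω] [Fintype 𝒟] [Nonempty 𝒟]
    [MeasurableSpace 𝒯] {μ : Measure Ω} [IsProbabilityMeasure μ] {D : Ω → 𝒟} {T : Ω → 𝒯}
    {q : 𝒟 → 𝒯 → ℝ} (h : IsCondLaw μ D T q) {δ : ℝ} (hδ : 0 < δ) :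
    ∃ c : ℝ, 0 < c ∧ ∀ n m : ℕ,
      Real.exp (n * (condEntropy μ D T * Real.log 2 + δ)) ≤ m →
      ∃ (enc : (Fin n → 𝒟) → Fin m) (dec : Fin m → (Fin n → 𝒯) → (Fin n → 𝒟)),
        (∀ k d, MeasurableSet {t | dec k t = d}) ∧
        (Measure.pi fun _ : Fin n => μ).real {ω |
          dec (enc fun i => D (ω i)) (fun i => T (ω i)) ≠ fun i => D (ω i)} ≤
          2 * Real.exp (-(n * c)) := by
  set H := condEntropy μ D T * Real.log 2 with hH
  obtain ⟨θ, h0, h1, hC⟩ := exists_renyi_parameter (16 * Fintype.card 𝒟) (show 0 < δ / 4 by linarith)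
  refine ⟨θ * (δ / 4), by positivity, fun n m hm => ?_⟩
  have hm0 : 0 < m := by
    have := (Real.exp_pos _).trans_le hm
    exact_mod_cast this
  have hm' : (0 : ℝ) < m := by exact_mod_cast hm0
  obtain ⟨enc, dec, hdm, herr⟩ := (h.pi n).exists_code hm0
    (Real.exp_pos (-(n * (H + δ / 2)))) h0 (show θ < 1 by linarith)
  refine ⟨enc, dec, hdm, herr.trans ?_⟩
  have hR := h.integral_sum_prod_rpow_le n (t := -θ) (by rw [abs_neg, abs_of_pos h0]; exact h1)
  rw [← sub_eq_add_neg, ← hH] at hR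
  have b1 : Real.exp (-(n * (H + δ / 2))) ^ θ *
      ∫ ω, ∑ d : Fin n → 𝒟, (∏ i, q (d i) (T (ω i))) ^ (1 - θ) ∂(Measure.pi fun _ : Fin n => μ) ≤
      Real.exp (-(n * (θ * (δ / 4)))) := by
    rw [← Real.exp_mul]
    refine (mul_le_mul_of_nonneg_left hR (Real.exp_pos _).le).trans ?_
    rw [← Real.exp_add, Real.exp_le_exp]
    have : 0 ≤ (n : ℝ) * θ * (δ / 4 - 16 * Fintype.card 𝒟 * θ) :=
      mul_nonneg (by positivity) (by linarith)
    linarith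
  have b2 : 1 / (Real.exp (-(n * (H + δ / 2))) * m) ≤ Real.exp (-(n * (θ * (δ / 4)))) := by
    rw [div_le_iff₀ (by positivity)]
    have h2 : Real.exp (-(n * (H + δ / 2))) * Real.exp (n * (H + δ)) ≤
        Real.exp (-(n * (H + δ / 2))) * m := by gcongr
    have h3 : (1 : ℝ) ≤ Real.exp (-(n * (θ * (δ / 4)))) *
        (Real.exp (-(n * (H + δ / 2))) * Real.exp (n * (H + δ))) := by
      rw [← Real.exp_add, ← Real.exp_add, Real.one_le_exp_iff]
      have : 0 ≤ (n : ℝ) * δ * (1 / 2 - θ / 4) := mul_nonneg (by positivity) (by linarith)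
      linarith
    exact h3.trans (mul_le_mul_of_nonneg_left h2 (Real.exp_pos _).le)
  linarith

/-! ### Privacy amplification for i.i.d. blocks -/

/-- If keys and messages together number less than `exp (n (H - δ))`, up to a constant factor, then
the hashed block is uniform up to an exponentially small entropy defect. -/
theorem IsCondLaw.exists_block_amplification {Ω 𝒟 𝒯 : Type} [MeasurableSpace Ω] [Fintype 𝒟]
    [MeasurableSpace 𝒯] {μ : Measure Ω} [IsProbabilityMeasure μ] {D : Ω → 𝒟} {T : Ω → 𝒯}
    {q : 𝒟 → 𝒯 → ℝ} (h : IsCondLaw μ D T q) {δ B : ℝ} (hδ : 0 < δ) (hB : 1 ≤ B) :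
    ∃ c A : ℝ, 0 < c ∧ ∀ (n : ℕ) {Ω₁ Ω' ℳ 𝒮 𝓗 : Type} [MeasurableSpace Ω₁] [MeasurableSpace Ω']
      [Fintype ℳ] [Nonempty ℳ] [MeasurableSpace ℳ] [MeasurableSingletonClass ℳ] [Fintype 𝒮]
      [Nonempty 𝒮] [DecidableEq 𝒮] [Fintype 𝓗] [MeasurableSpace 𝓗] [MeasurableSingletonClass 𝓗]
      {μ₁ : Measure Ω₁} [IsProbabilityMeasure μ₁] {ν : Measure Ω'} [IsProbabilityMeasure ν]
      {e : (Fin n → Ω) → Ω₁} {D₁ : Ω₁ → Fin n → 𝒟} {T₁ : Ω₁ → Fin n → 𝒯}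
      (_ : MeasurePreserving e (Measure.pi fun _ => μ) μ₁)
      (_ : ∀ d, MeasurableSet (D₁ ⁻¹' {d})) (_ : Measurable T₁)
      (_ : ∀ ω i, D₁ (e ω) i = D (ω i)) (_ : ∀ ω i, T₁ (e ω) i = T (ω i))
      {F : Ω' → 𝓗} (_ : Measurable F) {𝓕 : Finset 𝓗} (h𝓕 : 𝓕.Nonempty)
      (_ : ν.map F = (PMF.uniformOfFinset 𝓕 h𝓕).toMeasure) (ev : 𝓗 → (Fin n → 𝒟) → 𝒮)
      (_ : ∀ r r', r ≠ r' → ((𝓕.filter fun f => ev f r = ev f r').card : ℝ) / 𝓕.card ≤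
        1 / Fintype.card 𝒮) (φ : (Fin n → 𝒟) → ℳ)
      (_ : (Fintype.card 𝒮 : ℝ) * Fintype.card ℳ ≤
        B * Real.exp (n * (condEntropy μ D T * Real.log 2 - δ))),
      Real.log (Fintype.card 𝒮) -
          Real.exp (-(n * c)) * (Real.log (1 + Fintype.card 𝒮) + A) ≤
        condEntropy (μ₁.prod ν) (fun ω => ev (F ω.2) (D₁ ω.1))
          (fun ω => ((T₁ ω.1, F ω.2), φ (D₁ ω.1))) * Real.log 2 := by
  set H := condEntropy μ D T * Real.log 2 with hH
  obtain ⟨θ, h0, h1, hC⟩ := exists_renyi_parameter (16 * Fintype.card 𝒟)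
    (show 0 < δ / 4 by linarith)
  refine ⟨θ * (δ / 4), B / θ, by positivity, ?_⟩
  intro n Ω₁ Ω' ℳ 𝒮 𝓗 _ _ _ _ _ _ _ _ _ _ _ _ μ₁ _ ν _ e D₁ T₁ he hD₁ hT₁ hDe hTe F hF 𝓕 h𝓕 hνF
    ev huniv φ hcard
  have hblock : IsCondLaw μ₁ D₁ T₁ (fun d t => ∏ i, q (d i) (t i)) :=
    IsCondLaw.of_map he hD₁ hT₁ ((h.pi n).congr (funext fun ω => funext fun i => (hTe ω i).symm)
      (funext fun ω => funext fun i => (hDe ω i).symm))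
  have hM : (0 : ℝ) < Fintype.card ℳ := by exact_mod_cast Fintype.card_pos
  have hS : (0 : ℝ) < Fintype.card 𝒮 := by exact_mod_cast Fintype.card_pos
  have hmain := log_card_sub_le_condEntropy_hash hblock hF h𝓕 hνF ev huniv φ
    (β := Real.exp (-(n * (δ / 2))) / Fintype.card ℳ) (by positivity) h0 (by linarith)
  refine le_trans ?_ hmain
  have hR := h.integral_sum_prod_rpow_le n (t := θ) (by rw [abs_of_pos h0]; exact h1)
  have hR' : ∫ ω, ∑ d : Fin n → 𝒟, (∏ i, q (d i) (T₁ ω i)) ^ (1 + θ) ∂μ₁ ≤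
      Real.exp (n * (-θ * H + 16 * Fintype.card 𝒟 * θ ^ 2)) := by
    rw [← he.map_eq, integral_map he.measurable.aemeasurable]
    · simpa only [hTe] using hR
    · refine (Finset.measurable_sum _ fun d _ => ?_).aestronglyMeasurable
      exact ((hblock.measurable d).comp hT₁).pow_const _
  have b1 : Fintype.card ℳ * (Real.exp (-(n * (δ / 2))) / Fintype.card ℳ) ≤
      Real.exp (-(n * (θ * (δ / 4)))) := by
    rw [mul_div_cancel₀ _ hM.ne', Real.exp_le_exp]
    have : 0 ≤ (n : ℝ) * δ * (1 / 2 - θ / 4) := mul_nonneg (by positivity) (by linarith)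
    linarith
  have b2 : ((Fintype.card 𝒮 : ℝ) / (Real.exp (-(n * (δ / 2))) / Fintype.card ℳ)) ^ θ ≤
      B * Real.exp (n * θ * (H - δ / 2)) := by
    have e1 : (Fintype.card 𝒮 : ℝ) / (Real.exp (-(n * (δ / 2))) / Fintype.card ℳ) ≤
        B * Real.exp (n * (H - δ / 2)) := by
      rw [div_div_eq_mul_div, div_le_iff₀ (Real.exp_pos _), mul_assoc, ← Real.exp_add]
      refine hcard.trans_eq ?_
      congr 2
      ring
    refine (Real.rpow_le_rpow (by positivity) e1 h0.le).trans ?_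
    rw [Real.mul_rpow (by linarith) (Real.exp_pos _).le, ← Real.exp_mul]
    have e2 : B ^ θ ≤ B := by
      calc B ^ θ ≤ B ^ (1 : ℝ) := Real.rpow_le_rpow_of_exponent_le hB (by linarith)
        _ = B := Real.rpow_one B
    have e3 : (n : ℝ) * (H - δ / 2) * θ = n * θ * (H - δ / 2) := by ring
    rw [e3]
    gcongr
  have b3 : ((Fintype.card 𝒮 : ℝ) / (Real.exp (-(n * (δ / 2))) / Fintype.card ℳ)) ^ θ / θ *
      ∫ ω, ∑ d : Fin n → 𝒟, (∏ i, q (d i) (T₁ ω i)) ^ (1 + θ) ∂μ₁ ≤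
      Real.exp (-(n * (θ * (δ / 4)))) * (B / θ) := by
    calc _ ≤ B * Real.exp (n * θ * (H - δ / 2)) / θ *
          Real.exp (n * (-θ * H + 16 * Fintype.card 𝒟 * θ ^ 2)) := by
          refine mul_le_mul (div_le_div_of_nonneg_right b2 h0.le) hR' ?_ (by positivity)
          exact integral_nonneg fun ω => Finset.sum_nonneg fun d _ =>
            Real.rpow_nonneg (hblock.nonneg d (T₁ ω)) _
      _ = Real.exp (n * θ * (H - δ / 2) + n * (-θ * H + 16 * Fintype.card 𝒟 * θ ^ 2)) *
          (B / θ) := by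
          rw [Real.exp_add]; ring
      _ ≤ _ := by
          have : 0 ≤ (n : ℝ) * θ * (δ / 4 - 16 * Fintype.card 𝒟 * θ) :=
            mul_nonneg (by positivity) (by linarith)
          have h5 : n * θ * (H - δ / 2) + n * (-θ * H + 16 * Fintype.card 𝒟 * θ ^ 2) ≤
              -(n * (θ * (δ / 4))) := by linarith
          have := Real.exp_le_exp.2 h5
          exact mul_le_mul_of_nonneg_right this (by positivity)
  have hlog : 0 ≤ Real.log (1 + (Fintype.card 𝒮 : ℝ)) := Real.log_nonneg (by linarith)
  have b4 := mul_le_mul_of_nonneg_right b1 hlog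
  linarith

theorem eventually_exp_neg_mul_le (α β : ℝ) {c η : ℝ} (hc : 0 < c) (hη : 0 < η) :
    ∀ᶠ n : ℕ in atTop, Real.exp (-(n * c)) * (α + β * n) ≤ η := by
  have hx : Tendsto (fun n : ℕ => (n : ℝ) * c) atTop atTop :=
    tendsto_natCast_atTop_atTop.atTop_mul_const hc
  have h0 := (Real.tendsto_pow_mul_exp_neg_atTop_nhds_zero 0).comp hx
  have h1 := (Real.tendsto_pow_mul_exp_neg_atTop_nhds_zero 1).comp hx
  have h2 := (h0.const_mul α).add (h1.const_mul (β / c))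
  simp only [mul_zero, add_zero] at h2
  filter_upwards [h2.eventually (gt_mem_nhds hη)] with n hn
  refine le_of_eq_of_le ?_ hn.le
  simp only [Function.comp_apply, pow_zero, pow_one]
  field_simp

/-! ### The single-letter rate -/

section SingleLetter

theorem measurable_receive {G : Type} [Add G] [MeasurableSpace G] [MeasurableAdd₂ G] :
    Measurable fun q : G × G × G × G => (q.1 + q.2.1, q.1 + q.2.2.1, q.1 + q.2.2.2) := by
  fun_prop

theorem isProbabilityMeasure_receivedLaw {G : Type} [Add G] [MeasurableSpace G] [MeasurableAdd₂ G]
    (P NA NB NE : Measure G) [IsProbabilityMeasure P] [IsProbabilityMeasure NA]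
    [IsProbabilityMeasure NB] [IsProbabilityMeasure NE] :
    IsProbabilityMeasure (receivedLaw P NA NB NE) :=
  Measure.isProbabilityMeasure_map measurable_receive.aemeasurable

variable (VA VB VE : ℝ≥0) {K : ℕ} (a : Fin K → ℝ) (L : Finset (Levels K))

instance : IsProbabilityMeasure (letterLaw VA VB VE) :=
  isProbabilityMeasure_receivedLaw _ _ _ _

theorem measurable_levels : Measurable (levels a) :=
  ((measurable_level a).comp measurable_fst).prodMk
    ((measurable_level a).comp (measurable_fst.comp measurable_snd))

theorem measurable_selX_levels :
    Measurable fun q : ℝ × ℝ × ℝ => selX VA VB VE a L (levels a q) q.1 := by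
  have h : Measurable fun p : ℝ × Levels K => selX VA VB VE a L p.2 p.1 :=
    measurable_from_prod_countable_left fun w => measurable_selX VA VB VE a L w
  exact h.comp (measurable_fst.prodMk (measurable_levels a))

theorem measurable_selY_levels :
    Measurable fun q : ℝ × ℝ × ℝ => selY VA VB VE a L (levels a q) q.2.1 := by
  have h : Measurable fun p : ℝ × Levels K => selY VA VB VE a L p.2 p.1 :=
    measurable_from_prod_countable_left fun w => measurable_selY VA VB VE a L w
  exact h.comp ((measurable_fst.comp measurable_snd).prodMk (measurable_levels a))

/-- The contribution of one pair of levels to `R^*`: Alice's bit, Bob's bit or no bit is kept, and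
the gain of the bit that is kept is the larger one and nonnegative. -/
theorem levelProb_mul_selected_gain (w : Levels K) :
    levelProb VA VB VE a w *
        (condEntropy (levelLaw VA VB VE a w)
            (fun q => (selX VA VB VE a L w q.1, selY VA VB VE a L w q.2.1)) (fun q => q.2.2) -
          condEntropy (levelLaw VA VB VE a w) (fun q => selX VA VB VE a L w q.1)
            (fun q => q.2.1) -
          condEntropy (levelLaw VA VB VE a w) (fun q => selY VA VB VE a L w q.2.1)
            (fun q => q.1)) =
      if w ∈ L then levelProb VA VB VE a w *
        max 0 (max (gainX VA VB VE a w) (gainY VA VB VE a w)) else 0 := by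
  by_cases hp : letterLaw VA VB VE (levels a ⁻¹' {w}) = 0
  · simp [levelProb, measureReal_def, hp]
  have hprob : IsProbabilityMeasure (levelLaw VA VB VE a w) := cond_isProbabilityMeasure hp
  have hx : Measurable fun q : ℝ × ℝ × ℝ => q.1 := measurable_fst
  have hy : Measurable fun q : ℝ × ℝ × ℝ => q.2.1 := measurable_fst.comp measurable_snd
  have hz : Measurable fun q : ℝ × ℝ × ℝ => q.2.2 := measurable_snd.comp measurable_snd
  by_cases hA : w ∈ setA VA VB VE a L
  · have hB : w ∉ setB VA VB VE a L := fun hB =>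
      absurd ((le_max_right 0 (gainX VA VB VE a w)).trans_lt hB.2)
        (not_lt.2 ((le_max_right 0 (gainY VA VB VE a w)).trans hA.2))
    have hmax : max 0 (max (gainX VA VB VE a w) (gainY VA VB VE a w)) = gainX VA VB VE a w := by
      have h1 := (le_max_left 0 (gainY VA VB VE a w)).trans hA.2
      have h2 := (le_max_right 0 (gainY VA VB VE a w)).trans hA.2
      rw [max_eq_left h2, max_eq_right h1]
    simp only [selX, selY, if_pos hA, if_neg hB, if_pos hA.1, hmax]
    rw [condEntropy_comp_injective (i := fun d : Fin 2 => (d, (0 : Fin 2)))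
      (fun _ _ h => (Prod.ext_iff.1 h).1) (fun q : ℝ × ℝ × ℝ => hard q.1),
      condEntropy_const _ hx, sub_zero, gainX]
  · by_cases hB : w ∈ setB VA VB VE a L
    · have hmax : max 0 (max (gainX VA VB VE a w) (gainY VA VB VE a w)) = gainY VA VB VE a w := by
        have h1 := (le_max_left 0 (gainX VA VB VE a w)).trans hB.2.le
        have h2 := (le_max_right 0 (gainX VA VB VE a w)).trans hB.2.le
        rw [max_eq_right h2, max_eq_right h1]
      simp only [selX, selY, if_neg hA, if_pos hB, if_pos hB.1, hmax]
      rw [condEntropy_comp_injective (i := fun d : Fin 2 => ((0 : Fin 2), d))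
        (fun _ _ h => (Prod.ext_iff.1 h).2) (fun q : ℝ × ℝ × ℝ => hard q.2.1),
        condEntropy_const _ hy, sub_zero, gainY]
    · simp only [selX, selY, if_neg hA, if_neg hB]
      rw [condEntropy_const _ hx, condEntropy_const _ hy, condEntropy_const _ hz]
      split_ifs with hL
      · have h1 : gainX VA VB VE a w < max 0 (gainY VA VB VE a w) :=
          not_le.1 fun h => hA ⟨hL, h⟩
        have h2 : gainY VA VB VE a w ≤ max 0 (gainX VA VB VE a w) :=
          not_lt.1 fun h => hB ⟨hL, h⟩
        have h3 : max 0 (max (gainX VA VB VE a w) (gainY VA VB VE a w)) = 0 := by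
          refine max_eq_left (max_le ?_ ?_)
          · rcases lt_max_iff.1 h1 with h | h
            · exact h.le
            · rcases le_max_iff.1 h2 with h' | h' <;> linarith
          · rcases le_max_iff.1 h2 with h | h
            · exact h
            · rcases lt_max_iff.1 h1 with h' | h' <;> linarith
        rw [h3]; simp
      · simp

theorem keyRateBound_eq_sum :
    keyRateBound VA VB VE a L = ∑ w ∈ L, levelProb VA VB VE a w *
      max 0 (max (gainX VA VB VE a w) (gainY VA VB VE a w)) := by
  have hy : Measurable fun q : ℝ × ℝ × ℝ => q.2.1 := measurable_fst.comp measurable_snd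
  have hz : Measurable fun q : ℝ × ℝ × ℝ => q.2.2 := measurable_snd.comp measurable_snd
  have hlev := measurable_levels a
  have hae : ∀ w, ∀ᵐ q ∂(levelLaw VA VB VE a w), levels a q = w := fun w => by
    have := ae_cond_mem (μ := letterLaw VA VB VE) (hlev (measurableSet_singleton w))
    exact this
  rw [keyRateBound, ambiguityEve, ambiguityX, ambiguityY,
    condEntropy_prod_finite (fun d => ((measurable_selX_levels VA VB VE a L).prodMk
      (measurable_selY_levels VA VB VE a L)) (measurableSet_singleton d)) hz hlev,
    condEntropy_prod_finite (fun d => (measurable_selX_levels VA VB VE a L)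
      (measurableSet_singleton d)) hy hlev,
    condEntropy_prod_finite (fun d => (measurable_selY_levels VA VB VE a L)
      (measurableSet_singleton d)) measurable_fst hlev,
    ← Finset.sum_sub_distrib, ← Finset.sum_sub_distrib]
  calc _ = ∑ w, if w ∈ L then levelProb VA VB VE a w *
        max 0 (max (gainX VA VB VE a w) (gainY VA VB VE a w)) else 0 := by
        refine Finset.sum_congr rfl fun w _ => ?_
        rw [← levelProb_mul_selected_gain, mul_sub, mul_sub]
        change levelProb VA VB VE a w * condEntropy (levelLaw VA VB VE a w) _ _ -
          levelProb VA VB VE a w * condEntropy (levelLaw VA VB VE a w) _ _ -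
          levelProb VA VB VE a w * condEntropy (levelLaw VA VB VE a w) _ _ = _
        congr 1
        · congr 1
          · congr 1
            refine condEntropy_congr_ae ?_
            filter_upwards [hae w] with q hq
            rw [hq]
          · congr 1
            refine condEntropy_congr_ae ?_
            filter_upwards [hae w] with q hq
            rw [hq]
        · congr 1
          refine condEntropy_congr_ae ?_
          filter_upwards [hae w] with q hq
          rw [hq]
    _ = _ := by rw [Finset.sum_ite_mem, Finset.univ_inter]

end SingleLetter

/-! ### The law of the proposed protocol -/

/-- The received block, read as three sequences instead of a sequence of triples. -/
def blockSplit (n : ℕ) (ω : Fin n → ℝ × ℝ × ℝ) : (Fin n → ℝ) × (Fin n → ℝ) × (Fin n → ℝ) :=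
  (fun i => (ω i).1, fun i => (ω i).2.1, fun i => (ω i).2.2)

theorem measurable_blockSplit (n : ℕ) : Measurable (blockSplit n) := by
  unfold blockSplit
  fun_prop

/-- The channel is memoryless: for i.i.d. signals the received block consists of i.i.d. triples. -/
theorem measurePreserving_blockSplit (n : ℕ) (VA VB VE : ℝ≥0) :
    MeasurePreserving (blockSplit n) (Measure.pi fun _ => letterLaw VA VB VE)
      (receivedLaw (Measure.pi fun _ : Fin n => signLaw) (noise n VA) (noise n VB)
        (noise n VE)) := by
  let NA := gaussianReal 0 VA
  let NB := gaussianReal 0 VB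
  let NE := gaussianReal 0 VE
  have h1 : MeasurePreserving
      (fun (ω : Fin n → ℝ × ℝ × ℝ × ℝ) i =>
        ((ω i).1 + (ω i).2.1, (ω i).1 + (ω i).2.2.1, (ω i).1 + (ω i).2.2.2))
      (Measure.pi fun _ => signLaw.prod (NA.prod (NB.prod NE)))
      (Measure.pi fun _ => letterLaw VA VB VE) :=
    measurePreserving_pi _ _ fun _ => ⟨measurable_receive, rfl⟩
  have a1 := measurePreserving_arrowProdEquivProdArrow ℝ ℝ (Fin n) (fun _ => NB) (fun _ => NE)
  have a2 := (MeasurePreserving.id (Measure.pi fun _ : Fin n => NA)).prod a1 |>.comp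
    (measurePreserving_arrowProdEquivProdArrow ℝ (ℝ × ℝ) (Fin n) (fun _ => NA)
      (fun _ => NB.prod NE))
  have a3 := (MeasurePreserving.id (Measure.pi fun _ : Fin n => signLaw)).prod a2 |>.comp
    (measurePreserving_arrowProdEquivProdArrow ℝ (ℝ × ℝ × ℝ) (Fin n) (fun _ => signLaw)
      (fun _ => NA.prod (NB.prod NE)))
  refine ⟨measurable_blockSplit n, ?_⟩
  rw [← h1.map_eq, Measure.map_map (measurable_blockSplit n) h1.measurable, receivedLaw]
  simp only [noise]
  change _ = Measure.map _ ((Measure.pi fun _ : Fin n => signLaw).prod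
    ((Measure.pi fun _ : Fin n => NA).prod ((Measure.pi fun _ : Fin n => NB).prod
      (Measure.pi fun _ : Fin n => NE))))
  rw [← a3.map_eq, Measure.map_map measurable_receive a3.measurable]
  rfl

section Protocol

variable (VA VB VE : ℝ≥0) {K : ℕ} (a : Fin K → ℝ) (L : Finset (Levels K)) {n mA mB s : ℕ}

/-- The three received blocks. -/
abbrev Blocks (n : ℕ) : Type := (Fin n → ℝ) × (Fin n → ℝ) × (Fin n → ℝ)

/-- `X_Δ^n` as a function of the received blocks. -/
noncomputable def bitsX (p : Blocks n) : Bits n :=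
  selXSeq VA VB VE a L (levelSeq a p.1) (levelSeq a p.2.1) p.1

/-- `Y_Δ^n` as a function of the received blocks. -/
noncomputable def bitsY (p : Blocks n) : Bits n :=
  selYSeq VA VB VE a L (levelSeq a p.1) (levelSeq a p.2.1) p.2.1

/-- A received block of one party together with both level sequences, letter by letter. -/
def withLevels (r : Fin n → ℝ) (wA wB : Fin n → Fin (K + 1)) : Fin n → ℝ × Levels K :=
  fun i => (r i, (wA i, wB i))

theorem measurable_bitsX : Measurable (bitsX VA VB VE a L (n := n)) := by
  refine measurable_pi_lambda _ fun i => ?_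
  have h : Measurable fun p : Blocks n => (p.1 i, p.2.1 i, p.2.2 i) := by fun_prop
  have e : (fun p : Blocks n => bitsX VA VB VE a L p i) = (fun q : ℝ × ℝ × ℝ =>
      selX VA VB VE a L (levels a q) q.1) ∘ fun p : Blocks n => (p.1 i, p.2.1 i, p.2.2 i) := by
    funext p
    simp only [bitsX, selXSeq, levelSeq, levels, Function.comp_apply]
  rw [e]
  exact (measurable_selX_levels VA VB VE a L).comp h

theorem measurable_bitsY : Measurable (bitsY VA VB VE a L (n := n)) := by
  refine measurable_pi_lambda _ fun i => ?_
  have h : Measurable fun p : Blocks n => (p.1 i, p.2.1 i, p.2.2 i) := by fun_prop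
  have e : (fun p : Blocks n => bitsY VA VB VE a L p i) = (fun q : ℝ × ℝ × ℝ =>
      selY VA VB VE a L (levels a q) q.2.1) ∘ fun p : Blocks n => (p.1 i, p.2.1 i, p.2.2 i) := by
    funext p
    simp only [bitsY, selYSeq, levelSeq, levels, Function.comp_apply]
  rw [e]
  exact (measurable_selY_levels VA VB VE a L).comp h

theorem measurable_withLevels {Ω : Type} [MeasurableSpace Ω] {r : Ω → Fin n → ℝ}
    {wA wB : Ω → Fin n → Fin (K + 1)} (hr : Measurable r) (hA : Measurable wA)
    (hB : Measurable wB) : Measurable fun ω => withLevels (r ω) (wA ω) (wB ω) :=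
  measurable_pi_lambda _ fun i => ((measurable_pi_apply i).comp hr).prodMk
    (((measurable_pi_apply i).comp hA).prodMk ((measurable_pi_apply i).comp hB))

/-- The code of the proposed protocol that consists of two source codes with side information. -/
noncomputable def sourceCode (encX : Bits n → Fin mA)
    (decX : Fin mA → (Fin n → ℝ × Levels K) → Bits n)
    (hX : ∀ k d, MeasurableSet {t | decX k t = d}) (encY : Bits n → Fin mB)
    (decY : Fin mB → (Fin n → ℝ × Levels K) → Bits n)
    (hY : ∀ k d, MeasurableSet {t | decY k t = d}) : Code n K mA mB where
  encA := encX
  encB := encY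
  decA m wA wB x := decY m (withLevels x wA wB)
  decA_meas m _ _ r :=
    (measurable_withLevels measurable_id measurable_const measurable_const) (hY m r)
  decB m wA wB y := decX m (withLevels y wA wB)
  decB_meas m _ _ r :=
    (measurable_withLevels measurable_id measurable_const measurable_const) (hX m r)

/-- The law of the received blocks when the satellite sends i.i.d. uniform signs. -/
noncomputable def blocksLaw (n : ℕ) : Measure (Blocks n) :=
  receivedLaw (Measure.pi fun _ : Fin n => signLaw) (noise n VA) (noise n VB) (noise n VE)

instance : IsProbabilityMeasure (blocksLaw VA VB VE n) := by
  have (V : ℝ≥0) : IsProbabilityMeasure (noise n V) := by unfold noise; infer_instance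
  exact isProbabilityMeasure_receivedLaw _ _ _ _

/-- The outcomes of the proposed protocol: the received blocks and the private randomness, which is
a hash function for Alice and trivial for Bob. -/
abbrev Outcome (n s : ℕ) : Type := Blocks n × (Hash n s × Unit)

/-- The values of the communication of the proposed protocol. -/
abbrev Communication (n K mA mB s : ℕ) : Type :=
  ((((Unit × (Fin n → Fin (K + 1))) × (Fin n → Fin (K + 1))) × Fin mA) × Fin mB) × Hash n s

variable (code : Code n K mA mB) (𝓕 : Finset (Hash n s)) (h𝓕 : 𝓕.Nonempty)

/-- The law of the outcomes of the proposed protocol. -/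
noncomputable def outcomeLaw : Measure (Outcome n s) :=
  (blocksLaw VA VB VE n).prod (((PMF.uniformOfFinset 𝓕 h𝓕).toMeasure).prod (Measure.dirac ()))

instance : IsProbabilityMeasure (outcomeLaw VA VB VE 𝓕 h𝓕) := by
  unfold outcomeLaw; infer_instance

/-- The communication of the proposed protocol. -/
noncomputable def communication (ω : Outcome n s) : Communication n K mA mB s :=
  ((((((), levelSeq a ω.1.1), levelSeq a ω.1.2.1), code.encA (bitsX VA VB VE a L ω.1)),
    code.encB (bitsY VA VB VE a L ω.1)), ω.2.1)

/-- Alice's decision about Bob's bits. -/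
noncomputable def decodedY (p : Blocks n) : Bits n :=
  code.decA (code.encB (bitsY VA VB VE a L p)) (levelSeq a p.1) (levelSeq a p.2.1) p.1

/-- Bob's decision about Alice's bits. -/
noncomputable def decodedX (p : Blocks n) : Bits n :=
  code.decB (code.encA (bitsX VA VB VE a L p)) (levelSeq a p.1) (levelSeq a p.2.1) p.2.1

theorem agrees_iff (ε : ℝ) :
    (proposedProtocol VA VB VE a L code 𝓕 h𝓕).Agrees VA VB VE ε ↔
      (outcomeLaw VA VB VE 𝓕 h𝓕).real {ω |
        ω.2.1 (bitsX VA VB VE a L ω.1, decodedY VA VB VE a L code ω.1) ≠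
          ω.2.1 (decodedX VA VB VE a L code ω.1, bitsY VA VB VE a L ω.1)} ≤ ε := Iff.rfl

theorem secure_iff (ε : ℝ) :
    (proposedProtocol VA VB VE a L code 𝓕 h𝓕).Secure VA VB VE ε ↔
      Real.logb 2 s - ε ≤ condEntropy (outcomeLaw VA VB VE 𝓕 h𝓕)
        (fun ω => ω.2.1 (bitsX VA VB VE a L ω.1, decodedY VA VB VE a L code ω.1))
        (fun ω => (communication VA VB VE a L code ω, ω.1.2.2)) := by
  have htop : ∀ m : MeasurableSpace (Communication n K mA mB s),
      @MeasurableSingletonClass _ m → ⊤ = m := fun m _ =>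
    le_antisymm (fun t _ => t.toFinite.measurableSet) le_top
  have h : (proposedProtocol VA VB VE a L code 𝓕 h𝓕).Secure VA VB VE ε ↔
      Real.logb 2 (Fintype.card (Fin s)) - ε ≤ @condEntropy _ _ _ _ _
        (@Prod.instMeasurableSpace (Communication n K mA mB s) _ ⊤ _)
        (outcomeLaw VA VB VE 𝓕 h𝓕)
        (fun ω => ω.2.1 (bitsX VA VB VE a L ω.1, decodedY VA VB VE a L code ω.1))
        (fun ω => (communication VA VB VE a L code ω, ω.1.2.2)) := Iff.rfl
  rw [h, htop _ inferInstance, Fintype.card_fin]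

theorem measurable_blocks_levelA : Measurable fun p : Blocks n => levelSeq a p.1 :=
  (measurable_levelSeq a).comp measurable_fst

theorem measurable_blocks_levelB : Measurable fun p : Blocks n => levelSeq a p.2.1 :=
  (measurable_levelSeq a).comp (measurable_fst.comp measurable_snd)

theorem measurable_communication : Measurable (communication VA VB VE a L code (s := s)) := by
  have hX := (measurable_of_finite code.encA).comp (measurable_bitsX VA VB VE a L)
  have hY := (measurable_of_finite code.encB).comp (measurable_bitsY VA VB VE a L)
  exact ((((measurable_const.prodMk ((measurable_blocks_levelA a).comp measurable_fst)).prodMk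
    ((measurable_blocks_levelB a).comp measurable_fst)).prodMk (hX.comp measurable_fst)).prodMk
      (hY.comp measurable_fst)).prodMk (measurable_fst.comp measurable_snd)

theorem measurable_decodedY : Measurable (decodedY VA VB VE a L code) := by
  have h1 : Measurable fun q : (Fin n → ℝ) × (Fin mB × (Fin n → Fin (K + 1)) ×
      (Fin n → Fin (K + 1))) => code.decA q.2.1 q.2.2.1 q.2.2.2 q.1 :=
    measurable_from_prod_countable_left fun c =>
      measurable_to_countable' fun r => code.decA_meas c.1 c.2.1 c.2.2 r
  exact h1.comp (measurable_fst.prodMk (((measurable_of_finite code.encB).comp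
    (measurable_bitsY VA VB VE a L)).prodMk
      ((measurable_blocks_levelA a).prodMk (measurable_blocks_levelB a))))

theorem measurable_hash_apply {Ω : Type} [MeasurableSpace Ω] {r : Ω → Bits n × Bits n}
    (hr : Measurable r) : Measurable fun ω : Ω × (Hash n s × Unit) => ω.2.1 (r ω.1) := by
  have h1 : Measurable fun q : (Bits n × Bits n) × Hash n s => q.2 q.1 :=
    measurable_of_finite _
  exact h1.comp ((hr.comp measurable_fst).prodMk (measurable_fst.comp measurable_snd))

theorem outcomeLaw_real_fst {A : Set (Blocks n)} (hA : MeasurableSet A) :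
    (outcomeLaw VA VB VE 𝓕 h𝓕).real (Prod.fst ⁻¹' A) = (blocksLaw VA VB VE n).real A :=
  measurePreserving_fst.measureReal_preimage hA.nullMeasurableSet

/-- Alice's key differs from the hash value of the selected bits with small probability only, so
that its entropy is almost that of the hash value. -/
theorem condEntropy_hash_le (t : ℝ) :
    condEntropy (outcomeLaw VA VB VE 𝓕 h𝓕)
        (fun ω => ω.2.1 (bitsX VA VB VE a L ω.1, bitsY VA VB VE a L ω.1))
        (fun ω => (communication VA VB VE a L code ω, ω.1.2.2)) * Real.log 2 ≤
      condEntropy (outcomeLaw VA VB VE 𝓕 h𝓕)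
        (fun ω => ω.2.1 (bitsX VA VB VE a L ω.1, decodedY VA VB VE a L code ω.1))
        (fun ω => (communication VA VB VE a L code ω, ω.1.2.2)) * Real.log 2 +
      ((outcomeLaw VA VB VE 𝓕 h𝓕).real {ω |
        ω.2.1 (bitsX VA VB VE a L ω.1, decodedY VA VB VE a L code ω.1) ≠
          ω.2.1 (bitsX VA VB VE a L ω.1, bitsY VA VB VE a L ω.1)} * (1 + t) +
        s * Real.exp (-1 - t)) := by
  have h := condEntropy_le_add_of_ne (μ := outcomeLaw VA VB VE 𝓕 h𝓕)
    (D := fun ω => ω.2.1 (bitsX VA VB VE a L ω.1, decodedY VA VB VE a L code ω.1))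
    (D' := fun ω => ω.2.1 (bitsX VA VB VE a L ω.1, bitsY VA VB VE a L ω.1))
    (T := fun ω => (communication VA VB VE a L code ω, ω.1.2.2))
    (fun d => (measurable_hash_apply ((measurable_bitsX VA VB VE a L).prodMk
      (measurable_decodedY VA VB VE a L code))) (measurableSet_singleton d))
    (fun d => (measurable_hash_apply ((measurable_bitsX VA VB VE a L).prodMk
      (measurable_bitsY VA VB VE a L))) (measurableSet_singleton d))
    ((measurable_communication VA VB VE a L code).prodMk
      (measurable_snd.comp (measurable_snd.comp measurable_fst))) t
  rwa [Fintype.card_fin] at h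

/-- Eve's observation consists of her block with the level sequences, the hash function and the two
messages. -/
theorem condEntropy_communication_eq {𝒟 : Type} [Fintype 𝒟] (μ : Measure (Outcome n s))
    (D : Outcome n s → 𝒟) :
    condEntropy μ D (fun ω => (communication VA VB VE a L code ω, ω.1.2.2)) =
      condEntropy μ D (fun ω =>
        ((withLevels ω.1.2.2 (levelSeq a ω.1.1) (levelSeq a ω.1.2.1), ω.2.1),
          (code.encA (bitsX VA VB VE a L ω.1), code.encB (bitsY VA VB VE a L ω.1)))) := by
  refine condEntropy_congr_comap
    (g := fun p : Communication n K mA mB s × (Fin n → ℝ) =>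
      ((withLevels p.2 p.1.1.1.1.1.2 p.1.1.1.1.2, p.1.2), (p.1.1.1.2, p.1.1.2)))
    (g' := fun p : ((Fin n → ℝ × Levels K) × Hash n s) × (Fin mA × Fin mB) =>
      (((((((), fun i => (p.1.1 i).2.1), fun i => (p.1.1 i).2.2), p.2.1), p.2.2), p.1.2),
        fun i => (p.1.1 i).1)) ?_ ?_ (fun ω => rfl) (fun ω => rfl)
  · refine Measurable.prodMk (Measurable.prodMk (measurable_withLevels ?_ ?_ ?_) ?_) ?_ <;> fun_prop
  · fun_prop

end Protocol

/-! ### Rates, and the existence of good codes -/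

section Rates

theorem lt_logb_div_of_exp_lt {x : ℝ} {n m : ℕ} (hn : 0 < n)
    (h : Real.exp (n * (x * Real.log 2)) < m) : x < Real.logb 2 m / n := by
  have hl : 0 < Real.log 2 := Real.log_pos one_lt_two
  have hn' : (0 : ℝ) < n := by exact_mod_cast hn
  have h1 := Real.log_lt_log (Real.exp_pos _) h
  rw [Real.log_exp] at h1
  rw [Real.logb, div_div, lt_div_iff₀ (by positivity)]
  linarith

theorem le_logb_div_of_exp_le {x : ℝ} {n m : ℕ} (hn : 0 < n)
    (h : Real.exp (n * (x * Real.log 2)) ≤ m) : x ≤ Real.logb 2 m / n := by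
  have hl : 0 < Real.log 2 := Real.log_pos one_lt_two
  have hn' : (0 : ℝ) < n := by exact_mod_cast hn
  have h1 := Real.log_le_log (Real.exp_pos _) h
  rw [Real.log_exp] at h1
  rw [Real.logb, div_div, le_div_iff₀ (by positivity)]
  linarith

theorem floor_exp_add_one_le {y : ℝ} (hy : 0 ≤ y) :
    ((⌊Real.exp y⌋₊ + 1 : ℕ) : ℝ) ≤ 2 * Real.exp y := by
  have h1 := Nat.floor_le (Real.exp_pos y).le
  have h2 := Real.one_le_exp hy
  push_cast
  linarith

theorem ceil_exp_le {y : ℝ} (hy : 0 ≤ y) : (⌈Real.exp y⌉₊ : ℝ) ≤ 2 * Real.exp y := by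
  have h1 := Nat.ceil_lt_add_one (Real.exp_pos y).le
  have h2 := Real.one_le_exp hy
  linarith

theorem ceil_exp_eq_one {y : ℝ} (hy : y ≤ 0) : ⌈Real.exp y⌉₊ = 1 := by
  rw [Nat.ceil_eq_iff one_ne_zero]
  have := Real.exp_pos y
  have := Real.exp_le_one_iff.2 hy
  norm_num
  constructor <;> assumption

theorem log_one_add_le_of_le {x y : ℝ} (hx : 0 ≤ x) (hy : 0 ≤ y) (h : x ≤ 2 * Real.exp y) :
    Real.log (1 + x) ≤ 2 + y := by
  have h1 := Real.one_le_exp hy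
  have h2 : (3 : ℝ) ≤ Real.exp 2 := by have := Real.add_one_le_exp 2; linarith
  have h3 : 1 + x ≤ Real.exp (2 + y) := by
    rw [Real.exp_add]
    nlinarith [Real.exp_pos y]
  have := Real.log_le_log (by linarith) h3
  rwa [Real.log_exp] at this

end Rates

section Main

variable (VA VB VE : ℝ≥0) {K : ℕ} (a : Fin K → ℝ) (L : Finset (Levels K))

theorem exists_condLaw_X : ∃ q : Fin 2 → ℝ × Levels K → ℝ, IsCondLaw (letterLaw VA VB VE)
    (fun q => selX VA VB VE a L (levels a q) q.1) (fun q => (q.2.1, levels a q)) q :=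
  exists_isCondLaw _ (fun d => measurable_selX_levels VA VB VE a L (measurableSet_singleton d))
    ((measurable_fst.comp measurable_snd).prodMk (measurable_levels a))

theorem exists_condLaw_Y : ∃ q : Fin 2 → ℝ × Levels K → ℝ, IsCondLaw (letterLaw VA VB VE)
    (fun q => selY VA VB VE a L (levels a q) q.2.1) (fun q => (q.1, levels a q)) q :=
  exists_isCondLaw _ (fun d => measurable_selY_levels VA VB VE a L (measurableSet_singleton d))
    (measurable_fst.prodMk (measurable_levels a))

theorem exists_condLaw_Eve : ∃ q : Fin 2 × Fin 2 → ℝ × Levels K → ℝ,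
    IsCondLaw (letterLaw VA VB VE)
      (fun q => (selX VA VB VE a L (levels a q) q.1, selY VA VB VE a L (levels a q) q.2.1))
      (fun q => (q.2.2, levels a q)) q :=
  exists_isCondLaw _ (fun d => (measurable_selX_levels VA VB VE a L).prodMk
      (measurable_selY_levels VA VB VE a L) (measurableSet_singleton d))
    ((measurable_snd.comp measurable_snd).prodMk (measurable_levels a))

theorem ambiguityX_nonneg : 0 ≤ ambiguityX VA VB VE a L :=
  condEntropy_nonneg ((measurable_fst.comp measurable_snd).prodMk (measurable_levels a))
    fun d => measurable_selX_levels VA VB VE a L (measurableSet_singleton d)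

theorem ambiguityY_nonneg : 0 ≤ ambiguityY VA VB VE a L :=
  condEntropy_nonneg (measurable_fst.prodMk (measurable_levels a))
    fun d => measurable_selY_levels VA VB VE a L (measurableSet_singleton d)

/-- Codes with exponentially small decoding errors at rates above the ambiguities of Bob and
Alice. -/
theorem exists_sourceCode {δ : ℝ} (hδ : 0 < δ) :
    ∃ c : ℝ, 0 < c ∧ ∀ n mA mB : ℕ,
      Real.exp (n * (ambiguityX VA VB VE a L * Real.log 2 + δ)) ≤ mA →
      Real.exp (n * (ambiguityY VA VB VE a L * Real.log 2 + δ)) ≤ mB →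
      ∃ code : Code n K mA mB,
        MeasurableSet {p | decodedX VA VB VE a L code p ≠ bitsX VA VB VE a L p} ∧
        MeasurableSet {p | decodedY VA VB VE a L code p ≠ bitsY VA VB VE a L p} ∧
        (blocksLaw VA VB VE n).real {p | decodedX VA VB VE a L code p ≠ bitsX VA VB VE a L p} ≤
          2 * Real.exp (-(n * c)) ∧
        (blocksLaw VA VB VE n).real {p | decodedY VA VB VE a L code p ≠ bitsY VA VB VE a L p} ≤
          2 * Real.exp (-(n * c)) := by
  obtain ⟨qX, hqX⟩ := exists_condLaw_X VA VB VE a L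
  obtain ⟨qY, hqY⟩ := exists_condLaw_Y VA VB VE a L
  obtain ⟨cX, hcX, hX⟩ := hqX.exists_block_code hδ
  obtain ⟨cY, hcY, hY⟩ := hqY.exists_block_code hδ
  refine ⟨min cX cY, lt_min hcX hcY, fun n mA mB hmA hmB => ?_⟩
  obtain ⟨encX, decX, hdecX, heX⟩ := hX n mA hmA
  obtain ⟨encY, decY, hdecY, heY⟩ := hY n mB hmB
  have hmX : MeasurableSet {p : Blocks n | decX (encX (bitsX VA VB VE a L p))
      (withLevels p.2.1 (levelSeq a p.1) (levelSeq a p.2.1)) ≠ bitsX VA VB VE a L p} :=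
    measurableSet_decoding_error
      (fun d => measurable_bitsX VA VB VE a L (measurableSet_singleton d))
      (measurable_withLevels (measurable_fst.comp measurable_snd) (measurable_blocks_levelA a)
        (measurable_blocks_levelB a)) encX hdecX
  have hmY : MeasurableSet {p : Blocks n | decY (encY (bitsY VA VB VE a L p))
      (withLevels p.1 (levelSeq a p.1) (levelSeq a p.2.1)) ≠ bitsY VA VB VE a L p} :=
    measurableSet_decoding_error
      (fun d => measurable_bitsY VA VB VE a L (measurableSet_singleton d))
      (measurable_withLevels measurable_fst (measurable_blocks_levelA a)
        (measurable_blocks_levelB a)) encY hdecY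
  have hmp := measurePreserving_blockSplit n VA VB VE
  refine ⟨sourceCode encX decX hdecX encY decY hdecY, hmX, hmY, ?_, ?_⟩
  · have h1 : (blocksLaw VA VB VE n).real _ = _ :=
      (hmp.measureReal_preimage hmX.nullMeasurableSet).symm
    refine h1.trans_le (heX.trans ?_)
    gcongr
    exact min_le_left _ _
  · have h1 : (blocksLaw VA VB VE n).real _ = _ :=
      (hmp.measureReal_preimage hmY.nullMeasurableSet).symm
    refine h1.trans_le (heY.trans ?_)
    gcongr
    exact min_le_right _ _

/-- The hash value of the selected bits is almost uniform given Eve's observation. -/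
theorem exists_hash_entropy_bound {δ : ℝ} (hδ : 0 < δ) :
    ∃ c A : ℝ, 0 < c ∧ ∀ (n mA mB s : ℕ) (code : Code n K mA mB) (𝓕 : Finset (Hash n s))
      (h𝓕 : 𝓕.Nonempty), IsTwoUniversal 𝓕 → 0 < s →
      (s : ℝ) * (mA * mB) ≤ 8 * Real.exp (n * (ambiguityEve VA VB VE a L * Real.log 2 - δ)) →
      Real.log s - Real.exp (-(n * c)) * (Real.log (1 + s) + A) ≤
        condEntropy (outcomeLaw VA VB VE 𝓕 h𝓕)
          (fun ω => ω.2.1 (bitsX VA VB VE a L ω.1, bitsY VA VB VE a L ω.1))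
          (fun ω => (communication VA VB VE a L code ω, ω.1.2.2)) * Real.log 2 := by
  obtain ⟨q, hq⟩ := exists_condLaw_Eve VA VB VE a L
  obtain ⟨c, A, hc, hmain⟩ := hq.exists_block_amplification hδ (B := 8) (by norm_num)
  refine ⟨c, A, hc, fun n mA mB s code 𝓕 h𝓕 huniv hs hcard => ?_⟩
  have : Nonempty (Fin s) := ⟨⟨0, hs⟩⟩
  have : Nonempty (Fin mA × Fin mB) := ⟨(code.encA 0, code.encB 0)⟩
  have hfst : (((PMF.uniformOfFinset 𝓕 h𝓕).toMeasure).prod (Measure.dirac ())).map Prod.fst =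
      (PMF.uniformOfFinset 𝓕 h𝓕).toMeasure := by
    rw [Measure.map_fst_prod]; simp
  have h := hmain n (ℳ := Fin mA × Fin mB) (𝒮 := Fin s) (𝓗 := Hash n s)
    (μ₁ := blocksLaw VA VB VE n) (D₁ := fun p i => (bitsX VA VB VE a L p i, bitsY VA VB VE a L p i))
    (T₁ := fun p => withLevels p.2.2 (levelSeq a p.1) (levelSeq a p.2.1))
    (measurePreserving_blockSplit n VA VB VE)
    (fun d => (measurable_pi_lambda _ fun i =>
      ((measurable_pi_apply i).comp (measurable_bitsX VA VB VE a L)).prodMk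
        ((measurable_pi_apply i).comp (measurable_bitsY VA VB VE a L)))
          (measurableSet_singleton d))
    (measurable_withLevels (measurable_snd.comp measurable_snd) (measurable_blocks_levelA a)
        (measurable_blocks_levelB a))
    (fun ω i => rfl) (fun ω i => rfl) measurable_fst h𝓕 hfst
    (fun f d => f (fun i => (d i).1, fun i => (d i).2))
    (fun r r' hrr => by
      rw [Fintype.card_fin]
      refine huniv _ _ fun heq => hrr (funext fun i => ?_)
      exact Prod.ext (congrFun (Prod.ext_iff.1 heq).1 i) (congrFun (Prod.ext_iff.1 heq).2 i))
    (fun d => (code.encA fun i => (d i).1, code.encB fun i => (d i).2))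
    (by
      rw [Fintype.card_prod, Fintype.card_fin, Fintype.card_fin, Fintype.card_fin]
      push_cast
      exact hcard)
  rw [Fintype.card_fin] at h
  rw [condEntropy_communication_eq]
  exact h

/-- The proposed protocol works at every key rate below `R^*`, with message rates just above the
ambiguities. The number of keys is rounded up so that it never vanishes; for `R^* ≤ ε` it is `1`. -/
theorem eventually_exists_good_code {ε : ℝ} (hε : 0 < ε) : ∀ᶠ n : ℕ in atTop,
    ∃ (mA mB s : ℕ) (code : Code n K mA mB), 0 < s ∧
      ambiguityX VA VB VE a L < Real.logb 2 mA / n ∧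
      ambiguityY VA VB VE a L < Real.logb 2 mB / n ∧
      keyRateBound VA VB VE a L - ε ≤ Real.logb 2 s / n ∧
      ∀ (𝓕 : Finset (Hash n s)) (h𝓕 : 𝓕.Nonempty), IsTwoUniversal 𝓕 →
        (proposedProtocol VA VB VE a L code 𝓕 h𝓕).Agrees VA VB VE ε ∧
        (proposedProtocol VA VB VE a L code 𝓕 h𝓕).Secure VA VB VE ε := by
  have hl : 0 < Real.log 2 := Real.log_pos one_lt_two
  set ln2 := Real.log 2 with hln2
  -- the excess of the message rates, in nats
  set δ := ε * ln2 / 8 with hδdef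
  have hδ : 0 < δ := by positivity
  obtain ⟨c₁, hc₁, hcode⟩ := exists_sourceCode VA VB VE a L hδ
  obtain ⟨c₂, A, hc₂, hhash⟩ := exists_hash_entropy_bound VA VB VE a L
    (δ := ε * ln2 / 2) (by positivity)
  set r := (keyRateBound VA VB VE a L - ε) * ln2 with hr
  have hc : 0 < min c₁ (min c₂ 1) := lt_min hc₁ (lt_min hc₂ one_pos)
  set c := min c₁ (min c₂ 1) with hcdef
  filter_upwards [eventually_exp_neg_mul_le 4 0 hc hε,
    eventually_exp_neg_mul_le (9 + |A|) (3 * |r| + 2) hc (mul_pos hε hl),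
    eventually_gt_atTop 0] with n hn1 hn2 hn0
  have hX0 := mul_nonneg (ambiguityX_nonneg VA VB VE a L) hl.le
  have hY0 := mul_nonneg (ambiguityY_nonneg VA VB VE a L) hl.le
  set hX := ambiguityX VA VB VE a L * ln2 with hXdef
  set hY := ambiguityY VA VB VE a L * ln2 with hYdef
  have hn' : (0 : ℝ) < n := by exact_mod_cast hn0
  have hmA : Real.exp (n * (hX + δ)) < (⌊Real.exp (n * (hX + δ))⌋₊ + 1 : ℕ) := by
    push_cast; exact Nat.lt_floor_add_one _
  have hmB : Real.exp (n * (hY + δ)) < (⌊Real.exp (n * (hY + δ))⌋₊ + 1 : ℕ) := by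
    push_cast; exact Nat.lt_floor_add_one _
  have hmA2 := floor_exp_add_one_le (y := n * (hX + δ)) (by positivity)
  have hmB2 := floor_exp_add_one_le (y := n * (hY + δ)) (by positivity)
  set mA := ⌊Real.exp (n * (hX + δ))⌋₊ + 1
  set mB := ⌊Real.exp (n * (hY + δ))⌋₊ + 1
  obtain ⟨code, hmeasX, hmeasY, herrX, herrY⟩ := hcode n mA mB hmA.le hmB.le
  have hs1 : Real.exp (n * r) ≤ (⌈Real.exp (n * r)⌉₊ : ℕ) := Nat.le_ceil _
  have hs0 : 0 < ⌈Real.exp (n * r)⌉₊ := Nat.ceil_pos.2 (Real.exp_pos _)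
  have hs2 : r ≤ 0 → ⌈Real.exp (n * r)⌉₊ = 1 := fun h =>
    ceil_exp_eq_one (mul_nonpos_of_nonneg_of_nonpos hn'.le h)
  have hs3 : 0 ≤ r → (⌈Real.exp (n * r)⌉₊ : ℝ) ≤ 2 * Real.exp (n * r) := fun h =>
    ceil_exp_le (by positivity)
  set s := ⌈Real.exp (n * r)⌉₊
  have hexpc : ∀ c', c ≤ c' → Real.exp (-(n * c')) ≤ Real.exp (-(n * c)) := fun c' h => by
    gcongr
  have hE1 := hexpc c₁ (min_le_left _ _)
  have hE2 := hexpc c₂ ((min_le_right _ _).trans (min_le_left _ _))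
  have hE3 := hexpc 1 ((min_le_right _ _).trans (min_le_right _ _))
  set E := Real.exp (-(n * c)) with hE
  have hE0 : 0 < E := Real.exp_pos _
  refine ⟨mA, mB, s, code, hs0, lt_logb_div_of_exp_lt hn0 (lt_of_le_of_lt ?_ hmA),
    lt_logb_div_of_exp_lt hn0 (lt_of_le_of_lt ?_ hmB), le_logb_div_of_exp_le hn0 hs1,
    fun 𝓕 h𝓕 huniv => ⟨?_, ?_⟩⟩
  · rw [Real.exp_le_exp]
    exact mul_le_mul_of_nonneg_left (by linarith) hn'.le
  · rw [Real.exp_le_exp]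
    exact mul_le_mul_of_nonneg_left (by linarith) hn'.le
  · rw [agrees_iff]
    calc _ ≤ (outcomeLaw VA VB VE 𝓕 h𝓕).real (Prod.fst ⁻¹'
          ({p | decodedX VA VB VE a L code p ≠ bitsX VA VB VE a L p} ∪
            {p | decodedY VA VB VE a L code p ≠ bitsY VA VB VE a L p})) := by
          refine measureReal_mono fun ω hω => ?_
          by_contra hcon
          simp only [Set.mem_preimage, Set.mem_union, Set.mem_ofPred_eq, not_or, not_not] at hcon
          exact hω (by rw [hcon.1, hcon.2])
      _ ≤ 2 * Real.exp (-(n * c₁)) + 2 * Real.exp (-(n * c₁)) := by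
          rw [outcomeLaw_real_fst VA VB VE 𝓕 h𝓕 (hmeasX.union hmeasY)]
          exact (measureReal_union_le _ _).trans (add_le_add herrX herrY)
      _ ≤ E * (4 + 0 * n) := by linarith
      _ ≤ ε := hn1
  · rw [secure_iff]
    rcases le_or_gt r 0 with hr0 | hr0
    · -- the key is trivial
      have h1 : 0 ≤ condEntropy (outcomeLaw VA VB VE 𝓕 h𝓕)
          (fun ω => ω.2.1 (bitsX VA VB VE a L ω.1, decodedY VA VB VE a L code ω.1))
          (fun ω => (communication VA VB VE a L code ω, ω.1.2.2)) :=
        condEntropy_nonneg ((measurable_communication VA VB VE a L code).prodMk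
          (measurable_snd.comp (measurable_snd.comp measurable_fst)))
          fun d => (measurable_hash_apply ((measurable_bitsX VA VB VE a L).prodMk
            (measurable_decodedY VA VB VE a L code))) (measurableSet_singleton d)
      have h2 : Real.logb 2 (s : ℝ) = 0 := by rw [hs2 hr0]; simp
      linarith
    · have hs3' := hs3 hr0.le
      have hs' : (1 : ℝ) ≤ s := by exact_mod_cast hs0
      have hcard : (s : ℝ) * (mA * mB) ≤
          8 * Real.exp (n * (ambiguityEve VA VB VE a L * ln2 - ε * ln2 / 2)) := by
        calc (s : ℝ) * (mA * mB) ≤ 2 * Real.exp (n * r) *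
              (2 * Real.exp (n * (hX + δ)) * (2 * Real.exp (n * (hY + δ)))) := by gcongr
          _ = 8 * Real.exp (n * r + (n * (hX + δ) + n * (hY + δ))) := by
              rw [Real.exp_add, Real.exp_add]; ring
          _ ≤ _ := by
              have e : n * r + (n * (hX + δ) + n * (hY + δ)) =
                  n * (ambiguityEve VA VB VE a L * ln2 - 3 / 4 * (ε * ln2)) := by
                rw [hr, hXdef, hYdef, hδdef, keyRateBound]; ring
              rw [e]
              have : 0 < ε * ln2 := by positivity
              gcongr
              linarith
      have hH := hhash n mA mB s code 𝓕 h𝓕 huniv hs0 hcard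
      have hlog1 : 0 ≤ Real.log s := Real.log_nonneg hs'
      have hlog2 := log_one_add_le_of_le (by linarith) (by positivity) hs3'
      have hlog3 : Real.log s ≤ Real.log (1 + s) := Real.log_le_log (by linarith) (by linarith)
      -- the slope `log s + n` makes the `s` tangent intercepts negligible
      have hF := condEntropy_hash_le VA VB VE a L code 𝓕 h𝓕 (Real.log s + n)
      have hp : (outcomeLaw VA VB VE 𝓕 h𝓕).real {ω |
          ω.2.1 (bitsX VA VB VE a L ω.1, decodedY VA VB VE a L code ω.1) ≠
            ω.2.1 (bitsX VA VB VE a L ω.1, bitsY VA VB VE a L ω.1)} ≤ 2 * E := by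
        calc _ ≤ (outcomeLaw VA VB VE 𝓕 h𝓕).real (Prod.fst ⁻¹'
              {p | decodedY VA VB VE a L code p ≠ bitsY VA VB VE a L p}) := by
              refine measureReal_mono fun ω hω => ?_
              by_contra hcon
              simp only [Set.mem_preimage, Set.mem_ofPred_eq, not_not] at hcon
              exact hω (by rw [hcon])
          _ ≤ 2 * E := by
              rw [outcomeLaw_real_fst VA VB VE 𝓕 h𝓕 hmeasY]
              linarith
      have hq : (s : ℝ) * Real.exp (-1 - (Real.log s + n)) ≤ E := by
        have e : -1 - (Real.log s + n) = -Real.log s + (-(n * 1) + -1) := by ring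
        rw [e, Real.exp_add, Real.exp_neg (Real.log s), Real.exp_log (by linarith),
          mul_inv_cancel_left₀ (by linarith), Real.exp_add]
        have h1 : Real.exp (-1) ≤ 1 := Real.exp_le_one_iff.2 (by norm_num)
        calc Real.exp (-(n * 1)) * Real.exp (-1) ≤ Real.exp (-(n * 1)) * 1 := by gcongr
          _ ≤ E := by linarith
      have hp' := mul_le_mul_of_nonneg_right hp (show 0 ≤ 1 + (Real.log s + n) by positivity)
      have hrn : (n : ℝ) * r = |r| * n := by rw [abs_of_pos hr0]; ring
      have hA : Real.exp (-(n * c₂)) * (Real.log (1 + s) + A) ≤ E * (2 + |r| * n + |A|) := by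
        have : Real.log (1 + s) + A ≤ 2 + |r| * n + |A| := by
          rw [← hrn]; linarith [le_abs_self A]
        calc _ ≤ Real.exp (-(n * c₂)) * (2 + |r| * n + |A|) := by gcongr
          _ ≤ _ := by gcongr
      have hp2 : 2 * E * (1 + (Real.log s + n)) ≤ 2 * E * (1 + (2 + |r| * n + n)) := by
        rw [hrn] at hlog2
        gcongr
        linarith
      have htot : Real.log s - ε * ln2 ≤ condEntropy (outcomeLaw VA VB VE 𝓕 h𝓕)
          (fun ω => ω.2.1 (bitsX VA VB VE a L ω.1, decodedY VA VB VE a L code ω.1))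
          (fun ω => (communication VA VB VE a L code ω, ω.1.2.2)) * ln2 := by
        have hfin : E * (2 + |r| * n + |A|) + 2 * E * (1 + (2 + |r| * n + n)) + E =
            E * (9 + |A| + (3 * |r| + 2) * n) := by ring
        linarith
      have := div_le_div_of_nonneg_right htot hl.le
      rw [mul_div_cancel_right₀ _ hl.ne', sub_div, mul_div_cancel_right₀ _ hl.ne'] at this
      exact this

/-- The family of all hash functions is two-universal. -/
theorem isTwoUniversal_univ {n s : ℕ} (hs : 0 < s) :
    IsTwoUniversal (Finset.univ : Finset (Hash n s)) := by
  classical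
  intro r r' hrr
  have hs' : (0 : ℝ) < s := by exact_mod_cast hs
  have : Nonempty (Fin s) := ⟨⟨0, hs⟩⟩
  have h := card_filter_apply_eq_mul (m := s) hrr
  have hN : (0 : ℝ) < Fintype.card (Hash n s) := by exact_mod_cast Fintype.card_pos
  rw [Finset.card_univ, div_le_div_iff₀ hN hs', one_mul]
  refine le_of_eq ?_
  have h' : ((Finset.univ.filter fun e : Hash n s => e r = e r').card : ℝ) * s =
      Fintype.card (Hash n s) := by exact_mod_cast h
  convert h'

theorem achievable_keyRateBound : Achievable VA VB VE (keyRateBound VA VB VE a L) := by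
  intro ε hε
  filter_upwards [eventually_exists_good_code VA VB VE a L hε] with n hn
  obtain ⟨mA, mB, s, code, hs, -, -, hrate, hgood⟩ := hn
  have : Nonempty (Fin s) := ⟨⟨0, hs⟩⟩
  obtain ⟨h1, h2⟩ := hgood Finset.univ Finset.univ_nonempty (isTwoUniversal_univ hs)
  refine ⟨_, h1, h2, ?_⟩
  have h3 : (proposedProtocol VA VB VE a L code Finset.univ Finset.univ_nonempty).rate =
      Real.logb 2 (Fintype.card (Fin s)) / n := rfl
  rw [h3, Fintype.card_fin]
  exact hrate

end Main

end GaussianMaurer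

open GaussianMaurer in
theorem theorem1 (VA VB VE : ℝ≥0) (hVA : 0 < VA) (hVB : 0 < VB) (hVE : 0 < VE)
    {K : ℕ} (a : Fin K → ℝ) (ha_pos : ∀ j, 0 < a j) (ha_mono : Monotone a)
    (L : Finset (Levels K)) :
    (∀ ε : ℝ, 0 < ε → ∀ᶠ n : ℕ in atTop,
      ∃ (mA mB s : ℕ) (code : Code n K mA mB), 0 < s ∧
        ambiguityX VA VB VE a L < Real.logb 2 mA / n ∧
        ambiguityY VA VB VE a L < Real.logb 2 mB / n ∧
        keyRateBound VA VB VE a L - ε ≤ Real.logb 2 s / n ∧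
        ∀ (𝓕 : Finset (Hash n s)) (h𝓕 : 𝓕.Nonempty), IsTwoUniversal 𝓕 →
          (proposedProtocol VA VB VE a L code 𝓕 h𝓕).Agrees VA VB VE ε ∧
          (proposedProtocol VA VB VE a L code 𝓕 h𝓕).Secure VA VB VE ε) ∧
    ((keyRateBound VA VB VE a L : ℝ) : EReal) ≤ secretKeyRate VA VB VE ∧
    keyRateBound VA VB VE a L =
      ∑ w ∈ L, levelProb VA VB VE a w *
        max 0 (max (gainX VA VB VE a w) (gainY VA VB VE a w)) :=
  ⟨fun _ hε => eventually_exists_good_code VA VB VE a L hε,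
    le_sSup ⟨_, achievable_keyRateBound VA VB VE a L, rfl⟩, keyRateBound_eq_sum VA VB VE a L⟩
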